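/- Let $k$ be an algebraically closed field of characteristic zero (for instance $k=\mathbb C$), and let $A$ and $B$ be cosemisimple Hopf algebras over $k$. Let $A*B$ be their free product (the coproduct of unital $k$-algebras, with the Hopf algebra structure extending those of $A$ and $B$), so that $A$ and $B$ are Hopf subalgebras of $A*B$. For a Hopf algebra $H$, let $\mathcal{YD}_H^H$ be the abelian category of right-right Yetter–Drinfeld modules over $H$, i.e. right $H$-modules and right $H$-comodules $V$ such that $$(v\cdot a)_{(0)}\otimes (v\cdot a)_{(1)} = v_{(0)}\cdot a_{(2)}\otimes S(a_{(1)})v_{(1)}a_{(3)}\qquad (v\in V,\ a\in H),$$ with the $H$-linear and $H$-colinear maps as morphisms, and define Gerstenhaber–Schack cohomology by $$H^n_{\rm GS}(H,V)=\operatorname{Ext}^n_{\mathcal{YD}_H^H}(k,V),$$ where $k$ is the trivial Yetter–Drinfeld module. For a Hopf subalgebra $L\subset H$ and $V\in\mathcal{YD}_H^H$, let $$V^{(L)}=\{v\in V \mid v_{(0)}\otimes v_{(1)}\in V\otimes L\},$$ which is a Yetter–Drinfeld module over $L$ with the induced action and coaction; this defines the restriction functor $\mathcal{YD}_H^H\to\mathcal{YD}_L^L$.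 Then for every $n\ge 2$ and every Yetter–Drinfeld module $M$ over $A*B$ there is a $k$-linear isomorphism, natural in $M$, $$H^n_{\rm GS}(A*B,M)\simeq H^n_{\rm GS}(A,M^{(A)})\oplus H^n_{\rm GS}(B,M^{(B)}).$$ -/

import Mathlib

open TensorProduct CategoryTheory CategoryTheory.Limits

universe u

noncomputable section

/-! ### Free products of Hopf algebras -/

/-- The two-element family of types `A`, `B`. -/
def pairFam (A B : Type u) : Bool → Type u
  | true => A
  | false => B

instance pairFamRing (A B : Type u) [Ring A] [Ring B] : ∀ i, Ring (pairFam A B i)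
  | true => inferInstanceAs (Ring A)
  | false => inferInstanceAs (Ring B)

instance pairFamAlgebra (k A B : Type u) [Field k] [Ring A] [Ring B] [Algebra k A] [Algebra k B] :
    ∀ i, Algebra k (pairFam A B i)
  | true => inferInstanceAs (Algebra k A)
  | false => inferInstanceAs (Algebra k B)

/-- The free product (coproduct of unital algebras) `A * B` over `k`. -/
def FreeProd (k A B : Type u) [Field k] [Ring A] [Ring B] [Algebra k A] [Algebra k B] : Type u :=
  LinearAlgebra.FreeProduct k (pairFam A B)

namespace FreeProd

section Alg

variable (k A B : Type u) [Field k] [Ring A] [Ring B] [Algebra k A] [Algebra k B]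

instance : Ring (FreeProd k A B) :=
  inferInstanceAs (Ring (LinearAlgebra.FreeProduct.ringCon k (pairFam A B)).Quotient)

instance : Algebra k (FreeProd k A B) :=
  inferInstanceAs (Algebra k (LinearAlgebra.FreeProduct.ringCon k (pairFam A B)).Quotient)

/-- The canonical map `A → A * B`. -/
def inl : A →ₐ[k] FreeProd k A B := LinearAlgebra.FreeProduct.ι k (pairFam A B) true

/-- The canonical map `B → A * B`. -/
def inr : B →ₐ[k] FreeProd k A B := LinearAlgebra.FreeProduct.ι k (pairFam A B) false

variable {k A B} {C : Type u} [Ring C] [Algebra k C]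

/-- Two algebra maps as a map from the family. -/
def pairMap (f : A →ₐ[k] C) (g : B →ₐ[k] C) : (i : Bool) → pairFam A B i →ₐ[k] C
  | true => f
  | false => g

/-- The universal property of the free product: existence. -/
def lift (f : A →ₐ[k] C) (g : B →ₐ[k] C) : FreeProd k A B →ₐ[k] C :=
  LinearAlgebra.FreeProduct.lift k (pairFam A B) (fun {i} => pairMap f g i)

theorem lift_comp_inl (f : A →ₐ[k] C) (g : B →ₐ[k] C) : (lift f g).comp (inl k A B) = f :=
  LinearAlgebra.FreeProduct.lift_comp_ι k (pairFam A B) (fun {i} => pairMap f g i) (i := true)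

theorem lift_comp_inr (f : A →ₐ[k] C) (g : B →ₐ[k] C) : (lift f g).comp (inr k A B) = g :=
  LinearAlgebra.FreeProduct.lift_comp_ι k (pairFam A B) (fun {i} => pairMap f g i) (i := false)

/-- The universal property of the free product: uniqueness. -/
theorem hom_ext {f g : FreeProd k A B →ₐ[k] C}
    (hl : f.comp (inl k A B) = g.comp (inl k A B))
    (hr : f.comp (inr k A B) = g.comp (inr k A B)) : f = g := by
  have key : ∀ h : FreeProd k A B →ₐ[k] C, (∀ i : Bool,
      h.comp (LinearAlgebra.FreeProduct.ι k (pairFam A B) i) =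
        pairMap (g.comp (inl k A B)) (g.comp (inr k A B)) i) →
      h = lift (g.comp (inl k A B)) (g.comp (inr k A B)) := fun h hh =>
    LinearAlgebra.FreeProduct.lift_unique k (pairFam A B)
      (fun {i} => pairMap (g.comp (inl k A B)) (g.comp (inr k A B)) i) h hh
  refine (key f ?_).trans (key g ?_).symm
  · rintro (_ | _)
    · exact hr
    · exact hl
  · rintro (_ | _) <;> rfl

@[simp] theorem lift_inl (f : A →ₐ[k] C) (g : B →ₐ[k] C) (a : A) :
    lift f g (inl k A B a) = f a := DFunLike.congr_fun (lift_comp_inl f g) a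

@[simp] theorem lift_inr (f : A →ₐ[k] C) (g : B →ₐ[k] C) (b : B) :
    lift f g (inr k A B b) = g b := DFunLike.congr_fun (lift_comp_inr f g) b

/-- Induction principle: the free product is generated by the images of `A` and `B`. -/
theorem induction {p : FreeProd k A B → Prop} (hl : ∀ a, p (inl k A B a))
    (hr : ∀ b, p (inr k A B b)) (hadd : ∀ x y, p x → p y → p (x + y))
    (hmul : ∀ x y, p x → p y → p (x * y)) (x : FreeProd k A B) : p x := by
  have halg : ∀ r : k, p (algebraMap k _ r) := fun r => by
    rw [← AlgHom.commutes (inl k A B) r]; exact hl _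
  let S : Subalgebra k (FreeProd k A B) :=
    { carrier := {y | p y}
      mul_mem' := fun {a b} ha hb => hmul a b ha hb
      add_mem' := fun {a b} ha hb => hadd a b ha hb
      algebraMap_mem' := halg }
  let f : FreeProd k A B →ₐ[k] S :=
    lift ((inl k A B).codRestrict S hl) ((inr k A B).codRestrict S hr)
  have h : S.val.comp f = AlgHom.id k _ := by
    apply hom_ext <;> ext a <;> simp [f]
  have := (f x).2
  have h2 : ((f x : S) : FreeProd k A B) = x := DFunLike.congr_fun h x
  rw [h2] at this
  exact this

end Alg

section Hopf

variable (k A B : Type u) [Field k] [Ring A] [Ring B]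

/-- `Δ : A * B → (A * B) ⊗ (A * B)`, extending the comultiplications of the factors. -/
def comulHom [Bialgebra k A] [Bialgebra k B] :
    FreeProd k A B →ₐ[k] FreeProd k A B ⊗[k] FreeProd k A B :=
  lift ((Algebra.TensorProduct.map (inl k A B) (inl k A B)).comp (Bialgebra.comulAlgHom k A))
    ((Algebra.TensorProduct.map (inr k A B) (inr k A B)).comp (Bialgebra.comulAlgHom k B))

/-- `ε : A * B → k`, extending the counits of the factors. -/
def counitHom [Bialgebra k A] [Bialgebra k B] : FreeProd k A B →ₐ[k] k :=
  lift (Bialgebra.counitAlgHom k A) (Bialgebra.counitAlgHom k B)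

/-- `S : A * B → (A * B)ᵐᵒᵖ`, extending the antipodes of the factors. -/
def antipodeHom [HopfAlgebra k A] [HopfAlgebra k B] : FreeProd k A B →ₐ[k] (FreeProd k A B)ᵐᵒᵖ :=
  lift ((AlgHom.op (inl k A B)).comp (HopfAlgebra.antipodeAlgHomOp k A))
    ((AlgHom.op (inr k A B)).comp (HopfAlgebra.antipodeAlgHomOp k B))

section aux

variable {k A} {H : Type u} [Bialgebra k A] [Ring H] [Algebra k H] {i : A →ₐ[k] H}
  {D : H →ₐ[k] H ⊗[k] H} {E : H →ₐ[k] k}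

theorem aux_coassoc
    (hD : D.comp i = (Algebra.TensorProduct.map i i).comp (Bialgebra.comulAlgHom k A)) :
    (((Algebra.TensorProduct.assoc k k k H H H).toAlgHom.comp
      ((Algebra.TensorProduct.map D (.id k H)).comp D)).comp i) =
    ((Algebra.TensorProduct.map (.id k H) D).comp D).comp i := by
  have hD' : ∀ a, D (i a) = TensorProduct.map i.toLinearMap i.toLinearMap (Coalgebra.comul a) :=
    fun a => DFunLike.congr_fun hD a
  have h1 : ∀ t : A ⊗[k] A, Algebra.TensorProduct.assoc k k k H H H
      (Algebra.TensorProduct.map D (.id k H)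
        (TensorProduct.map i.toLinearMap i.toLinearMap t)) =
      TensorProduct.map i.toLinearMap (TensorProduct.map i.toLinearMap i.toLinearMap)
        (TensorProduct.assoc k A A A (Coalgebra.comul.rTensor A t)) := by
    intro t
    induction t with
    | zero => simp
    | add x y hx hy => simp only [map_add, hx, hy]
    | tmul x y =>
      simp only [map_tmul, AlgHom.toLinearMap_apply, Algebra.TensorProduct.map_tmul, hD',
        LinearMap.rTensor_tmul, AlgHom.coe_id, id_eq]
      generalize (Coalgebra.comul x : A ⊗[k] A) = s
      induction s with
      | zero => simp
      | add x y hx hy => simp only [map_add, add_tmul, hx, hy]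
      | tmul x y => simp
  have h2 : ∀ t : A ⊗[k] A, Algebra.TensorProduct.map (.id k H) D
        (TensorProduct.map i.toLinearMap i.toLinearMap t) =
      TensorProduct.map i.toLinearMap (TensorProduct.map i.toLinearMap i.toLinearMap)
        (Coalgebra.comul.lTensor A t) := by
    intro t
    induction t with
    | zero => simp
    | add x y hx hy => simp only [map_add, hx, hy]
    | tmul x y => simp [hD']
  ext a
  simp only [AlgHom.comp_apply, hD']
  rw [h2, ← Coalgebra.coassoc_apply, ← h1]
  rfl

theorem aux_rTensor
    (hD : D.comp i = (Algebra.TensorProduct.map i i).comp (Bialgebra.comulAlgHom k A))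
    (hE : E.comp i = Bialgebra.counitAlgHom k A) :
    (((Algebra.TensorProduct.map E (.id k H)).comp D).comp i) =
    ((Algebra.TensorProduct.lid k H).symm : H →ₐ[k] k ⊗[k] H).comp i := by
  have hD' : ∀ a, D (i a) = TensorProduct.map i.toLinearMap i.toLinearMap (Coalgebra.comul a) :=
    fun a => DFunLike.congr_fun hD a
  have hE' : ∀ a, E (i a) = Coalgebra.counit a := fun a => DFunLike.congr_fun hE a
  have h1 : ∀ t : A ⊗[k] A, Algebra.TensorProduct.map E (.id k H)
      (TensorProduct.map i.toLinearMap i.toLinearMap t) =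
      i.toLinearMap.lTensor k (Coalgebra.counit.rTensor A t) := by
    intro t
    induction t with
    | zero => simp
    | add x y hx hy => simp only [map_add, hx, hy]
    | tmul x y => simp [hE']
  ext a
  simp only [AlgHom.comp_apply, hD', h1, Coalgebra.rTensor_counit_comul]
  simp

theorem aux_lTensor
    (hD : D.comp i = (Algebra.TensorProduct.map i i).comp (Bialgebra.comulAlgHom k A))
    (hE : E.comp i = Bialgebra.counitAlgHom k A) :
    (((Algebra.TensorProduct.map (.id k H) E).comp D).comp i) =
    ((Algebra.TensorProduct.rid k k H).symm : H →ₐ[k] H ⊗[k] k).comp i := by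
  have hD' : ∀ a, D (i a) = TensorProduct.map i.toLinearMap i.toLinearMap (Coalgebra.comul a) :=
    fun a => DFunLike.congr_fun hD a
  have hE' : ∀ a, E (i a) = Coalgebra.counit a := fun a => DFunLike.congr_fun hE a
  have h1 : ∀ t : A ⊗[k] A, Algebra.TensorProduct.map (.id k H) E
      (TensorProduct.map i.toLinearMap i.toLinearMap t) =
      i.toLinearMap.rTensor k (Coalgebra.counit.lTensor A t) := by
    intro t
    induction t with
    | zero => simp
    | add x y hx hy => simp only [map_add, hx, hy]
    | tmul x y => simp [hE']
  ext a
  simp only [AlgHom.comp_apply, hD', h1, Coalgebra.lTensor_counit_comul]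
  simp

end aux

instance [Bialgebra k A] [Bialgebra k B] : Bialgebra k (FreeProd k A B) :=
  Bialgebra.ofAlgHom (comulHom k A B) (counitHom k A B)
    (hom_ext (aux_coassoc (lift_comp_inl _ _)) (aux_coassoc (lift_comp_inr _ _)))
    (hom_ext (aux_rTensor (lift_comp_inl _ _) (lift_comp_inl _ _))
      (aux_rTensor (lift_comp_inr _ _) (lift_comp_inr _ _)))
    (hom_ext (aux_lTensor (lift_comp_inl _ _) (lift_comp_inl _ _))
      (aux_lTensor (lift_comp_inr _ _) (lift_comp_inr _ _)))

/-- The canonical map `A → A * B` as a bialgebra map. -/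
def inlBialg [Bialgebra k A] [Bialgebra k B] : A →ₐc[k] FreeProd k A B :=
  BialgHom.ofAlgHom (inl k A B) (lift_comp_inl _ _) (lift_comp_inl _ _).symm

/-- The canonical map `B → A * B` as a bialgebra map. -/
def inrBialg [Bialgebra k A] [Bialgebra k B] : B →ₐc[k] FreeProd k A B :=
  BialgHom.ofAlgHom (inr k A B) (lift_comp_inr _ _) (lift_comp_inr _ _).symm

theorem inlBialg_injective [Bialgebra k A] [Bialgebra k B] :
    Function.Injective (inlBialg k A B) := by
  let r : FreeProd k A B →ₐ[k] A :=
    lift (AlgHom.id k A) ((Algebra.ofId k A).comp (Bialgebra.counitAlgHom k B))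
  exact Function.LeftInverse.injective (g := r) fun a => lift_inl _ _ a

theorem inrBialg_injective [Bialgebra k A] [Bialgebra k B] :
    Function.Injective (inrBialg k A B) := by
  let r : FreeProd k A B →ₐ[k] B :=
    lift ((Algebra.ofId k B).comp (Bialgebra.counitAlgHom k A)) (AlgHom.id k B)
  exact Function.LeftInverse.injective (g := r) fun a => lift_inr _ _ a

/-- The antipode of `A * B` as a linear map. -/
def antipodeLin [HopfAlgebra k A] [HopfAlgebra k B] : FreeProd k A B →ₗ[k] FreeProd k A B :=
  (MulOpposite.opLinearEquiv k).symm.toLinearMap ∘ₗ (antipodeHom k A B).toLinearMap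

section aux2

variable {k} {H : Type u} [Ring H] [Bialgebra k H] {S : H →ₗ[k] H}

/-- If `S` is anti-multiplicative, the left antipode identity is stable under products. -/
theorem aux_left_mul (hS : ∀ x y, S (x * y) = S y * S x) (x y : H)
    (hx : LinearMap.mul' k H (S.rTensor H (Coalgebra.comul x)) = algebraMap k H (Coalgebra.counit x))
    (hy : LinearMap.mul' k H (S.rTensor H (Coalgebra.comul y)) =
      algebraMap k H (Coalgebra.counit y)) :
    LinearMap.mul' k H (S.rTensor H (Coalgebra.comul (x * y))) =
      algebraMap k H (Coalgebra.counit (x * y)) := by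
  have h1 : ∀ s t : H ⊗[k] H, LinearMap.mul' k H (S.rTensor H (s * t)) =
      LinearMap.mul' k H ((LinearMap.mulLeft k (LinearMap.mul' k H (S.rTensor H s))).lTensor H
        (S.rTensor H t)) := by
    intro s t
    induction t with
    | zero => simp
    | add a b ha hb => simp only [mul_add, map_add, ha, hb]
    | tmul a b =>
      induction s with
      | zero => simp
      | add c d hc hd =>
        simp only [add_mul, map_add, hc, hd, LinearMap.rTensor_tmul, LinearMap.lTensor_tmul,
          LinearMap.mul'_apply, LinearMap.mulLeft_apply, mul_add]
      | tmul c d => simp [hS, mul_assoc]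
  rw [Bialgebra.comul_mul, h1, hx, Bialgebra.counit_mul, map_mul, ← hy]
  generalize (Coalgebra.comul y : H ⊗[k] H) = t
  induction t with
  | zero => simp
  | add a b ha hb => simp only [map_add, ha, hb, mul_add]
  | tmul a b =>
    simp only [LinearMap.rTensor_tmul, LinearMap.lTensor_tmul, LinearMap.mul'_apply,
      LinearMap.mulLeft_apply]
    rw [← mul_assoc, ← mul_assoc, Algebra.commutes]

/-- If `S` is anti-multiplicative, the right antipode identity is stable under products. -/
theorem aux_right_mul (hS : ∀ x y, S (x * y) = S y * S x) (x y : H)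
    (hx : LinearMap.mul' k H (S.lTensor H (Coalgebra.comul x)) = algebraMap k H (Coalgebra.counit x))
    (hy : LinearMap.mul' k H (S.lTensor H (Coalgebra.comul y)) =
      algebraMap k H (Coalgebra.counit y)) :
    LinearMap.mul' k H (S.lTensor H (Coalgebra.comul (x * y))) =
      algebraMap k H (Coalgebra.counit (x * y)) := by
  have h1 : ∀ s t : H ⊗[k] H, LinearMap.mul' k H (S.lTensor H (s * t)) =
      LinearMap.mul' k H ((LinearMap.mulRight k (LinearMap.mul' k H (S.lTensor H t))).rTensor H
        (S.lTensor H s)) := by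
    intro s t
    induction s with
    | zero => simp
    | add a b ha hb => simp only [add_mul, map_add, ha, hb]
    | tmul a b =>
      induction t with
      | zero => simp
      | add c d hc hd =>
        simp only [mul_add, map_add, hc, hd, LinearMap.rTensor_tmul, LinearMap.lTensor_tmul,
          LinearMap.mul'_apply, LinearMap.mulRight_apply, add_mul]
      | tmul c d => simp [hS, mul_assoc]
  rw [Bialgebra.comul_mul, h1, hy, Bialgebra.counit_mul, map_mul, ← hx]
  generalize (Coalgebra.comul x : H ⊗[k] H) = t
  induction t with
  | zero => simp
  | add a b ha hb => simp only [map_add, ha, hb, add_mul]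
  | tmul a b =>
    simp only [LinearMap.rTensor_tmul, LinearMap.lTensor_tmul, LinearMap.mul'_apply,
      LinearMap.mulRight_apply]
    rw [mul_assoc, Algebra.commutes, ← mul_assoc]

variable {A : Type u} [Ring A] [HopfAlgebra k A]

theorem aux_left_map (i : A →ₐc[k] H) (hi : ∀ a, S (i a) = i (HopfAlgebra.antipode k a)) (a : A) :
    LinearMap.mul' k H (S.rTensor H (Coalgebra.comul (i a))) =
      algebraMap k H (Coalgebra.counit (i a)) := by
  have h : ∀ t : A ⊗[k] A, LinearMap.mul' k H (S.rTensor H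
      (TensorProduct.map (i : A →ₗ[k] H) (i : A →ₗ[k] H) t)) =
      i (LinearMap.mul' k A ((HopfAlgebra.antipode k).rTensor A t)) := by
    intro t
    induction t with
    | zero => simp
    | add x y hx hy => simp only [map_add, hx, hy]
    | tmul x y => simp [hi]
  rw [← CoalgHomClass.map_comp_comul_apply, h, HopfAlgebra.mul_antipode_rTensor_comul_apply,
    CoalgHomClass.counit_comp_apply]
  exact AlgHomClass.commutes i _

theorem aux_right_map (i : A →ₐc[k] H) (hi : ∀ a, S (i a) = i (HopfAlgebra.antipode k a)) (a : A) :
    LinearMap.mul' k H (S.lTensor H (Coalgebra.comul (i a))) =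
      algebraMap k H (Coalgebra.counit (i a)) := by
  have h : ∀ t : A ⊗[k] A, LinearMap.mul' k H (S.lTensor H
      (TensorProduct.map (i : A →ₗ[k] H) (i : A →ₗ[k] H) t)) =
      i (LinearMap.mul' k A ((HopfAlgebra.antipode k).lTensor A t)) := by
    intro t
    induction t with
    | zero => simp
    | add x y hx hy => simp only [map_add, hx, hy]
    | tmul x y => simp [hi]
  rw [← CoalgHomClass.map_comp_comul_apply, h, HopfAlgebra.mul_antipode_lTensor_comul_apply,
    CoalgHomClass.counit_comp_apply]
  exact AlgHomClass.commutes i _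

end aux2

theorem antipodeLin_mul [HopfAlgebra k A] [HopfAlgebra k B] (x y : FreeProd k A B) :
    antipodeLin k A B (x * y) = antipodeLin k A B y * antipodeLin k A B x := by
  simp [antipodeLin]

theorem antipodeLin_inl [HopfAlgebra k A] [HopfAlgebra k B] (a : A) :
    antipodeLin k A B (inlBialg k A B a) = inlBialg k A B (HopfAlgebra.antipode k a) := by
  change (antipodeHom k A B (inl k A B a)).unop = inl k A B _
  simp [antipodeHom]

theorem antipodeLin_inr [HopfAlgebra k A] [HopfAlgebra k B] (b : B) :
    antipodeLin k A B (inrBialg k A B b) = inrBialg k A B (HopfAlgebra.antipode k b) := by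
  change (antipodeHom k A B (inr k A B b)).unop = inr k A B _
  simp [antipodeHom]

/-- The free product of two Hopf algebras is a Hopf algebra; `inlBialg` and `inrBialg` are
Hopf algebra maps. -/
instance [HopfAlgebra k A] [HopfAlgebra k B] : HopfAlgebra k (FreeProd k A B) where
  antipode := antipodeLin k A B
  mul_antipode_rTensor_comul := by
    refine LinearMap.ext fun x => ?_
    refine induction (aux_left_map (inlBialg k A B) (antipodeLin_inl k A B))
      (aux_left_map (inrBialg k A B) (antipodeLin_inr k A B)) ?_
      (aux_left_mul (antipodeLin_mul k A B)) x
    intro x y hx hy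
    simp only [map_add, hx, hy]
  mul_antipode_lTensor_comul := by
    refine LinearMap.ext fun x => ?_
    refine induction (aux_right_map (inlBialg k A B) (antipodeLin_inl k A B))
      (aux_right_map (inrBialg k A B) (antipodeLin_inr k A B)) ?_
      (aux_right_mul (antipodeLin_mul k A B)) x
    intro x y hx hy
    simp only [map_add, hx, hy]

end Hopf

end FreeProd

/-- A bialgebra map between Hopf algebras commutes with the antipodes. -/
theorem BialgHom.map_antipode_apply {k B A : Type u} [Field k] [Ring A] [Ring B] [HopfAlgebra k A]
    [HopfAlgebra k B] (f : B →ₐc[k] A) (b : B) :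
    f (HopfAlgebra.antipode k b) = HopfAlgebra.antipode k (f b) := by
  have h : WithConv.toConv ((f : B →ₗ[k] A) ∘ₗ HopfAlgebra.antipode k) =
      WithConv.toConv (HopfAlgebra.antipode k ∘ₗ (f : B →ₗ[k] A)) := by
    apply left_inv_eq_right_inv (a := WithConv.toConv (f : B →ₗ[k] A))
    · ext b
      have := congrArg f (HopfAlgebra.sum_antipode_mul_eq_algebraMap_counit
        (Coalgebra.Repr.arbitrary k b))
      have hc : f (algebraMap k B (Coalgebra.counit b)) = algebraMap k A (Coalgebra.counit b) :=
        AlgHomClass.commutes f _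
      rw [(Coalgebra.Repr.arbitrary k b).convMul_apply]
      simpa [hc] using this
    · ext b
      have := HopfAlgebra.mul_antipode_lTensor_comul_apply (R := k) (f b)
      rw [← CoalgHomClass.map_comp_comul_apply, ← (Coalgebra.Repr.arbitrary k b).eq] at this
      rw [(Coalgebra.Repr.arbitrary k b).convMul_apply]
      simpa using this
  exact congrArg (fun g : WithConv (B →ₗ[k] A) => g b) h

/-! ### Comodules and cosemisimplicity -/

/-- A right comodule structure on `V` over the coalgebra `C`. -/
structure Coaction (k C V : Type u) [Field k] [AddCommGroup C] [Module k C] [Coalgebra k C]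
    [AddCommGroup V] [Module k V] where
  /-- The coaction `v ↦ v₍₀₎ ⊗ v₍₁₎`. -/
  coact : V →ₗ[k] V ⊗[k] C
  coassoc : ∀ v, TensorProduct.assoc k V C C (coact.rTensor C (coact v)) =
    Coalgebra.comul.lTensor V (coact v)
  counit : ∀ v, Coalgebra.counit.lTensor V (coact v) = v ⊗ₜ[k] (1 : k)

/-- `W ⊆ V` is a subcomodule: the coaction maps `W` into (the image of) `W ⊗ C`. -/
def Coaction.IsSubcomodule {k C V : Type u} [Field k] [AddCommGroup C] [Module k C] [Coalgebra k C]
    [AddCommGroup V] [Module k V] (ρ : Coaction k C V) (W : Submodule k V) : Prop :=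
  ∀ w ∈ W, ρ.coact w ∈ LinearMap.range (W.subtype.rTensor C)

/-- A coalgebra is cosemisimple if all its right comodules are semisimple: every subcomodule of
every comodule has a complementary subcomodule. -/
def IsCosemisimple (k C : Type u) [Field k] [AddCommGroup C] [Module k C] [Coalgebra k C] : Prop :=
  ∀ (V : Type u) [AddCommGroup V] [Module k V] (ρ : Coaction k C V) (W : Submodule k V),
    ρ.IsSubcomodule W → ∃ W' : Submodule k V, ρ.IsSubcomodule W' ∧ IsCompl W W'

/-! ### Yetter–Drinfeld modules -/

/-- For a bilinear map `act v a = v · a`, the map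
`(v ⊗ h, x ⊗ y ⊗ z) ↦ (v · y) ⊗ S(x) h z`. -/
def ydTwist {k A V : Type u} [Field k] [Ring A] [HopfAlgebra k A] [AddCommGroup V] [Module k V]
    (act : V →ₗ[k] A →ₗ[k] V) : V ⊗[k] A →ₗ[k] A ⊗[k] (A ⊗[k] A) →ₗ[k] V ⊗[k] A :=
  TensorProduct.lift <| LinearMap.mk₂ k
    (fun v h => TensorProduct.lift ((TensorProduct.mapBilinear (RingHom.id k) A A V A (act v)) ∘ₗ
      LinearMap.mul k A ∘ₗ LinearMap.mulRight k h ∘ₗ HopfAlgebra.antipode k))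
    (fun _ _ _ => by ext; simp)
    (fun _ _ _ => by ext; simp [smul_tmul'])
    (fun _ _ _ => by ext; simp [mul_add, tmul_add])
    (fun _ _ _ => by ext; simp)

@[simp] theorem ydTwist_tmul {k A V : Type u} [Field k] [Ring A] [HopfAlgebra k A] [AddCommGroup V]
    [Module k V] (act : V →ₗ[k] A →ₗ[k] V) (v : V) (h x y z : A) :
    ydTwist act (v ⊗ₜ h) (x ⊗ₜ (y ⊗ₜ z)) =
      act v y ⊗ₜ[k] (HopfAlgebra.antipode k x * h * z) := by
  simp [ydTwist]

/-- A (right-right) Yetter–Drinfeld module over the Hopf algebra `A`: a right `A`-module and right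
`A`-comodule with `(v·a)₍₀₎ ⊗ (v·a)₍₁₎ = v₍₀₎·a₍₂₎ ⊗ S(a₍₁₎) v₍₁₎ a₍₃₎`. -/
structure YetterDrinfeld (k A : Type u) [Field k] [Ring A] [HopfAlgebra k A] where
  /-- The underlying vector space. -/
  carrier : Type u
  [addCommGroup : AddCommGroup carrier]
  [module : Module k carrier]
  /-- The right action `act v a = v · a`. -/
  act : carrier →ₗ[k] A →ₗ[k] carrier
  act_one : ∀ v, act v 1 = v
  act_mul : ∀ v a b, act v (a * b) = act (act v a) b
  /-- The right coaction. -/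
  coaction : Coaction k A carrier
  yd : ∀ v a, coaction.coact (act v a) =
    ydTwist act (coaction.coact v) (Coalgebra.comul.lTensor A (Coalgebra.comul a))

attribute [instance] YetterDrinfeld.addCommGroup YetterDrinfeld.module

namespace YetterDrinfeld

section Basic

variable {k A : Type u} [Field k] [Ring A] [HopfAlgebra k A]

/-- The coaction as a linear map. -/
abbrev coact (M : YetterDrinfeld k A) : M.carrier →ₗ[k] M.carrier ⊗[k] A := M.coaction.coact

/-- Morphisms of Yetter–Drinfeld modules: the `A`-linear and `A`-colinear maps. -/
@[ext] structure Hom (M N : YetterDrinfeld k A) where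
  /-- The underlying linear map. -/
  lin : M.carrier →ₗ[k] N.carrier
  map_act : ∀ v a, lin (M.act v a) = N.act (lin v) a
  map_coact : ∀ v, lin.rTensor A (M.coact v) = N.coact (lin v)

instance : Category (YetterDrinfeld k A) where
  Hom M N := Hom M N
  id M := ⟨LinearMap.id, fun _ _ => rfl, fun _ => by simp⟩
  comp f g := ⟨g.lin ∘ₗ f.lin, fun _ _ => by simp [f.map_act, g.map_act], fun _ => by
    rw [LinearMap.rTensor_comp_apply, f.map_coact, g.map_coact]; rfl⟩

variable {M N P : YetterDrinfeld k A}

theorem hom_ext {f g : M ⟶ N} (h : ∀ v, f.lin v = g.lin v) : f = g :=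
  Hom.ext (LinearMap.ext h)

@[simp] theorem id_lin (M : YetterDrinfeld k A) : Hom.lin (𝟙 M) = LinearMap.id := rfl

@[simp] theorem comp_lin (f : M ⟶ N) (g : N ⟶ P) : Hom.lin (f ≫ g) = g.lin ∘ₗ f.lin := rfl

theorem lin_injective : Function.Injective (fun f : M ⟶ N => f.lin) := fun _ _ h => Hom.ext h

instance : Zero (M ⟶ N) := ⟨⟨0, fun _ _ => by simp, fun _ => by simp⟩⟩
instance : Add (M ⟶ N) := ⟨fun f g => ⟨f.lin + g.lin,
  fun _ _ => by simp [f.map_act, g.map_act],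
  fun _ => by simp [LinearMap.rTensor_add, f.map_coact, g.map_coact]⟩⟩
instance : Neg (M ⟶ N) := ⟨fun f => ⟨-f.lin,
  fun _ _ => by simp [f.map_act], fun _ => by simp [LinearMap.rTensor_neg, f.map_coact]⟩⟩
instance : Sub (M ⟶ N) := ⟨fun f g => ⟨f.lin - g.lin,
  fun _ _ => by simp [f.map_act, g.map_act],
  fun _ => by simp [LinearMap.rTensor_sub, f.map_coact, g.map_coact]⟩⟩
instance : SMul k (M ⟶ N) := ⟨fun c f => ⟨c • f.lin,
  fun _ _ => by simp [f.map_act], fun _ => by simp [LinearMap.rTensor_smul, f.map_coact]⟩⟩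
instance : SMul ℕ (M ⟶ N) := ⟨fun c f => (c : k) • f⟩
instance : SMul ℤ (M ⟶ N) := ⟨fun c f => (c : k) • f⟩

@[simp] theorem zero_lin : Hom.lin (0 : M ⟶ N) = 0 := rfl
@[simp] theorem add_lin (f g : M ⟶ N) : Hom.lin (f + g) = f.lin + g.lin := rfl
@[simp] theorem neg_lin (f : M ⟶ N) : Hom.lin (-f) = -f.lin := rfl
@[simp] theorem sub_lin (f g : M ⟶ N) : Hom.lin (f - g) = f.lin - g.lin := rfl
@[simp] theorem smul_lin (c : k) (f : M ⟶ N) : Hom.lin (c • f) = c • f.lin := rfl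

instance : AddCommGroup (M ⟶ N) :=
  lin_injective.addCommGroup _ rfl (fun _ _ => rfl) (fun _ => rfl) (fun _ _ => rfl)
    (fun f n => (Nat.cast_smul_eq_nsmul k n f.lin)) (fun f n => (Int.cast_smul_eq_zsmul k n f.lin))

/-- Forgetting to linear maps, as an additive map. -/
def linAddHom (M N : YetterDrinfeld k A) : (M ⟶ N) →+ (M.carrier →ₗ[k] N.carrier) where
  toFun f := f.lin
  map_zero' := rfl
  map_add' _ _ := rfl

instance : Module k (M ⟶ N) :=
  lin_injective.module k (linAddHom M N) (fun _ _ => rfl)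

instance : Preadditive (YetterDrinfeld k A) where
  add_comp _ _ _ f f' g := hom_ext fun v => by simp
  comp_add _ _ _ f g g' := hom_ext fun v => by simp

instance : Linear k (YetterDrinfeld k A) where
  smul_comp _ _ _ r f g := hom_ext fun v => by simp
  comp_smul _ _ _ f r g := hom_ext fun v => by simp

/-- The trivial Yetter–Drinfeld module `k`: `v · a = ε(a) v` and `v ↦ v ⊗ 1`. -/
def trivialModule (k A : Type u) [Field k] [Ring A] [HopfAlgebra k A] : YetterDrinfeld k A where
  carrier := k
  act := (LinearMap.mul k k).compl₂ Coalgebra.counit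
  act_one v := by simp
  act_mul v a b := by simp [mul_assoc]
  coaction :=
    { coact := (TensorProduct.mk k k A).flip 1
      coassoc := fun v => by simp [Algebra.TensorProduct.one_def]
      counit := fun v => by simp }
  yd v a := by
    have h : ∀ t : A ⊗[k] A, ydTwist ((LinearMap.mul k k).compl₂ Coalgebra.counit) (v ⊗ₜ (1 : A))
        (Coalgebra.comul.lTensor A t) =
        v ⊗ₜ LinearMap.mul' k A ((HopfAlgebra.antipode k).rTensor A t) := by
      intro t
      induction t with
      | zero => simp
      | add x y hx hy => simp only [map_add, hx, hy, tmul_add]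
      | tmul x y =>
        have h2 : ∀ s : A ⊗[k] A,
            ydTwist ((LinearMap.mul k k).compl₂ Coalgebra.counit) (v ⊗ₜ (1 : A)) (x ⊗ₜ s) =
            v ⊗ₜ (HopfAlgebra.antipode k x *
              TensorProduct.lid k A (Coalgebra.counit.rTensor A s)) := by
          intro s
          induction s with
          | zero => simp
          | add x y hx hy => simp only [map_add, hx, hy, tmul_add, mul_add]
          | tmul y z =>
            simp only [ydTwist_tmul, LinearMap.compl₂_apply, LinearMap.mul_apply', mul_one,
              LinearMap.rTensor_tmul, lid_tmul, mul_smul_comm, tmul_smul]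
            rw [mul_comm v, ← smul_eq_mul, smul_tmul']
        simp [h2]
    have := h (Coalgebra.comul a)
    simp only [LinearMap.flip_apply, TensorProduct.mk_apply, LinearMap.compl₂_apply,
      LinearMap.mul_apply'] at this ⊢
    rw [this, HopfAlgebra.mul_antipode_rTensor_comul_apply, mul_comm, ← smul_eq_mul, smul_tmul,
      Algebra.algebraMap_eq_smul_one]

end Basic

/-! #### Transport of the axioms along linear maps -/

section Transport

variable {k A B V W : Type u} [Field k] [Ring A] [HopfAlgebra k A] [Ring B] [HopfAlgebra k B]
  [AddCommGroup V] [Module k V] [AddCommGroup W] [Module k W]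

theorem coassoc_left (f : B →ₐc[k] A) (φ : V →ₗ[k] W) (ρV : V →ₗ[k] V ⊗[k] B)
    (ρW : W →ₗ[k] W ⊗[k] A)
    (h : ∀ v, TensorProduct.map φ (f : B →ₗ[k] A) (ρV v) = ρW (φ v)) (v : V) :
    TensorProduct.map φ (TensorProduct.map (f : B →ₗ[k] A) (f : B →ₗ[k] A))
      (TensorProduct.assoc k V B B (ρV.rTensor B (ρV v))) =
    TensorProduct.assoc k W A A (ρW.rTensor A (ρW (φ v))) := by
  rw [← h]
  generalize ρV v = t
  induction t with
  | zero => simp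
  | add x y hx hy => simp only [map_add, hx, hy]
  | tmul x y =>
    simp only [LinearMap.rTensor_tmul, map_tmul, ← h]
    generalize ρV x = s
    induction s with
    | zero => simp
    | add x y hx hy => simp only [map_add, hx, hy, add_tmul]
    | tmul x y => simp

theorem coassoc_right (f : B →ₐc[k] A) (φ : V →ₗ[k] W) (ρV : V →ₗ[k] V ⊗[k] B)
    (ρW : W →ₗ[k] W ⊗[k] A)
    (h : ∀ v, TensorProduct.map φ (f : B →ₗ[k] A) (ρV v) = ρW (φ v)) (v : V) :
    TensorProduct.map φ (TensorProduct.map (f : B →ₗ[k] A) (f : B →ₗ[k] A))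
      (Coalgebra.comul.lTensor V (ρV v)) =
    Coalgebra.comul.lTensor W (ρW (φ v)) := by
  rw [← h]
  generalize ρV v = t
  induction t with
  | zero => simp
  | add x y hx hy => simp only [map_add, hx, hy]
  | tmul x y => simp [← CoalgHomClass.map_comp_comul_apply]

theorem counit_left (f : B →ₐc[k] A) (φ : V →ₗ[k] W) (ρV : V →ₗ[k] V ⊗[k] B)
    (ρW : W →ₗ[k] W ⊗[k] A)
    (h : ∀ v, TensorProduct.map φ (f : B →ₗ[k] A) (ρV v) = ρW (φ v)) (v : V) :
    φ.rTensor k (Coalgebra.counit.lTensor V (ρV v)) = Coalgebra.counit.lTensor W (ρW (φ v)) := by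
  rw [← h]
  generalize ρV v = t
  induction t with
  | zero => simp
  | add x y hx hy => simp only [map_add, hx, hy]
  | tmul x y => simp

theorem ydTwist_map (f : B →ₐc[k] A) (φ : V →ₗ[k] W) (actV : V →ₗ[k] B →ₗ[k] V)
    (actW : W →ₗ[k] A →ₗ[k] W) (h : ∀ v b, φ (actV v b) = actW (φ v) (f b))
    (t : V ⊗[k] B) (s : B ⊗[k] (B ⊗[k] B)) :
    TensorProduct.map φ (f : B →ₗ[k] A) (ydTwist actV t s) =
      ydTwist actW (TensorProduct.map φ (f : B →ₗ[k] A) t)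
        (TensorProduct.map (f : B →ₗ[k] A) (TensorProduct.map (f : B →ₗ[k] A) (f : B →ₗ[k] A)) s) := by
  induction t with
  | zero => simp
  | add x y hx hy => simp only [map_add, hx, hy, LinearMap.add_apply]
  | tmul v x =>
    induction s with
    | zero => simp
    | add x y hx hy => simp only [map_add, hx, hy]
    | tmul a s =>
      induction s with
      | zero => simp
      | add x y hx hy => simp only [map_add, hx, hy, tmul_add]
      | tmul b c => simp [h, BialgHom.map_antipode_apply]

theorem comul_map (f : B →ₐc[k] A) (b : B) :
    TensorProduct.map (f : B →ₗ[k] A) (TensorProduct.map (f : B →ₗ[k] A) (f : B →ₗ[k] A))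
      (Coalgebra.comul.lTensor B (Coalgebra.comul b)) =
    Coalgebra.comul.lTensor A (Coalgebra.comul (f b)) := by
  rw [← CoalgHomClass.map_comp_comul_apply]
  generalize (Coalgebra.comul b : B ⊗[k] B) = t
  induction t with
  | zero => simp
  | add x y hx hy => simp only [map_add, hx, hy]
  | tmul x y => simp [← CoalgHomClass.map_comp_comul_apply]

theorem map_id_eq (φ : V →ₗ[k] W) (t : V ⊗[k] A) :
    TensorProduct.map φ ((BialgHom.id k A : A →ₐc[k] A) : A →ₗ[k] A) t = φ.rTensor A t := rfl

end Transport

/-! #### Subobjects and restriction -/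

section Pull

variable {k A B : Type u} [Field k] [Ring A] [HopfAlgebra k A] [Ring B] [HopfAlgebra k B]

theorem map_injective {V W : Type u} [AddCommGroup V] [Module k V] [AddCommGroup W] [Module k W]
    (φ : V →ₗ[k] W) (hφ : Function.Injective φ) {U X : Type u} [AddCommGroup U] [Module k U]
    [AddCommGroup X] [Module k X] (ψ : U →ₗ[k] X) (hψ : Function.Injective ψ) :
    Function.Injective (TensorProduct.map φ ψ) :=
  TensorProduct.map_injective_of_flat_flat _ _ hφ hψ

variable (f : B →ₐc[k] A) (hf : Function.Injective f) (X : YetterDrinfeld k A)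
  (W : Submodule k X.carrier)

/-- The coaction `W → W ⊗ B` obtained by corestricting that of `X`, when the latter maps `W` into
`W ⊗ B ⊆ X ⊗ A`. -/
def pullCoact
    (hco : ∀ w ∈ W, X.coact w ∈ LinearMap.range (TensorProduct.map W.subtype (f : B →ₗ[k] A))) :
    W →ₗ[k] W ⊗[k] B :=
  (LinearEquiv.ofInjective (TensorProduct.map W.subtype (f : B →ₗ[k] A))
    (map_injective _ W.subtype_injective _ hf)).symm.toLinearMap ∘ₗ
    LinearMap.codRestrict _ (X.coact ∘ₗ W.subtype) (fun w => hco w w.2)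

theorem map_pullCoact
    (hco : ∀ w ∈ W, X.coact w ∈ LinearMap.range (TensorProduct.map W.subtype (f : B →ₗ[k] A)))
    (w : W) :
    TensorProduct.map W.subtype (f : B →ₗ[k] A) (pullCoact f hf X W hco w) =
      X.coact (W.subtype w) := by
  have := LinearEquiv.apply_symm_apply (LinearEquiv.ofInjective
    (TensorProduct.map W.subtype (f : B →ₗ[k] A)) (map_injective _ W.subtype_injective _ hf))
    (LinearMap.codRestrict _ (X.coact ∘ₗ W.subtype) (fun w => hco w w.2) w)
  exact congrArg Subtype.val this

/-- A subspace `W ⊆ X` stable under the action of the Hopf subalgebra `B ⊆ A`, with coaction taking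
values in `W ⊗ B`, is a Yetter–Drinfeld module over `B`. -/
def pull (hact : ∀ w ∈ W, ∀ b, X.act w (f b) ∈ W)
    (hco : ∀ w ∈ W, X.coact w ∈ LinearMap.range (TensorProduct.map W.subtype (f : B →ₗ[k] A))) :
    YetterDrinfeld k B where
  carrier := W
  act := LinearMap.mk₂ k (fun w b => ⟨X.act w (f b), hact w w.2 b⟩)
    (fun _ _ _ => by ext; simp) (fun _ _ _ => by ext; simp)
    (fun _ _ _ => by ext; simp) (fun _ _ _ => by ext; simp)
  act_one w := by ext; simp [X.act_one]
  act_mul w a b := by ext; simp [X.act_mul]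
  coaction :=
    { coact := pullCoact f hf X W hco
      coassoc := fun w => by
        have hh := map_pullCoact f hf X W hco
        apply map_injective _ W.subtype_injective _ (map_injective _ hf _ hf)
        refine (coassoc_left f _ _ X.coact hh w).trans ?_
        exact (X.coaction.coassoc _).trans (coassoc_right f _ _ X.coact hh w).symm
      counit := fun w => by
        have hh := map_pullCoact f hf X W hco
        apply Module.Flat.rTensor_preserves_injective_linearMap (M := k) _ W.subtype_injective
        rw [counit_left f _ _ X.coact hh w, X.coaction.counit]
        simp }
  yd w b := by
    have hh := map_pullCoact f hf X W hco
    apply map_injective _ W.subtype_injective _ hf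
    refine Eq.trans ?_ (ydTwist_map f W.subtype _ X.act (fun _ _ => rfl) _ _).symm
    rw [comul_map]
    refine (hh _).trans ((X.yd _ _).trans ?_)
    exact congrArg (fun t => ydTwist X.act t _) (hh w).symm

end Pull

section Restriction

variable {k A B : Type u} [Field k] [Ring A] [HopfAlgebra k A] [Ring B] [HopfAlgebra k B]
  (f : B →ₐc[k] A) (hf : Function.Injective f) (X : YetterDrinfeld k A)

/-- `X^(B) = {x ∈ X | x₍₀₎ ⊗ x₍₁₎ ∈ X ⊗ B}`, for a Hopf subalgebra `f : B ↪ A`. -/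
def resSubmodule : Submodule k X.carrier :=
  (LinearMap.range ((f : B →ₗ[k] A).lTensor X.carrier)).comap X.coact

theorem resSubmodule_act (x : X.carrier) (hx : x ∈ resSubmodule f X) (b : B) :
    X.act x (f b) ∈ resSubmodule f X := by
  have key : ∀ (t : X.carrier ⊗[k] B) (s : B ⊗[k] (B ⊗[k] B)),
      ydTwist X.act ((f : B →ₗ[k] A).lTensor X.carrier t)
        (TensorProduct.map (f : B →ₗ[k] A)
          (TensorProduct.map (f : B →ₗ[k] A) (f : B →ₗ[k] A)) s) ∈
        LinearMap.range ((f : B →ₗ[k] A).lTensor X.carrier) := by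
    intro t s
    induction t with
    | zero => simp
    | add a b ha hb =>
      simp only [map_add, LinearMap.add_apply]
      exact Submodule.add_mem _ ha hb
    | tmul v h =>
      induction s with
      | zero => simp
      | add a b ha hb =>
        simp only [map_add]
        exact Submodule.add_mem _ ha hb
      | tmul a s =>
        induction s with
        | zero => simp
        | add b c hb hc =>
          simp only [map_add, tmul_add]
          exact Submodule.add_mem _ hb hc
        | tmul b c =>
          refine ⟨X.act v (f b) ⊗ₜ (HopfAlgebra.antipode k a * h * c), ?_⟩
          simp [BialgHom.map_antipode_apply]
  obtain ⟨t, ht⟩ := hx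
  refine Submodule.mem_comap.2 ?_
  have hyd : X.coact (X.act x (f b)) = _ := X.yd x (f b)
  rw [hyd, ← comul_map f b, ← ht]
  exact key _ _

theorem resSubmodule_coact (hf : Function.Injective f) (x : X.carrier) (hx : x ∈ resSubmodule f X) :
    X.coact x ∈
      LinearMap.range (TensorProduct.map (resSubmodule f X).subtype (f : B →ₗ[k] A)) := by
  obtain ⟨t, ht⟩ := hx
  -- `resSubmodule f X` is the kernel of `ψ : X → X ⊗ A / f(B)`.
  let q : A →ₗ[k] A ⧸ LinearMap.range (f : B →ₗ[k] A) := Submodule.mkQ _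
  let ψ : X.carrier →ₗ[k] X.carrier ⊗[k] (A ⧸ LinearMap.range (f : B →ₗ[k] A)) :=
    q.lTensor X.carrier ∘ₗ X.coact
  have hqf : ∀ b, q (f b) = 0 := fun b =>
    (Submodule.Quotient.mk_eq_zero _).2 ⟨b, rfl⟩
  have hex : Function.Exact (f : B →ₗ[k] A) q := by
    intro a
    exact Submodule.Quotient.mk_eq_zero _
  have hex2 : Function.Exact ((f : B →ₗ[k] A).lTensor X.carrier) (q.lTensor X.carrier) :=
    Module.Flat.lTensor_exact X.carrier hex
  have hker : Function.Exact (resSubmodule f X).subtype ψ := by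
    intro y
    rw [show ψ y = q.lTensor X.carrier (X.coact y) from rfl, hex2]
    constructor
    · intro hy
      exact ⟨⟨y, hy⟩, rfl⟩
    · rintro ⟨z, rfl⟩
      exact z.2
  have hex3 := Module.Flat.rTensor_exact B hker
  have ht0 : ψ.rTensor B t = 0 := by
    apply Module.Flat.lTensor_preserves_injective_linearMap
      (M := X.carrier ⊗[k] (A ⧸ LinearMap.range (f : B →ₗ[k] A))) (f : B →ₗ[k] A) hf
    rw [map_zero]
    have h1 : ∀ t : X.carrier ⊗[k] B, (f : B →ₗ[k] A).lTensor _ (ψ.rTensor B t) =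
        (q.lTensor X.carrier).rTensor A
          (X.coact.rTensor A ((f : B →ₗ[k] A).lTensor X.carrier t)) := by
      intro t
      induction t with
      | zero => simp
      | add a b ha hb => simp only [map_add, ha, hb]
      | tmul v b => simp [ψ]
    have h2 : ∀ s : X.carrier ⊗[k] (A ⊗[k] A), (q.lTensor X.carrier).rTensor A
        ((TensorProduct.assoc k X.carrier A A).symm s) =
        (TensorProduct.assoc k X.carrier _ A).symm ((q.rTensor A).lTensor X.carrier s) := by
      intro s
      induction s with
      | zero => simp
      | add a b ha hb => simp only [map_add, ha, hb]
      | tmul v s =>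
        induction s with
        | zero => simp
        | add a b ha hb => simp only [map_add, ha, hb, tmul_add]
        | tmul a b => simp
    have h3 : ∀ t : X.carrier ⊗[k] B, (q.rTensor A).lTensor X.carrier
        (Coalgebra.comul.lTensor X.carrier ((f : B →ₗ[k] A).lTensor X.carrier t)) = 0 := by
      intro t
      induction t with
      | zero => simp
      | add a b ha hb => simp only [map_add, ha, hb, add_zero]
      | tmul v b =>
        have h4 : ∀ s : B ⊗[k] B, q.rTensor A
            (TensorProduct.map (f : B →ₗ[k] A) (f : B →ₗ[k] A) s) = 0 := by
          intro s
          induction s with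
          | zero => simp
          | add a b ha hb => simp only [map_add, ha, hb, add_zero]
          | tmul a b => simp [hqf]
        simp only [LinearMap.lTensor_tmul]
        erw [← CoalgHomClass.map_comp_comul_apply f b, h4, tmul_zero]
    rw [h1, ht, ← (TensorProduct.assoc k X.carrier A A).symm_apply_apply
      (X.coact.rTensor A (X.coact x)), h2]
    have hc : TensorProduct.assoc k X.carrier A A (X.coact.rTensor A (X.coact x)) = _ :=
      X.coaction.coassoc x
    rw [hc]
    have h5 := h3 t
    rw [ht] at h5
    erw [h5]
    simp
  obtain ⟨s, hs⟩ := (hex3 t).1 ht0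
  refine ⟨s, ?_⟩
  rw [← ht, ← hs]
  exact (LinearMap.congr_fun (LinearMap.lTensor_comp_rTensor _ _ _) s).symm

/-- The restriction `X^(B)` of a Yetter–Drinfeld module `X` over `A`, for a Hopf subalgebra
`f : B ↪ A`: the action and the coaction are those of `X`. -/
def resObj : YetterDrinfeld k B :=
  pull f hf X (resSubmodule f X) (resSubmodule_act f X) (resSubmodule_coact f X hf)

theorem map_resObj_coact (w : (resObj f hf X).carrier) :
    TensorProduct.map (resSubmodule f X).subtype (f : B →ₗ[k] A) ((resObj f hf X).coact w) =
      X.coact ((resSubmodule f X).subtype w) :=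
  map_pullCoact f hf X (resSubmodule f X) (resSubmodule_coact f X hf) w

theorem resSubmodule_map {X Y : YetterDrinfeld k A} (g : X ⟶ Y) (x : X.carrier)
    (hx : x ∈ resSubmodule f X) : g.lin x ∈ resSubmodule f Y := by
  obtain ⟨t, ht⟩ := hx
  refine ⟨g.lin.rTensor B t, ?_⟩
  rw [← g.map_coact, ← ht]
  exact (LinearMap.congr_fun (LinearMap.lTensor_comp_rTensor _ _ _) t).trans
    (LinearMap.congr_fun (LinearMap.rTensor_comp_lTensor _ _ _) t).symm

/-- The restriction of a morphism. -/
def resMap {X Y : YetterDrinfeld k A} (g : X ⟶ Y) : resObj f hf X ⟶ resObj f hf Y where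
  lin := g.lin.restrict (resSubmodule_map f g)
  map_act v a := Subtype.ext (g.map_act _ _)
  map_coact v := by
    apply map_injective _ (resSubmodule f Y).subtype_injective _ hf
    refine Eq.trans ?_ (map_resObj_coact f hf Y _).symm
    have h1 : ∀ t : (resSubmodule f X) ⊗[k] B,
        TensorProduct.map (resSubmodule f Y).subtype (f : B →ₗ[k] A)
          ((g.lin.restrict (resSubmodule_map f g)).rTensor B t) =
        g.lin.rTensor A (TensorProduct.map (resSubmodule f X).subtype (f : B →ₗ[k] A) t) := by
      intro t
      induction t with
      | zero => simp
      | add a b ha hb => simp only [map_add, ha, hb]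
      | tmul v b => simp
    refine (h1 _).trans ?_
    rw [map_resObj_coact f hf X v]
    exact g.map_coact _

/-- The restriction functor `X ↦ X^(B)` from Yetter–Drinfeld modules over `A` to those over `B`,
for a Hopf subalgebra `f : B ↪ A`. -/
def restriction : YetterDrinfeld k A ⥤ YetterDrinfeld k B where
  obj X := resObj f hf X
  map g := resMap f hf g
  map_id _ := hom_ext fun _ => rfl
  map_comp _ _ := hom_ext fun _ => rfl

end Restriction

end YetterDrinfeld

namespace YetterDrinfeld

/-! #### The abelian category of Yetter–Drinfeld modules -/

section Abelian

variable {k A : Type u} [Field k] [Ring A] [HopfAlgebra k A]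

/-- The quotient of a Yetter–Drinfeld module by a Yetter–Drinfeld submodule. -/
def quot (X : YetterDrinfeld k A) (W : Submodule k X.carrier)
    (hact : ∀ w ∈ W, ∀ a, X.act w a ∈ W)
    (hco : ∀ w ∈ W, W.mkQ.rTensor A (X.coact w) = 0) : YetterDrinfeld k A where
  carrier := X.carrier ⧸ W
  act := W.liftQ (((LinearMap.llcomp k A X.carrier (X.carrier ⧸ W)) W.mkQ) ∘ₗ X.act)
    (fun w hw => LinearMap.mem_ker.2 (LinearMap.ext fun a =>
      (Submodule.Quotient.mk_eq_zero W).2 (hact w hw a)))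
  act_one v := by
    obtain ⟨v, rfl⟩ := W.mkQ_surjective v
    exact congrArg W.mkQ (X.act_one v)
  act_mul v a b := by
    obtain ⟨v, rfl⟩ := W.mkQ_surjective v
    exact congrArg W.mkQ (X.act_mul v a b)
  coaction :=
    { coact := W.liftQ (W.mkQ.rTensor A ∘ₗ X.coact) (fun w hw => LinearMap.mem_ker.2 (hco w hw))
      coassoc := fun v => by
        obtain ⟨v, rfl⟩ := W.mkQ_surjective v
        refine (coassoc_left (BialgHom.id k A) W.mkQ X.coact _ (fun _ => rfl) v).symm.trans ?_
        rw [X.coaction.coassoc]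
        exact coassoc_right (BialgHom.id k A) W.mkQ X.coact _ (fun _ => rfl) v
      counit := fun v => by
        obtain ⟨v, rfl⟩ := W.mkQ_surjective v
        refine (counit_left (BialgHom.id k A) W.mkQ X.coact _ (fun _ => rfl) v).symm.trans ?_
        rw [X.coaction.counit]
        rfl }
  yd v a := by
    obtain ⟨v, rfl⟩ := W.mkQ_surjective v
    have h := congrArg (W.mkQ.rTensor A) (X.yd v a)
    refine h.trans ?_
    refine (ydTwist_map (BialgHom.id k A) W.mkQ X.act
      (W.liftQ (((LinearMap.llcomp k A X.carrier (X.carrier ⧸ W)) W.mkQ) ∘ₗ X.act)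
        (fun w hw => LinearMap.mem_ker.2 (LinearMap.ext fun a =>
          (Submodule.Quotient.mk_eq_zero W).2 (hact w hw a)))) (fun _ _ => rfl) _ _).trans ?_
    rw [comul_map]
    rfl

/-- The componentwise action on a direct sum. -/
def sumAct (X Y : YetterDrinfeld k A) :
    X.carrier × Y.carrier →ₗ[k] A →ₗ[k] X.carrier × Y.carrier :=
  (LinearMap.llcomp k A X.carrier (X.carrier × Y.carrier) (LinearMap.inl k _ _) ∘ₗ
      X.act ∘ₗ LinearMap.fst k _ _) +
    (LinearMap.llcomp k A Y.carrier (X.carrier × Y.carrier) (LinearMap.inr k _ _) ∘ₗ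
      Y.act ∘ₗ LinearMap.snd k _ _)

/-- The componentwise coaction on a direct sum. -/
def sumCoact (X Y : YetterDrinfeld k A) :
    X.carrier × Y.carrier →ₗ[k] (X.carrier × Y.carrier) ⊗[k] A :=
  ((LinearMap.inl k X.carrier Y.carrier).rTensor A ∘ₗ X.coact ∘ₗ LinearMap.fst k _ _) +
    ((LinearMap.inr k X.carrier Y.carrier).rTensor A ∘ₗ Y.coact ∘ₗ LinearMap.snd k _ _)

theorem sumAct_apply (X Y : YetterDrinfeld k A) (v : X.carrier × Y.carrier) (a : A) :
    sumAct X Y v a = (X.act v.1 a, Y.act v.2 a) := by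
  simp [sumAct]

theorem sumCoact_inl (X Y : YetterDrinfeld k A) (x : X.carrier) :
    sumCoact X Y (LinearMap.inl k _ _ x) = (LinearMap.inl k _ _).rTensor A (X.coact x) := by
  simp [sumCoact]

theorem sumCoact_inr (X Y : YetterDrinfeld k A) (y : Y.carrier) :
    sumCoact X Y (LinearMap.inr k _ _ y) = (LinearMap.inr k _ _).rTensor A (Y.coact y) := by
  simp [sumCoact]

theorem fst_sumCoact (X Y : YetterDrinfeld k A) (v : X.carrier × Y.carrier) :
    (LinearMap.fst k _ _).rTensor A (sumCoact X Y v) = X.coact v.1 := by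
  simp [sumCoact, ← LinearMap.rTensor_comp_apply]

theorem snd_sumCoact (X Y : YetterDrinfeld k A) (v : X.carrier × Y.carrier) :
    (LinearMap.snd k _ _).rTensor A (sumCoact X Y v) = Y.coact v.2 := by
  simp [sumCoact, ← LinearMap.rTensor_comp_apply]

theorem sum_eq (X Y : YetterDrinfeld k A) (v : X.carrier × Y.carrier) :
    v = LinearMap.inl k X.carrier Y.carrier v.1 + LinearMap.inr k X.carrier Y.carrier v.2 := by
  simp

theorem sumCoact_coassoc (X Y : YetterDrinfeld k A) (v : X.carrier × Y.carrier) :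
    TensorProduct.assoc k (X.carrier × Y.carrier) A A
      ((sumCoact X Y).rTensor A (sumCoact X Y v)) =
      Coalgebra.comul.lTensor (X.carrier × Y.carrier) (sumCoact X Y v) := by
  have hX := coassoc_left (BialgHom.id k A) (LinearMap.inl k X.carrier Y.carrier) X.coact
    (sumCoact X Y) (fun x => (sumCoact_inl X Y x).symm) v.1
  rw [X.coaction.coassoc, coassoc_right (BialgHom.id k A) (LinearMap.inl k X.carrier Y.carrier)
    X.coact (sumCoact X Y) (fun x => (sumCoact_inl X Y x).symm)] at hX
  have hY := coassoc_left (BialgHom.id k A) (LinearMap.inr k X.carrier Y.carrier) Y.coact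
    (sumCoact X Y) (fun x => (sumCoact_inr X Y x).symm) v.2
  rw [Y.coaction.coassoc, coassoc_right (BialgHom.id k A) (LinearMap.inr k X.carrier Y.carrier)
    Y.coact (sumCoact X Y) (fun x => (sumCoact_inr X Y x).symm)] at hY
  rw [sum_eq X Y v]
  simp only [map_add]
  rw [hX, hY]

theorem sum_yd (X Y : YetterDrinfeld k A) (v : X.carrier × Y.carrier) (a : A) :
    sumCoact X Y (sumAct X Y v a) = ydTwist (sumAct X Y) (sumCoact X Y v)
      (Coalgebra.comul.lTensor A (Coalgebra.comul a)) := by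
  have hX : sumCoact X Y (sumAct X Y (LinearMap.inl k X.carrier Y.carrier v.1) a) =
      ydTwist (sumAct X Y) (sumCoact X Y (LinearMap.inl k X.carrier Y.carrier v.1))
      (Coalgebra.comul.lTensor A (Coalgebra.comul a)) := by
    have h1 : sumAct X Y (LinearMap.inl k _ _ v.1) a = LinearMap.inl k _ _ (X.act v.1 a) := by
      simp [sumAct_apply]
    have h2 := ydTwist_map (BialgHom.id k A) (LinearMap.inl k X.carrier Y.carrier) X.act
      (sumAct X Y) (fun v b => by simp [sumAct_apply]) (X.coact v.1)
      (Coalgebra.comul.lTensor A (Coalgebra.comul a))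
    rw [comul_map] at h2
    rw [h1, sumCoact_inl, sumCoact_inl]
    exact (congrArg ((LinearMap.inl k X.carrier Y.carrier).rTensor A) (X.yd v.1 a)).trans h2
  have hY : sumCoact X Y (sumAct X Y (LinearMap.inr k X.carrier Y.carrier v.2) a) =
      ydTwist (sumAct X Y) (sumCoact X Y (LinearMap.inr k X.carrier Y.carrier v.2))
      (Coalgebra.comul.lTensor A (Coalgebra.comul a)) := by
    have h1 : sumAct X Y (LinearMap.inr k _ _ v.2) a = LinearMap.inr k _ _ (Y.act v.2 a) := by
      simp [sumAct_apply]
    have h2 := ydTwist_map (BialgHom.id k A) (LinearMap.inr k X.carrier Y.carrier) Y.act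
      (sumAct X Y) (fun v b => by simp [sumAct_apply]) (Y.coact v.2)
      (Coalgebra.comul.lTensor A (Coalgebra.comul a))
    rw [comul_map] at h2
    rw [h1, sumCoact_inr, sumCoact_inr]
    exact (congrArg ((LinearMap.inr k X.carrier Y.carrier).rTensor A) (Y.yd v.2 a)).trans h2
  rw [sum_eq X Y v]
  simp only [map_add, LinearMap.add_apply]
  rw [hX, hY]

theorem sumCoact_counit (X Y : YetterDrinfeld k A) (v : X.carrier × Y.carrier) :
    Coalgebra.counit.lTensor _ (sumCoact X Y v) = v ⊗ₜ[k] (1 : k) := by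
  have h : ∀ (φ : X.carrier →ₗ[k] X.carrier × Y.carrier) (t : X.carrier ⊗[k] A),
      Coalgebra.counit.lTensor _ (φ.rTensor A t) =
        φ.rTensor k (Coalgebra.counit.lTensor _ t) := fun φ t =>
    (LinearMap.congr_fun (LinearMap.lTensor_comp_rTensor _ _ _) t).trans
      (LinearMap.congr_fun (LinearMap.rTensor_comp_lTensor _ _ _) t).symm
  have h' : ∀ (φ : Y.carrier →ₗ[k] X.carrier × Y.carrier) (t : Y.carrier ⊗[k] A),
      Coalgebra.counit.lTensor _ (φ.rTensor A t) =
        φ.rTensor k (Coalgebra.counit.lTensor _ t) := fun φ t =>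
    (LinearMap.congr_fun (LinearMap.lTensor_comp_rTensor _ _ _) t).trans
      (LinearMap.congr_fun (LinearMap.rTensor_comp_lTensor _ _ _) t).symm
  simp only [sumCoact, LinearMap.add_apply, LinearMap.comp_apply, map_add, h, h',
    X.coaction.counit, Y.coaction.counit, LinearMap.rTensor_tmul]
  rw [← add_tmul]
  simp

/-- The direct sum of two Yetter–Drinfeld modules. -/
def directSum (X Y : YetterDrinfeld k A) : YetterDrinfeld k A where
  carrier := X.carrier × Y.carrier
  act := sumAct X Y
  act_one v := by simp [sumAct_apply, act_one]
  act_mul v a b := by simp [sumAct_apply, act_mul]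
  coaction :=
    { coact := sumCoact X Y
      coassoc := sumCoact_coassoc X Y
      counit := sumCoact_counit X Y }
  yd := sum_yd X Y

/-- The zero Yetter–Drinfeld module. -/
def zeroObj : YetterDrinfeld k A where
  carrier := PUnit
  act := 0
  act_one _ := rfl
  act_mul _ _ _ := rfl
  coaction :=
    { coact := 0
      coassoc := fun v => by simp
      counit := fun v => by rw [Subsingleton.elim v 0, zero_tmul]; simp }
  yd v a := by simp

variable {X Y Z : YetterDrinfeld k A}

/-- Lift a morphism through an injective one. -/
def liftInj (i : X ⟶ Y) (hi : Function.Injective i.lin) (g : Z ⟶ Y)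
    (h : ∀ z, g.lin z ∈ LinearMap.range i.lin) : Z ⟶ X :=
  let l : Z.carrier →ₗ[k] X.carrier :=
    (LinearEquiv.ofInjective i.lin hi).symm.toLinearMap ∘ₗ LinearMap.codRestrict _ g.lin h
  have hl : ∀ z, i.lin (l z) = g.lin z := fun z =>
    congrArg Subtype.val (LinearEquiv.apply_symm_apply (LinearEquiv.ofInjective i.lin hi)
      (LinearMap.codRestrict _ g.lin h z))
  have hl' : i.lin ∘ₗ l = g.lin := LinearMap.ext hl
  { lin := l
    map_act := fun z a => hi (by rw [hl, g.map_act, i.map_act, hl])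
    map_coact := fun z => by
      apply Module.Flat.rTensor_preserves_injective_linearMap (M := A) i.lin hi
      rw [i.map_coact, hl, ← LinearMap.rTensor_comp_apply, hl', g.map_coact] }

theorem liftInj_comp (i : X ⟶ Y) (hi : Function.Injective i.lin) (g : Z ⟶ Y)
    (h : ∀ z, g.lin z ∈ LinearMap.range i.lin) : liftInj i hi g h ≫ i = g :=
  hom_ext fun z => congrArg Subtype.val (LinearEquiv.apply_symm_apply
    (LinearEquiv.ofInjective i.lin hi) (LinearMap.codRestrict _ g.lin h z))

/-- Descend a morphism along a surjective one. -/
def descSurj (p : X ⟶ Y) (hp : Function.Surjective p.lin) (g : X ⟶ Z)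
    (h : LinearMap.ker p.lin ≤ LinearMap.ker g.lin) : Y ⟶ Z :=
  let l : Y.carrier →ₗ[k] Z.carrier :=
    (LinearMap.ker p.lin).liftQ g.lin h ∘ₗ
      (p.lin.quotKerEquivOfSurjective hp).symm.toLinearMap
  have hl : ∀ x, l (p.lin x) = g.lin x := fun x => by
    have : (p.lin.quotKerEquivOfSurjective hp).symm (p.lin x) = Submodule.Quotient.mk x := by
      rw [LinearEquiv.symm_apply_eq]; rfl
    simp [l, this]
  have hl' : l ∘ₗ p.lin = g.lin := LinearMap.ext hl
  { lin := l
    map_act := fun y a => by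
      obtain ⟨x, rfl⟩ := hp y
      rw [← p.map_act, hl, hl, g.map_act]
    map_coact := fun y => by
      obtain ⟨x, rfl⟩ := hp y
      rw [← p.map_coact, hl, ← LinearMap.rTensor_comp_apply, hl', g.map_coact] }

theorem comp_descSurj (p : X ⟶ Y) (hp : Function.Surjective p.lin) (g : X ⟶ Z)
    (h : LinearMap.ker p.lin ≤ LinearMap.ker g.lin) : p ≫ descSurj p hp g h = g :=
  hom_ext fun x => by
    have : (p.lin.quotKerEquivOfSurjective hp).symm (p.lin x) = Submodule.Quotient.mk x := by
      rw [LinearEquiv.symm_apply_eq]; rfl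
    simp [descSurj, this]

/-- An injective morphism onto the kernel of `g` is a categorical kernel of `g`. -/
def isLimitOfExact (i : X ⟶ Y) (g : Y ⟶ Z) (w : i ≫ g = 0) (hi : Function.Injective i.lin)
    (h : LinearMap.ker g.lin ≤ LinearMap.range i.lin) : IsLimit (KernelFork.ofι i w) :=
  KernelFork.IsLimit.ofι i w
    (fun {_} t ht => liftInj i hi t fun z => h (LinearMap.congr_fun (congrArg Hom.lin ht) z))
    (fun {_} t _ => liftInj_comp i hi t _)
    (fun {_} t _ _ hm => hom_ext fun z => hi
      ((LinearMap.congr_fun (congrArg Hom.lin hm) z).trans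
        (LinearMap.congr_fun (congrArg Hom.lin (liftInj_comp i hi t _)) z).symm))

/-- A surjective morphism whose kernel is the range of `f` is a categorical cokernel of `f`. -/
def isColimitOfExact (f : X ⟶ Y) (p : Y ⟶ Z) (w : f ≫ p = 0) (hp : Function.Surjective p.lin)
    (h : LinearMap.ker p.lin ≤ LinearMap.range f.lin) : IsColimit (CokernelCofork.ofπ p w) :=
  CokernelCofork.IsColimit.ofπ p w
    (fun {_} t ht => descSurj p hp t (by
      intro y hy
      obtain ⟨x, rfl⟩ := h hy
      exact LinearMap.congr_fun (congrArg Hom.lin ht) x))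
    (fun {_} t _ => comp_descSurj p hp t _)
    (fun {_} t ht _ hm => hom_ext fun z => by
      obtain ⟨y, rfl⟩ := hp z
      have hle : LinearMap.ker p.lin ≤ LinearMap.ker t.lin := by
        intro y hy
        obtain ⟨x, rfl⟩ := h hy
        exact LinearMap.congr_fun (congrArg Hom.lin ht) x
      exact (LinearMap.congr_fun (congrArg Hom.lin hm) y).trans
        (LinearMap.congr_fun (congrArg Hom.lin (comp_descSurj p hp t hle)) y).symm)

/-- A Yetter–Drinfeld submodule. -/
def sub (X : YetterDrinfeld k A) (W : Submodule k X.carrier)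
    (hact : ∀ w ∈ W, ∀ a, X.act w a ∈ W)
    (hco : ∀ w ∈ W, X.coact w ∈ LinearMap.range (W.subtype.rTensor A)) : YetterDrinfeld k A :=
  pull (BialgHom.id k A) Function.injective_id X W hact hco

/-- The inclusion of a Yetter–Drinfeld submodule. -/
def subι (X : YetterDrinfeld k A) (W : Submodule k X.carrier)
    (hact : ∀ w ∈ W, ∀ a, X.act w a ∈ W)
    (hco : ∀ w ∈ W, X.coact w ∈ LinearMap.range (W.subtype.rTensor A)) : sub X W hact hco ⟶ X where
  lin := W.subtype
  map_act _ _ := rfl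
  map_coact v := map_pullCoact (BialgHom.id k A) Function.injective_id X W hco v

/-- The projection to a quotient. -/
def quotπ (X : YetterDrinfeld k A) (W : Submodule k X.carrier)
    (hact : ∀ w ∈ W, ∀ a, X.act w a ∈ W)
    (hco : ∀ w ∈ W, W.mkQ.rTensor A (X.coact w) = 0) : X ⟶ quot X W hact hco where
  lin := W.mkQ
  map_act _ _ := rfl
  map_coact _ := rfl

theorem ker_act (f : X ⟶ Y) : ∀ w ∈ LinearMap.ker f.lin, ∀ a, X.act w a ∈ LinearMap.ker f.lin :=
  fun w hw a => by
    rw [LinearMap.mem_ker] at hw ⊢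
    rw [f.map_act, hw]
    simp

theorem ker_coact (f : X ⟶ Y) : ∀ w ∈ LinearMap.ker f.lin,
    X.coact w ∈ LinearMap.range ((LinearMap.ker f.lin).subtype.rTensor A) := fun w hw => by
  have hex : Function.Exact (LinearMap.ker f.lin).subtype f.lin := LinearMap.exact_subtype_ker_map _
  refine (Module.Flat.rTensor_exact A hex _).1 ?_
  rw [f.map_coact, LinearMap.mem_ker.1 hw, map_zero]

theorem range_act (f : X ⟶ Y) :
    ∀ w ∈ LinearMap.range f.lin, ∀ a, Y.act w a ∈ LinearMap.range f.lin := by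
  rintro _ ⟨x, rfl⟩ a
  exact ⟨X.act x a, f.map_act x a⟩

theorem range_coact (f : X ⟶ Y) : ∀ w ∈ LinearMap.range f.lin,
    Y.coact w ∈ LinearMap.range ((LinearMap.range f.lin).subtype.rTensor A) := by
  rintro _ ⟨x, rfl⟩
  refine ⟨f.lin.rangeRestrict.rTensor A (X.coact x), ?_⟩
  rw [← f.map_coact, ← LinearMap.rTensor_comp_apply]
  rfl

theorem range_coact' (f : X ⟶ Y) : ∀ w ∈ LinearMap.range f.lin,
    (LinearMap.range f.lin).mkQ.rTensor A (Y.coact w) = 0 := by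
  rintro _ ⟨x, rfl⟩
  rw [← f.map_coact, ← LinearMap.rTensor_comp_apply, LinearMap.range_mkQ_comp]
  simp

/-- Kernels, cokernels and images, computed on underlying vector spaces. -/
def abelianStruct (f : X ⟶ Y) : Abelian.AbelianStruct f :=
  have w1 : subι X _ (ker_act f) (ker_coact f) ≫ f = 0 := hom_ext fun v => v.2
  have w2 : f ≫ quotπ Y _ (range_act f) (range_coact' f) = 0 := hom_ext fun v =>
    (Submodule.Quotient.mk_eq_zero _).2 ⟨v, rfl⟩
  have inj : Function.Injective (subι Y _ (range_act f) (range_coact f)).lin :=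
    Submodule.subtype_injective _
  let π : X ⟶ sub Y _ (range_act f) (range_coact f) :=
    liftInj (subι Y _ (range_act f) (range_coact f)) inj f fun z => ⟨⟨f.lin z, z, rfl⟩, rfl⟩
  have hπ : ∀ x, (π.lin x : LinearMap.range f.lin).1 = f.lin x := fun x =>
    LinearMap.congr_fun (congrArg Hom.lin (liftInj_comp _ inj f _)) x
  { kernelFork := KernelFork.ofι _ w1
    isLimitKernelFork := isLimitOfExact _ _ w1 (Submodule.subtype_injective _)
      fun x hx => ⟨⟨x, hx⟩, rfl⟩
    cokernelCofork := CokernelCofork.ofπ _ w2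
    isColimitCokernelCofork := isColimitOfExact _ _ w2 (Submodule.mkQ_surjective _)
      fun x hx => (Submodule.Quotient.mk_eq_zero _).1 hx
    image := sub Y _ (range_act f) (range_coact f)
    imageπ := π
    ι_imageπ := hom_ext fun v => Subtype.ext ((hπ _).trans v.2)
    imageIsCokernel := isColimitOfExact _ _ _
      (fun y => by
        obtain ⟨_, x, rfl⟩ := y
        exact ⟨x, Subtype.ext (hπ x)⟩)
      (fun x hx => ⟨⟨x, (hπ x).symm.trans (congrArg Subtype.val hx)⟩, rfl⟩)
    imageι := subι Y _ (range_act f) (range_coact f)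
    imageι_π := hom_ext fun v => (Submodule.Quotient.mk_eq_zero _).2 v.2
    imageIsKernel := isLimitOfExact _ _ _ inj
      fun y hy => ⟨⟨y, (Submodule.Quotient.mk_eq_zero _).1 hy⟩, rfl⟩
    fac := liftInj_comp _ inj f _ }

instance : HasZeroObject (YetterDrinfeld k A) :=
  ⟨⟨zeroObj, fun _ => ⟨⟨⟨0⟩, fun f => hom_ext fun v => by
      rw [show v = 0 from Subsingleton.elim (α := PUnit) _ _]; simp⟩⟩,
    fun _ => ⟨⟨⟨0⟩, fun f => hom_ext fun v => Subsingleton.elim (α := PUnit) _ _⟩⟩⟩⟩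

/-- The biproduct bicone on the direct sum. -/
def sumBicone (X Y : YetterDrinfeld k A) : BinaryBicone X Y where
  pt := directSum X Y
  fst := ⟨LinearMap.fst k _ _, fun v a => congrArg Prod.fst (sumAct_apply X Y v a),
    fst_sumCoact X Y⟩
  snd := ⟨LinearMap.snd k _ _, fun v a => congrArg Prod.snd (sumAct_apply X Y v a),
    snd_sumCoact X Y⟩
  inl := ⟨LinearMap.inl k _ _, fun v a => ((sumAct_apply X Y (v, 0) a).trans (by simp only [map_zero]; rfl)).symm,
    fun v => (sumCoact_inl X Y v).symm⟩
  inr := ⟨LinearMap.inr k _ _, fun v a => ((sumAct_apply X Y (0, v) a).trans (by simp only [map_zero]; rfl)).symm,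
    fun v => (sumCoact_inr X Y v).symm⟩
  inl_fst := hom_ext fun _ => rfl
  inl_snd := hom_ext fun _ => rfl
  inr_fst := hom_ext fun _ => rfl
  inr_snd := hom_ext fun _ => rfl

instance : HasBinaryBiproducts (YetterDrinfeld k A) :=
  ⟨fun X Y => hasBinaryBiproduct_of_total (sumBicone X Y) (hom_ext fun v =>
    (Prod.ext (add_zero v.1) (zero_add v.2) : ((v.1, 0) + (0, v.2) : X.carrier × Y.carrier) = v))⟩

instance : HasFiniteProducts (YetterDrinfeld k A) :=
  hasFiniteProducts_of_has_binary_and_terminal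

/-- The category of Yetter–Drinfeld modules is abelian. -/
instance : Abelian (YetterDrinfeld k A) := Abelian.mk' fun _ _ f => ⟨abelianStruct f⟩

instance : HasExt.{u + 1} (YetterDrinfeld k A) := HasExt.standard _

end Abelian

end YetterDrinfeld

/-! ### Gerstenhaber–Schack cohomology -/

section GS

open YetterDrinfeld

variable {k A : Type u} [Field k] [Ring A] [HopfAlgebra k A]

/-- The Gerstenhaber–Schack cohomology `H^n_GS(A, M) = Ext^n(k, M)`, the extensions being taken in
the abelian category of Yetter–Drinfeld modules over `A`. It is a vector space over `k`. -/
abbrev HGS (n : ℕ) (M : YetterDrinfeld k A) : Type (u + 1) :=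
  Abelian.Ext.{u + 1} (trivialModule k A) M n

/-- Functoriality of `H^n_GS(A, M)` in `M`. -/
def HGS.map (n : ℕ) {M N : YetterDrinfeld k A} (f : M ⟶ N) : HGS n M →ₗ[k] HGS n N :=
  (Abelian.Ext.mk₀ f).postcompOfLinear k (trivialModule k A) (add_zero n)

end GS

section FreeProduct

variable (k A B : Type u) [Field k] [Ring A] [Ring B] [HopfAlgebra k A] [HopfAlgebra k B]

/-- The restriction functor `M ↦ M^(A)` from Yetter–Drinfeld modules over `A * B` to those
over `A`. -/
abbrev resLeft : YetterDrinfeld k (FreeProd k A B) ⥤ YetterDrinfeld k A :=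
  YetterDrinfeld.restriction (FreeProd.inlBialg k A B) (FreeProd.inlBialg_injective k A B)

/-- The restriction functor `M ↦ M^(B)` from Yetter–Drinfeld modules over `A * B` to those
over `B`. -/
abbrev resRight : YetterDrinfeld k (FreeProd k A B) ⥤ YetterDrinfeld k B :=
  YetterDrinfeld.restriction (FreeProd.inrBialg k A B) (FreeProd.inrBialg_injective k A B)

end FreeProduct

end

/-!
The invariant functional of a cosemisimple Hopf algebra splits `A = k1 ⊕ ker h` into subcoalgebras,
so the alternating words in `A * B` decompose it as `A ⊕ D` with `D` a subcoalgebra. The resulting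
bicolinear retraction `A * B → A` makes `M ↦ M^(A)` exact, and composing it with `h` yields an
invariant functional on `A * B`, so that coinvariants lift along epimorphisms.

Every Yetter–Drinfeld module over `A * B` embeds in a cofree one on an injective module `N`, which
is injective and has injective restrictions. The main input is that a linear map `g : W → N` from an
`A`-module splits as an `A`-linear map plus one with values in the `B`-invariants: over the
coproduct, `A` and `B` can act on `N ⊕ W` independently, here so that `N` has the complement `W`
over `A` and the graph of `-g` over `B`, and the splitting comes from a retraction onto `N`. For
`W = k` this shows that the coinvariants of a cofree module are sums of an `A`-invariant and a
`B`-invariant element. This property passes to quotients, and for a module `M` having it, a diagram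
chase in an embedding of `M` in a cofree module shows that
`H¹(A * B, M) ≃ H¹(A, M^(A)) ⊕ H¹(B, M^(B))`. Dimension shifting along the cokernel of a cofree
embedding gives all degrees `n ≥ 2`.
-/

noncomputable section

/-! ### Invariant functionals -/

section Haar

variable {k : Type u} [Field k]

/-- The left action `l ⇀ c = c₍₁₎ l(c₍₂₎)` of the dual algebra on a coalgebra. -/
def leftHit {C : Type u} [AddCommGroup C] [Module k C] [Coalgebra k C] (l : C →ₗ[k] k) :
    C →ₗ[k] C :=
  (TensorProduct.rid k C).toLinearMap ∘ₗ l.lTensor C ∘ₗ Coalgebra.comul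

theorem leftHit_map {C D F : Type u} [AddCommGroup C] [Module k C] [Coalgebra k C]
    [AddCommGroup D] [Module k D] [Coalgebra k D] [FunLike F C D] [CoalgHomClass F k C D]
    (f : F) (l : D →ₗ[k] k) (c : C) :
    leftHit l (f c) = f (leftHit (l ∘ₗ (f : C →ₗ[k] D)) c) := by
  have h : (TensorProduct.rid k D).toLinearMap ∘ₗ l.lTensor D ∘ₗ
        TensorProduct.map (f : C →ₗ[k] D) (f : C →ₗ[k] D) =
      (f : C →ₗ[k] D) ∘ₗ (TensorProduct.rid k C).toLinearMap ∘ₗ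
        (l ∘ₗ (f : C →ₗ[k] D)).lTensor C := by
    ext; simp
  have := LinearMap.congr_fun h (Coalgebra.comul c)
  rwa [LinearMap.comp_apply, LinearMap.comp_apply, CoalgHomClass.map_comp_comul_apply] at this

theorem leftHit_counit {C : Type u} [AddCommGroup C] [Module k C] [Coalgebra k C] (c : C) :
    leftHit (Coalgebra.counit (R := k)) c = c := by
  simp [leftHit]

variable {A : Type u} [Ring A] [Bialgebra k A]

/-- The functional `h` is right invariant: `h(a₍₁₎) a₍₂₎ = h(a) 1`. -/
def RightInvariant (h : A →ₗ[k] k) : Prop :=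
  ∀ a, h.rTensor A (Coalgebra.comul a) = h a ⊗ₜ[k] (1 : A)

/-- The functional `h` is left invariant: `a₍₁₎ h(a₍₂₎) = h(a) 1`. -/
def LeftInvariant (h : A →ₗ[k] k) : Prop :=
  ∀ a, leftHit h a = h a • (1 : A)

/-- A coalgebra as a right comodule over itself. -/
def regularCoaction (k C : Type u) [Field k] [AddCommGroup C] [Module k C] [Coalgebra k C] :
    Coaction k C C where
  coact := Coalgebra.comul
  coassoc := Coalgebra.coassoc_apply
  counit := Coalgebra.lTensor_counit_comul

theorem exists_rightInvariant (hA : IsCosemisimple k A) :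
    ∃ h : A →ₗ[k] k, h 1 = 1 ∧ RightInvariant h := by
  obtain ⟨W, hW, hc⟩ := hA A (regularCoaction k A) (k ∙ (1 : A)) fun w hw => by
    obtain ⟨c, rfl⟩ := Submodule.mem_span_singleton.1 hw
    refine ⟨⟨c • 1, hw⟩ ⊗ₜ 1, ?_⟩
    simp [regularCoaction, Algebra.TensorProduct.one_def, smul_tmul']
  have one_notMem : (1 : A) ∉ W := fun hmem => by
    have h0 : (1 : A) ∈ (k ∙ (1 : A)) ⊓ W := ⟨Submodule.mem_span_singleton_self 1, hmem⟩
    rw [hc.inf_eq_bot, Submodule.mem_bot] at h0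
    simpa using congrArg (Coalgebra.counit (R := k)) h0
  obtain ⟨f, hf1, hfW⟩ := Submodule.exists_dual_map_eq_bot_of_notMem one_notMem inferInstance
  have hf : f ∘ₗ W.subtype = 0 := by
    ext w
    exact (Submodule.eq_bot_iff _).1 hfW _ (Submodule.mem_map_of_mem w.2)
  refine ⟨(f 1)⁻¹ • f, inv_mul_cancel₀ hf1, fun a => ?_⟩
  obtain ⟨_, hx, w, hw, rfl⟩ := Submodule.mem_sup.1 (hc.sup_eq_top ▸ Submodule.mem_top : a ∈ _)
  obtain ⟨c, rfl⟩ := Submodule.mem_span_singleton.1 hx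
  obtain ⟨t, ht⟩ := hW w hw
  have hΔw : f.rTensor A (Coalgebra.comul w) = 0 := by
    rw [show Coalgebra.comul w = W.subtype.rTensor A t from ht.symm,
      ← LinearMap.rTensor_comp_apply, hf, LinearMap.rTensor_zero, LinearMap.zero_apply]
  have hfw : f w = 0 := LinearMap.congr_fun hf ⟨w, hw⟩
  simp [hΔw, hfw, Algebra.TensorProduct.one_def, smul_tmul', LinearMap.rTensor_smul]

theorem Coaction.IsSubcomodule.eq_bot_of_rightInvariant {W : Submodule k A}
    (hW : (regularCoaction k A).IsSubcomodule W) {d : A →ₗ[k] k} (hd : RightInvariant d)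
    (h1 : d 1 = 0) (hinj : Function.Injective (d ∘ₗ W.subtype)) : W = ⊥ := by
  refine (Submodule.eq_bot_iff W).2 fun c hc => ?_
  obtain ⟨t, ht⟩ := hW c hc
  have ht_eq : t = (⟨c, hc⟩ : W) ⊗ₜ[k] (1 : A) := by
    apply Module.Flat.rTensor_preserves_injective_linearMap (M := A) _ hinj
    rw [LinearMap.rTensor_comp_apply, ht]
    exact hd c
  have hc1 : c = Coalgebra.counit (R := k) c • 1 := by
    have h2 := congrArg (TensorProduct.lid k A ∘ Coalgebra.counit.rTensor A) ht
    rw [ht_eq] at h2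
    simpa [regularCoaction] using h2.symm
  have hdc : d c = 0 := by rw [hc1, map_smul, h1, smul_zero]
  exact congrArg Subtype.val (hinj (by simpa using hdc) : (⟨c, hc⟩ : W) = 0)

theorem RightInvariant.eq_zero (hA : IsCosemisimple k A) {d : A →ₗ[k] k} (hd : RightInvariant d)
    (h1 : d 1 = 0) : d = 0 := by
  obtain ⟨W, hW, hc⟩ := hA A (regularCoaction k A) (LinearMap.ker d) fun w hw => by
    refine (Module.Flat.rTensor_exact A (LinearMap.exact_subtype_ker_map d) _).1 ((hd w).trans ?_)
    rw [LinearMap.mem_ker.1 hw, zero_tmul]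
  have hinj : Function.Injective (d ∘ₗ W.subtype) := by
    rw [← LinearMap.ker_eq_bot, LinearMap.ker_comp, ← Submodule.disjoint_iff_comap_eq_bot]
    exact hc.symm.disjoint
  rw [← LinearMap.ker_eq_top, ← hc.sup_eq_top, hW.eq_bot_of_rightInvariant hd h1 hinj, sup_bot_eq]

theorem convMul_eq_comp_leftHit {C : Type u} [AddCommGroup C] [Module k C] [Coalgebra k C]
    (φ ψ : C →ₗ[k] k) :
    WithConv.toConv φ * WithConv.toConv ψ = WithConv.toConv (φ ∘ₗ leftHit ψ) := by
  have h : LinearMap.mul' k k ∘ₗ TensorProduct.map φ ψ =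
      φ ∘ₗ (TensorProduct.rid k C).toLinearMap ∘ₗ ψ.lTensor C := by
    ext; simp [mul_comm]
  ext c
  exact LinearMap.congr_fun h (Coalgebra.comul c)

theorem convMul_eq_comp_lid {C : Type u} [AddCommGroup C] [Module k C] [Coalgebra k C]
    (φ ψ : C →ₗ[k] k) :
    WithConv.toConv φ * WithConv.toConv ψ = WithConv.toConv
      (ψ ∘ₗ (TensorProduct.lid k C).toLinearMap ∘ₗ φ.rTensor C ∘ₗ Coalgebra.comul) := by
  have h : LinearMap.mul' k k ∘ₗ TensorProduct.map φ ψ =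
      ψ ∘ₗ (TensorProduct.lid k C).toLinearMap ∘ₗ φ.rTensor C := by
    ext; simp
  ext c
  exact LinearMap.congr_fun h (Coalgebra.comul c)

theorem rightInvariant_iff_convMul {h : A →ₗ[k] k} : RightInvariant h ↔
    ∀ ψ : A →ₗ[k] k, WithConv.toConv h * WithConv.toConv ψ = ψ 1 • WithConv.toConv h := by
  simp only [convMul_eq_comp_lid]
  refine ⟨fun hh ψ => ?_, fun hh a => ?_⟩
  · ext a
    simp [hh a, mul_comm]
  · refine (TensorProduct.lid k A).injective (sub_eq_zero.1 ?_)
    rw [← Module.forall_dual_apply_eq_zero_iff k]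
    intro ψ
    simpa [sub_eq_zero, mul_comm] using LinearMap.congr_fun (congrArg WithConv.ofConv (hh ψ)) a

theorem leftInvariant_iff_convMul {h : A →ₗ[k] k} : LeftInvariant h ↔
    ∀ φ : A →ₗ[k] k, WithConv.toConv φ * WithConv.toConv h = φ 1 • WithConv.toConv h := by
  simp only [convMul_eq_comp_leftHit]
  refine ⟨fun hh φ => ?_, fun hh a => sub_eq_zero.1 ?_⟩
  · ext a
    simp [hh a, mul_comm]
  · rw [← Module.forall_dual_apply_eq_zero_iff k]
    intro φ
    simpa [sub_eq_zero, mul_comm] using LinearMap.congr_fun (congrArg WithConv.ofConv (hh φ)) a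

theorem RightInvariant.leftInvariant (hA : IsCosemisimple k A) {h : A →ₗ[k] k}
    (hh : RightInvariant h) (h1 : h 1 = 1) : LeftInvariant h := by
  rw [leftInvariant_iff_convMul]
  rw [rightInvariant_iff_convMul] at hh
  intro φ
  let d := WithConv.toConv φ * WithConv.toConv h - φ 1 • WithConv.toConv h
  have hd : RightInvariant d.ofConv := rightInvariant_iff_convMul.2 fun ψ => by
    simp only [d, WithConv.toConv_ofConv, sub_mul, mul_assoc, smul_mul_assoc, hh ψ,
      mul_smul_comm, smul_sub, smul_comm (φ 1)]
  have hd1 : d.ofConv 1 = 0 := by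
    simp [d, h1, Algebra.TensorProduct.one_def]
  exact sub_eq_zero.1 (congrArg WithConv.toConv (hd.eq_zero hA hd1))

end Haar

/-! ### Subcoalgebras -/

section Subcoalgebra

variable {k : Type u} [Field k]

/-- The square `D ⊗ D` of a submodule `D`, as a submodule of the ambient tensor square. -/
def tensorSquare {C : Type u} [AddCommGroup C] [Module k C] (D : Submodule k C) :
    Submodule k (C ⊗[k] C) :=
  Submodule.map₂ (TensorProduct.mk k C C) D D

theorem tensorSquare_mono {C : Type u} [AddCommGroup C] [Module k C] {D E : Submodule k C}
    (h : D ≤ E) : tensorSquare D ≤ tensorSquare E :=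
  Submodule.map₂_le_map₂ h h

/-- A submodule `D` of a coalgebra is a subcoalgebra if `Δ(D) ⊆ D ⊗ D`. -/
def IsSubcoalgebra {C : Type u} [AddCommGroup C] [Module k C] [Coalgebra k C]
    (D : Submodule k C) : Prop :=
  ∀ x ∈ D, Coalgebra.comul x ∈ tensorSquare D

section Coalgebra

variable {C C' : Type u} [AddCommGroup C] [Module k C] [Coalgebra k C]
  [AddCommGroup C'] [Module k C'] [Coalgebra k C']

theorem IsSubcoalgebra.iSup {ι : Sort*} {D : ι → Submodule k C} (hD : ∀ n, IsSubcoalgebra (D n)) :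
    IsSubcoalgebra (⨆ n, D n) := fun x hx => by
  have hle : ⨆ n, D n ≤ (tensorSquare (⨆ n, D n)).comap Coalgebra.comul :=
    iSup_le fun n x hx => tensorSquare_mono (le_iSup D n) (hD n x hx)
  exact hle hx

theorem IsSubcoalgebra.sup {D E : Submodule k C} (hD : IsSubcoalgebra D)
    (hE : IsSubcoalgebra E) : IsSubcoalgebra (D ⊔ E) := by
  rw [sup_eq_iSup]
  exact .iSup (Bool.forall_bool.2 ⟨hE, hD⟩)

theorem IsSubcoalgebra.map {D : Submodule k C} (hD : IsSubcoalgebra D) (f : C →ₗc[k] C') :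
    IsSubcoalgebra (D.map (f : C →ₗ[k] C')) := by
  rintro _ ⟨x, hx, rfl⟩
  have hle : tensorSquare D ≤ (tensorSquare (D.map (f : C →ₗ[k] C'))).comap
      (TensorProduct.map (f : C →ₗ[k] C') (f : C →ₗ[k] C')) :=
    Submodule.map₂_le.2 fun x hx y hy => Submodule.apply_mem_map₂ _
      (Submodule.mem_map_of_mem hx) (Submodule.mem_map_of_mem hy)
  have := hle (hD x hx)
  rwa [Submodule.mem_comap, CoalgHomClass.map_comp_comul_apply] at this

theorem IsSubcoalgebra.leftHit_eq_zero {D : Submodule k C} (hD : IsSubcoalgebra D)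
    {l : C →ₗ[k] k} (hl : ∀ x ∈ D, l x = 0) {x : C} (hx : x ∈ D) : leftHit l x = 0 := by
  have hle : tensorSquare D ≤
      LinearMap.ker ((TensorProduct.rid k C).toLinearMap ∘ₗ l.lTensor C) :=
    Submodule.map₂_le.2 fun x _ y hy => by simp [hl y hy]
  exact hle (hD x hx)

end Coalgebra

section Bialgebra

variable {H : Type u} [Ring H] [Bialgebra k H]

theorem isSubcoalgebra_one : IsSubcoalgebra (1 : Submodule k H) := fun x hx => by
  obtain ⟨c, rfl⟩ := Submodule.mem_one.1 hx
  rw [Bialgebra.comul_algebraMap, Algebra.algebraMap_eq_smul_one, Algebra.TensorProduct.one_def]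
  exact Submodule.smul_mem _ c (Submodule.apply_mem_map₂ _
    (Submodule.one_le.1 le_rfl) (Submodule.one_le.1 le_rfl))

theorem tensorSquare_mul_le (D E : Submodule k H) :
    tensorSquare D * tensorSquare E ≤ tensorSquare (D * E) := by
  simp only [tensorSquare, Submodule.map₂_eq_span_image2, Submodule.span_mul_span]
  rw [Submodule.span_le, Set.mul_subset_iff]
  rintro _ ⟨a, ha, b, hb, rfl⟩ _ ⟨c, hc, d, hd, rfl⟩
  exact Submodule.subset_span ⟨a * c, Submodule.mul_mem_mul ha hc, b * d,
    Submodule.mul_mem_mul hb hd, (Algebra.TensorProduct.tmul_mul_tmul a c b d).symm⟩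

theorem IsSubcoalgebra.mul {D E : Submodule k H} (hD : IsSubcoalgebra D) (hE : IsSubcoalgebra E) :
    IsSubcoalgebra (D * E) := fun x hx => by
  have hle : D * E ≤ (tensorSquare (D * E)).comap Coalgebra.comul :=
    Submodule.mul_le.2 fun x hx y hy => by
      rw [Submodule.mem_comap, Bialgebra.comul_mul]
      exact tensorSquare_mul_le D E (Submodule.mul_mem_mul (hD x hx) (hE y hy))
  exact hle hx

theorem LeftInvariant.isSubcoalgebra_ker {h : H →ₗ[k] k} (hl : LeftInvariant h)
    (hr : RightInvariant h) (h1 : h 1 = 1) : IsSubcoalgebra (LinearMap.ker h) := by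
  intro a ha
  let P : H →ₗ[k] H := LinearMap.id - h.smulRight 1
  have hP : ∀ x, P x ∈ LinearMap.ker h := fun x => by simp [P, h1]
  have hlT : P.lTensor H (Coalgebra.comul a) = Coalgebra.comul a := by
    have e : (h.smulRight (1 : H)).lTensor H =
        (TensorProduct.mk k H H).flip 1 ∘ₗ (TensorProduct.rid k H).toLinearMap ∘ₗ h.lTensor H := by
      ext; simp [smul_tmul']
    have := hl a
    rw [LinearMap.mem_ker.1 ha, zero_smul] at this
    simp [P, LinearMap.lTensor_sub, e, show TensorProduct.rid k H (h.lTensor H _) = 0 from this]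
  have hrT : P.rTensor H (Coalgebra.comul a) = Coalgebra.comul a := by
    have e : (h.smulRight (1 : H)).rTensor H =
        TensorProduct.mk k H H 1 ∘ₗ (TensorProduct.lid k H).toLinearMap ∘ₗ h.rTensor H := by
      ext; simp [smul_tmul]
    simp [P, LinearMap.rTensor_sub, e, hr a, LinearMap.mem_ker.1 ha]
  have hmap : LinearMap.range (TensorProduct.map P P) ≤ tensorSquare (LinearMap.ker h) := by
    rw [TensorProduct.range_map]
    exact tensorSquare_mono (LinearMap.range_le_iff_comap.2 (eq_top_iff.2 fun x _ => hP x))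
  refine hmap ⟨Coalgebra.comul a, ?_⟩
  rw [← LinearMap.lTensor_comp_rTensor, LinearMap.comp_apply, hrT, hlT]

end Bialgebra

end Subcoalgebra

/-! ### Alternating products of submodules -/

section AltProd

variable {k H : Type u} [Field k] [Ring H] [Algebra k H]

/-- The alternating product `U V U ⋯` with `n` factors. -/
def altProd (U V : Submodule k H) : ℕ → Submodule k H
  | 0 => 1
  | n + 1 => U * altProd V U n

/-- The sum of all alternating products `1`, `U`, `UV`, `UVU`, …. -/
def altSpan (U V : Submodule k H) : Submodule k H :=
  ⨆ n, altProd U V n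

theorem altSpan_eq (U V : Submodule k H) : altSpan U V = 1 ⊔ U * altSpan V U := by
  rw [altSpan, altSpan, Submodule.mul_iSup, ← sup_iSup_nat_succ]
  rfl

theorem one_le_altSpan (U V : Submodule k H) : 1 ≤ altSpan U V :=
  altSpan_eq U V ▸ le_sup_left

theorem mul_altSpan_le (U V : Submodule k H) : U * altSpan V U ≤ altSpan U V :=
  (altSpan_eq U V).symm ▸ le_sup_right

theorem le_altSpan (U V : Submodule k H) : U ≤ altSpan U V :=
  (mul_one U).symm.le.trans
    ((mul_le_mul_right (one_le_altSpan V U) U).trans (mul_altSpan_le U V))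

/-- The span of the alternating products of `U` and `V` having a factor `V`; in a coproduct of
algebras it is a complement of the first factor `1 + U`. -/
def altComplement (U V : Submodule k H) : Submodule k H :=
  (1 ⊔ U) * (V * altSpan U V)

theorem mul_altSpan_sup_le {U V : Submodule k H} (hU : U * U ≤ 1 ⊔ U) :
    U * (altSpan U V ⊔ altSpan V U) ≤ altSpan U V ⊔ altSpan V U := by
  rw [Submodule.mul_sup, sup_le_iff]
  refine ⟨?_, (mul_altSpan_le U V).trans le_sup_left⟩
  calc U * altSpan U V = U ⊔ U * U * altSpan V U := by
        rw [altSpan_eq, Submodule.mul_sup, mul_one, mul_assoc]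
    _ ≤ U ⊔ (1 ⊔ U) * altSpan V U := sup_le_sup_left (mul_le_mul_left hU _) _
    _ ≤ altSpan U V ⊔ altSpan V U := by
        rw [Submodule.sup_mul, one_mul]
        exact sup_le ((le_altSpan U V).trans le_sup_left)
          (sup_le le_sup_right ((mul_altSpan_le U V).trans le_sup_left))

theorem one_sup_mul_altSpan_sup_le {U V : Submodule k H} (hU : U * U ≤ 1 ⊔ U) :
    (1 ⊔ U) * (altSpan U V ⊔ altSpan V U) ≤ altSpan U V ⊔ altSpan V U := by
  rw [Submodule.sup_mul, one_mul]
  exact sup_le le_rfl (mul_altSpan_sup_le hU)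

theorem altSpan_sup_le (U V : Submodule k H) :
    altSpan U V ⊔ altSpan V U ≤ (1 ⊔ U) ⊔ altComplement U V := by
  have hV : altSpan V U ≤ 1 ⊔ V * altSpan U V := (altSpan_eq V U).le
  rw [altComplement, Submodule.sup_mul, one_mul]
  refine sup_le ?_ (hV.trans (sup_le_sup le_sup_left le_sup_left))
  calc altSpan U V ≤ 1 ⊔ U * (1 ⊔ V * altSpan U V) :=
        (altSpan_eq U V).le.trans (sup_le_sup_left (mul_le_mul_right hV U) 1)
    _ = (1 ⊔ U) ⊔ U * (V * altSpan U V) := by rw [Submodule.mul_sup, mul_one, sup_assoc]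
    _ ≤ _ := sup_le_sup_left le_sup_right _

theorem apply_mem_of_mem_altProd {M : Type u} [AddCommGroup M] [Module k M]
    (π : H →ₐ[k] Module.End k M) {U V : Submodule k H} {W₁ W₂ : Submodule k M}
    (hU : ∀ u ∈ U, ∀ w ∈ W₁, π u w ∈ W₂) (hV : ∀ v ∈ V, ∀ w ∈ W₂, π v w ∈ W₁)
    {Ω : M} (h₁ : Ω ∈ W₁) (h₂ : Ω ∈ W₂) (n : ℕ) :
    ∀ x ∈ altProd U V n, π x Ω ∈ W₂ := by
  induction n generalizing U V W₁ W₂ with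
  | zero =>
    intro x hx
    obtain ⟨c, rfl⟩ := Submodule.mem_one.1 hx
    simpa [Algebra.algebraMap_eq_smul_one] using W₂.smul_mem c h₂
  | succ n ih =>
    have hle : altProd U V (n + 1) ≤ W₂.comap (LinearMap.applyₗ Ω ∘ₗ π.toLinearMap) :=
      Submodule.mul_le.2 fun u hu x hx => by
        simpa using hU u hu _ (ih hV hU h₂ h₁ x hx)
    exact hle

theorem apply_mem_of_mem_altSpan {M : Type u} [AddCommGroup M] [Module k M]
    (π : H →ₐ[k] Module.End k M) {U V : Submodule k H} {W₁ W₂ : Submodule k M}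
    (hU : ∀ u ∈ U, ∀ w ∈ W₁, π u w ∈ W₂) (hV : ∀ v ∈ V, ∀ w ∈ W₂, π v w ∈ W₁)
    {Ω : M} (h₁ : Ω ∈ W₁) (h₂ : Ω ∈ W₂) {x : H} (hx : x ∈ altSpan U V) : π x Ω ∈ W₂ := by
  have hle : altSpan U V ≤ W₂.comap (LinearMap.applyₗ Ω ∘ₗ π.toLinearMap) :=
    iSup_le (apply_mem_of_mem_altProd π hU hV h₁ h₂)
  exact hle hx

theorem apply_mem_of_mem_altComplement {M : Type u} [AddCommGroup M] [Module k M]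
    (π : H →ₐ[k] Module.End k M) {U V : Submodule k H} {W₁ W₂ W₃ : Submodule k M}
    (hU : ∀ u ∈ U, ∀ w ∈ W₁, π u w ∈ W₂) (hV : ∀ v ∈ V, ∀ w ∈ W₂, π v w ∈ W₁ ⊓ W₃)
    (hR : ∀ r ∈ 1 ⊔ U, ∀ w ∈ W₃, π r w ∈ W₃)
    {Ω : M} (h₁ : Ω ∈ W₁) (h₂ : Ω ∈ W₂) {x : H} (hx : x ∈ altComplement U V) : π x Ω ∈ W₃ := by
  have hVP : V * altSpan U V ≤ W₃.comap (LinearMap.applyₗ Ω ∘ₗ π.toLinearMap) :=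
    Submodule.mul_le.2 fun v hv p hp => by
      simpa using (hV v hv _ (apply_mem_of_mem_altSpan π hU (fun v hv w hw => (hV v hv w hw).1)
        h₁ h₂ hp)).2
  have hle : altComplement U V ≤ W₃.comap (LinearMap.applyₗ Ω ∘ₗ π.toLinearMap) :=
    Submodule.mul_le.2 fun r hr y hy => by simpa using hR r hr _ (hVP hy)
  exact hle hx

theorem isSubcoalgebra_altProd {H : Type u} [Ring H] [Bialgebra k H] {U V : Submodule k H}
    (hU : IsSubcoalgebra U) (hV : IsSubcoalgebra V) (n : ℕ) : IsSubcoalgebra (altProd U V n) := by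
  induction n generalizing U V with
  | zero => exact isSubcoalgebra_one
  | succ n ih => exact hU.mul (ih hV hU)

theorem isSubcoalgebra_altComplement {H : Type u} [Ring H] [Bialgebra k H] {U V : Submodule k H}
    (hU : IsSubcoalgebra U) (hV : IsSubcoalgebra V) : IsSubcoalgebra (altComplement U V) :=
  (isSubcoalgebra_one.sup hU).mul (hV.mul (.iSup (isSubcoalgebra_altProd hU hV)))

end AltProd

/-! ### The Fock representation of a coproduct of algebras -/

section AltWord

/-- Alternating words in two alphabets `I` and `J`. The words in `AltWord I J true` do not start
with a letter of `I`, those in `AltWord I J false` do not start with a letter of `J`. -/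
inductive AltWord (I J : Type u) : Bool → Type u
  | nil (b : Bool) : AltWord I J b
  | consLeft (x : I) (w : AltWord I J true) : AltWord I J false
  | consRight (y : J) (w : AltWord I J false) : AltWord I J true

/-- Move a letter of `I` into the word, and take a letter of `J` off it. -/
def AltWord.swapLetter {I J : Type u} : AltWord I J true × Option I → AltWord I J false × Option J
  | (w, some x) => (.consLeft x w, none)
  | (.nil _, none) => (.nil _, none)
  | (.consRight y w, none) => (w, some y)

/-- Move a letter of `J` into the word, and take a letter of `I` off it. -/
def AltWord.unswapLetter {I J : Type u} :
    AltWord I J false × Option J → AltWord I J true × Option I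
  | (w, some y) => (.consRight y w, none)
  | (.nil _, none) => (.nil _, none)
  | (.consLeft x w, none) => (w, some x)

/-- The two ways of splitting an alternating word: with a possibly empty letter of `I` in front of
a word not starting in `I`, or with a possibly empty letter of `J` in front of a word not starting
in `J`. -/
def AltWord.letterEquiv (I J : Type u) :
    AltWord I J true × Option I ≃ AltWord I J false × Option J where
  toFun := swapLetter
  invFun := unswapLetter
  left_inv := by rintro ⟨w, _ | x⟩ <;> [cases w; skip] <;> rfl
  right_inv := by rintro ⟨w, _ | x⟩ <;> [cases w; skip] <;> rfl

end AltWord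

section Fock

variable {k A B : Type u} [Field k] [Ring A] [Ring B] [Algebra k A] [Algebra k B]

theorem exists_basis_of_unital_functional (h : A →ₗ[k] k) (h1 : h 1 = 1) :
    ∃ (I : Type u) (b : Module.Basis (Option I) k A),
      b none = 1 ∧ Submodule.span k (Set.range (b ∘ some)) = LinearMap.ker h := by
  obtain ⟨⟨I, c⟩⟩ := Module.Free.exists_basis k (LinearMap.ker h)
  let v : Option I → A := fun o => o.elim 1 fun x => c x
  have hv_some : v ∘ some = (LinearMap.ker h).subtype ∘ c := rfl
  have hspan : Submodule.span k (Set.range (v ∘ some)) = LinearMap.ker h := by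
    rw [hv_some, Set.range_comp, ← Submodule.map_span, c.span_eq, Submodule.map_top,
      Submodule.range_subtype]
  have hv : LinearIndependent k v := by
    refine linearIndependent_option.2 ⟨?_, ?_⟩
    · exact hv_some ▸ c.linearIndependent.map' _ (Submodule.ker_subtype _)
    · rw [hspan]
      simp [v, h1]
  refine ⟨_, Module.Basis.mk hv fun a _ => ?_, by simp [v], by rw [Module.Basis.coe_mk, hspan]⟩
  have hle : LinearMap.ker h ≤ Submodule.span k (Set.range v) :=
    hspan ▸ Submodule.span_mono (Set.range_comp_subset_range some v)
  have ha : a - h a • 1 ∈ LinearMap.ker h := by simp [h1]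
  rw [← sub_add_cancel a (h a • 1)]
  exact add_mem (hle ha) (Submodule.smul_mem _ _ (Submodule.subset_span ⟨none, rfl⟩))

variable {I J X Y : Type u}

/-- The isomorphism of free modules induced by a bijection of bases. -/
def fockEquiv (bA : Module.Basis (Option I) k A) (bB : Module.Basis (Option J) k B)
    (E : X × Option I ≃ Y × Option J) : (X →₀ A) ≃ₗ[k] (Y →₀ B) :=
  ((Finsupp.basis (fun _ : X => bA)).reindex (Equiv.sigmaEquivProd _ _)).equiv
    ((Finsupp.basis (fun _ : Y => bB)).reindex (Equiv.sigmaEquivProd _ _)) E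

theorem fockEquiv_single (bA : Module.Basis (Option I) k A) (bB : Module.Basis (Option J) k B)
    (E : X × Option I ≃ Y × Option J) (x : X) (o : Option I) :
    fockEquiv bA bB E (Finsupp.single x (bA o)) =
      Finsupp.single (E (x, o)).1 (bB (E (x, o)).2) := by
  have := ((Finsupp.basis (fun _ : X => bA)).reindex (Equiv.sigmaEquivProd _ _)).equiv_apply
    (b' := (Finsupp.basis (fun _ : Y => bB)).reindex (Equiv.sigmaEquivProd _ _)) (x, o) E
  simpa [fockEquiv] using this

theorem fockEquiv_symm (bA : Module.Basis (Option I) k A) (bB : Module.Basis (Option J) k B)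
    (E : X × Option I ≃ Y × Option J) :
    (fockEquiv bA bB E).symm = fockEquiv bB bA E.symm := rfl

/-- The vectors of the free module `X →₀ A` with scalar coordinates. -/
def scalarVectors (k A X : Type u) [Field k] [Ring A] [Algebra k A] : Submodule k (X →₀ A) :=
  Submodule.span k (Set.range fun x => Finsupp.single x 1)

theorem fockEquiv_smul_mem {h : A →ₗ[k] k} {bA : Module.Basis (Option I) k A}
    (hbA : Submodule.span k (Set.range (bA ∘ some)) = LinearMap.ker h)
    {bB : Module.Basis (Option J) k B} (hbB1 : bB none = 1) {E : X × Option I ≃ Y × Option J}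
    {y₀ : Y} (hE : ∀ x o, (E (x, some o)).2 = none ∧ (E (x, some o)).1 ≠ y₀)
    {a : A} (ha : h a = 0) {f : X →₀ A} (hf : f ∈ scalarVectors k A X) :
    fockEquiv bA bB E (a • f) ∈ scalarVectors k B Y ∧ fockEquiv bA bB E (a • f) y₀ = 0 := by
  let W : Submodule k (X →₀ A) :=
    (scalarVectors k B Y ⊓ LinearMap.ker (Finsupp.lapply y₀)).comap (fockEquiv bA bB E).toLinearMap
  have hW : Submodule.map₂ (Algebra.lsmul k k (X →₀ A)).toLinearMap (LinearMap.ker h)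
      (scalarVectors k A X) ≤ W := by
    rw [← hbA, scalarVectors, Submodule.map₂_span_span, Submodule.span_le]
    rintro _ ⟨_, ⟨o, rfl⟩, _, ⟨x, rfl⟩, rfl⟩
    have hs : fockEquiv bA bB E (bA (some o) • Finsupp.single x 1) =
        Finsupp.single (E (x, some o)).1 (1 : B) := by
      rw [Finsupp.smul_single, smul_eq_mul, mul_one, fockEquiv_single, (hE x o).1, hbB1]
    refine ⟨?_, LinearMap.mem_ker.2 ?_⟩
    · exact hs ▸ Submodule.subset_span ⟨_, rfl⟩
    · exact (DFunLike.congr_fun hs y₀).trans (Finsupp.single_eq_of_ne (hE x o).2.symm)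
  exact hW (Submodule.apply_mem_map₂ _ ha hf)

end Fock

section Coproduct

variable {k A B H : Type u} [Field k] [Ring A] [Ring B] [Ring H] [Algebra k A] [Algebra k B]
  [Algebra k H]

/-- The algebra `H` is the coproduct of `A` and `B`. Uniqueness of the lifts is replaced by the
equivalent condition that the images of `A` and `B` generate `H`, as an induction principle. -/
structure IsAlgCoprod (i : A →ₐ[k] H) (j : B →ₐ[k] H) : Prop where
  exists_lift : ∀ (C : Type u) [Ring C] [Algebra k C] (f : A →ₐ[k] C) (g : B →ₐ[k] C),
    ∃ φ : H →ₐ[k] C, (∀ a, φ (i a) = f a) ∧ ∀ b, φ (j b) = g b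
  induction : ∀ p : H → Prop, (∀ a, p (i a)) → (∀ b, p (j b)) → (∀ x y, p x → p y → p (x + y)) →
    (∀ x y, p x → p y → p (x * y)) → ∀ x, p x

theorem FreeProd.isAlgCoprod : IsAlgCoprod (FreeProd.inl k A B) (FreeProd.inr k A B) where
  exists_lift _ _ _ f g := ⟨FreeProd.lift f g, FreeProd.lift_inl f g, FreeProd.lift_inr f g⟩
  induction _ hl hr hadd hmul := FreeProd.induction hl hr hadd hmul

variable {i : A →ₐ[k] H} {j : B →ₐ[k] H}

theorem IsAlgCoprod.symm (hij : IsAlgCoprod i j) : IsAlgCoprod j i where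
  exists_lift C _ _ f g := by
    obtain ⟨φ, hg, hf⟩ := hij.exists_lift C g f
    exact ⟨φ, hf, hg⟩
  induction p hj hi := hij.induction p hi hj

/-- The image in `H` of the kernel of a functional on `A`. -/
abbrev kerImage (i : A →ₐ[k] H) (h : A →ₗ[k] k) : Submodule k H :=
  (LinearMap.ker h).map i.toLinearMap

theorem one_sup_kerImage (i : A →ₐ[k] H) {h : A →ₗ[k] k} (h1 : h 1 = 1) :
    1 ⊔ kerImage i h = LinearMap.range i.toLinearMap := by
  refine le_antisymm (sup_le (Submodule.one_le.2 ⟨1, map_one i⟩) LinearMap.map_le_range) ?_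
  rintro _ ⟨a, rfl⟩
  refine Submodule.mem_sup.2 ⟨algebraMap k H (h a), Submodule.algebraMap_mem _,
    i (a - h a • 1), ⟨_, by simp [h1], rfl⟩, ?_⟩
  simp [Algebra.algebraMap_eq_smul_one]

theorem kerImage_mul_kerImage_le (i : A →ₐ[k] H) {h : A →ₗ[k] k} (h1 : h 1 = 1) :
    kerImage i h * kerImage i h ≤ 1 ⊔ kerImage i h := by
  rw [one_sup_kerImage i h1, Submodule.mul_le]
  rintro _ ⟨a, -, rfl⟩ _ ⟨b, -, rfl⟩
  exact ⟨a * b, map_mul i a b⟩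

variable {φA : A →ₗ[k] k} {φB : B →ₗ[k] k}

theorem IsAlgCoprod.altSpan_sup_altSpan (hij : IsAlgCoprod i j) (h1A : φA 1 = 1)
    (h1B : φB 1 = 1) :
    altSpan (kerImage i φA) (kerImage j φB) ⊔ altSpan (kerImage j φB) (kerImage i φA) = ⊤ := by
  set S := altSpan (kerImage i φA) (kerImage j φB) ⊔ altSpan (kerImage j φB) (kerImage i φA)
    with hS
  have hl : ∀ x, ∀ s ∈ S, x * s ∈ S := by
    refine hij.induction _ (fun a s hs => ?_) (fun b s hs => ?_)
      (fun x y hx hy s hs => add_mul x y s ▸ S.add_mem (hx s hs) (hy s hs))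
      fun x y hx hy s hs => (mul_assoc x y s).symm ▸ hx _ (hy s hs)
    · refine one_sup_mul_altSpan_sup_le (kerImage_mul_kerImage_le i h1A)
        (Submodule.mul_mem_mul ?_ hs)
      exact one_sup_kerImage i h1A ▸ ⟨a, rfl⟩
    · rw [hS, sup_comm] at hs ⊢
      refine one_sup_mul_altSpan_sup_le (kerImage_mul_kerImage_le j h1B)
        (Submodule.mul_mem_mul ?_ hs)
      exact one_sup_kerImage j h1B ▸ ⟨b, rfl⟩
  have h1 : (1 : H) ∈ S := (one_le_altSpan _ _).trans le_sup_left (Submodule.one_le.1 le_rfl)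
  exact eq_top_iff.2 fun x _ => mul_one x ▸ hl x 1 h1

theorem IsAlgCoprod.range_sup_altComplement (hij : IsAlgCoprod i j) (h1A : φA 1 = 1)
    (h1B : φB 1 = 1) :
    LinearMap.range i.toLinearMap ⊔ altComplement (kerImage i φA) (kerImage j φB) = ⊤ := by
  rw [eq_top_iff, ← hij.altSpan_sup_altSpan h1A h1B, ← one_sup_kerImage i h1A]
  exact altSpan_sup_le _ _

theorem IsAlgCoprod.exists_projection (hij : IsAlgCoprod i j) (h1A : φA 1 = 1) (h1B : φB 1 = 1) :
    ∃ ρ : H →ₗ[k] A, (∀ a, ρ (i a) = a) ∧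
      ∀ x ∈ altComplement (kerImage i φA) (kerImage j φB), ρ x = 0 := by
  obtain ⟨I, bA, bA1, hbA⟩ := exists_basis_of_unital_functional φA h1A
  obtain ⟨J, bB, bB1, hbB⟩ := exists_basis_of_unital_functional φB h1B
  let E := AltWord.letterEquiv I J
  let x₀ : AltWord I J true := .nil _
  let y₀ : AltWord I J false := .nil _
  let e := fockEquiv bA bB E
  let Ω := Finsupp.single x₀ (1 : A)
  have hΩ : e Ω = Finsupp.single y₀ 1 := by
    have := fockEquiv_single bA bB E x₀ none
    rwa [bA1, show E (x₀, none) = (y₀, none) from rfl, bB1] at this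
  obtain ⟨π, hπA, hπB⟩ := hij.exists_lift (Module.End k (AltWord I J true →₀ A))
    (Algebra.lsmul k k _) ((e.symm.conjAlgEquiv k).toAlgHom.comp (Algebra.lsmul k k _))
  have hπi : ∀ a f, π (i a) f = a • f := fun a f => by rw [hπA]; rfl
  have hπj : ∀ b f, π (j b) f = e.symm (b • e f) := fun b f => by rw [hπB]; rfl
  let W₂ := (scalarVectors k B (AltWord I J false)).comap e.toLinearMap
  have hU : ∀ u ∈ kerImage i φA, ∀ w ∈ scalarVectors k A (AltWord I J true), π u w ∈ W₂ := by
    rintro _ ⟨a, ha, rfl⟩ w hw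
    have hE : ∀ x o, (E (x, some o)).2 = none ∧ (E (x, some o)).1 ≠ y₀ := fun x o => ⟨rfl, nofun⟩
    simpa [hπi, W₂] using (fockEquiv_smul_mem hbA bB1 hE ha hw).1
  have hV : ∀ v ∈ kerImage j φB, ∀ w ∈ W₂,
      π v w ∈ scalarVectors k A (AltWord I J true) ⊓ LinearMap.ker (Finsupp.lapply x₀) := by
    rintro _ ⟨b, hb, rfl⟩ w hw
    have hE : ∀ y o, (E.symm (y, some o)).2 = none ∧ (E.symm (y, some o)).1 ≠ x₀ :=
      fun y o => ⟨rfl, nofun⟩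
    simpa [hπj, e, fockEquiv_symm] using fockEquiv_smul_mem hbB bA1 hE hb hw
  refine ⟨Finsupp.lapply x₀ ∘ₗ LinearMap.applyₗ Ω ∘ₗ π.toLinearMap, fun a => by simp [hπi, Ω],
    fun x hx => ?_⟩
  refine LinearMap.mem_ker.1 (apply_mem_of_mem_altComplement π hU hV (fun r hr w hw => ?_)
    (Submodule.subset_span ⟨x₀, rfl⟩) ?_ hx)
  · rw [one_sup_kerImage i h1A] at hr
    obtain ⟨a, rfl⟩ := hr
    have hw0 : w x₀ = 0 := hw
    simp [hπi, hw0]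
  · exact Submodule.mem_comap.2 (hΩ ▸ Submodule.subset_span ⟨y₀, rfl⟩)

end Coproduct

section Retraction

variable {k A B H : Type u} [Field k] [Ring A] [Ring B] [Ring H] [Bialgebra k A] [Bialgebra k B]
  [Bialgebra k H] {i : A →ₐc[k] H} {j : B →ₐc[k] H}

theorem IsAlgCoprod.exists_retraction
    (hij : IsAlgCoprod (i : A →ₐ[k] H) (j : B →ₐ[k] H))
    (hA : IsCosemisimple k A) (hB : IsCosemisimple k B) :
    ∃ ρ : H →ₗ[k] A, (∀ a, ρ (i a) = a) ∧
      ∀ (φ : A →ₗ[k] k) (x : H), leftHit (φ ∘ₗ ρ) x = i (leftHit φ (ρ x)) := by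
  obtain ⟨φA, h1A, hrA⟩ := exists_rightInvariant hA
  obtain ⟨φB, h1B, hrB⟩ := exists_rightInvariant hB
  obtain ⟨ρ, hρi, hρ0⟩ := hij.exists_projection h1A h1B
  refine ⟨ρ, hρi, fun φ x => ?_⟩
  have hD : IsSubcoalgebra (altComplement (kerImage (i : A →ₐ[k] H) φA)
      (kerImage (j : B →ₐ[k] H) φB)) := isSubcoalgebra_altComplement
    (((hrA.leftInvariant hA h1A).isSubcoalgebra_ker hrA h1A).map (i : A →ₗc[k] H))
    (((hrB.leftInvariant hB h1B).isSubcoalgebra_ker hrB h1B).map (j : B →ₗc[k] H))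
  obtain ⟨_, ⟨a, rfl⟩, y, hy, rfl⟩ := Submodule.mem_sup.1
    (hij.range_sup_altComplement h1A h1B ▸ Submodule.mem_top : x ∈ _)
  have ha : leftHit (φ ∘ₗ ρ) (i a) = i (leftHit φ a) := by
    rw [leftHit_map, LinearMap.comp_assoc, show ρ ∘ₗ (i : A →ₗ[k] H) = .id from LinearMap.ext hρi,
      LinearMap.comp_id]
  have hy0 := hD.leftHit_eq_zero (l := φ ∘ₗ ρ) (fun x hx => by simp [hρ0 x hx]) hy
  have hρa : ρ (i a) = a := hρi a
  simp [ha, hy0, hρ0 y hy, hρa]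

theorem IsAlgCoprod.exists_leftInvariant
    (hij : IsAlgCoprod (i : A →ₐ[k] H) (j : B →ₐ[k] H))
    (hA : IsCosemisimple k A) (hB : IsCosemisimple k B) :
    ∃ l : H →ₗ[k] k, l 1 = 1 ∧ LeftInvariant l := by
  obtain ⟨h, h1, hr⟩ := exists_rightInvariant hA
  obtain ⟨ρ, hρi, hρ⟩ := hij.exists_retraction hA hB
  have hρ1 : ρ 1 = 1 := by rw [← map_one i, hρi]
  exact ⟨h ∘ₗ ρ, by simp [hρ1, h1], fun x => by simp [hρ, hr.leftInvariant hA h1 (ρ x)]⟩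

end Retraction

/-! ### Exactness of the restriction functors -/

namespace YetterDrinfeld

section Exact

variable {k A : Type u} [Field k] [Ring A] [HopfAlgebra k A] {X Y : YetterDrinfeld k A}

theorem injective_of_mono (f : X ⟶ Y) [Mono f] : Function.Injective f.lin := by
  rw [← LinearMap.ker_eq_bot, LinearMap.ker_eq_bot']
  intro x hx
  have ker_incl_eq_zero : subι X _ (ker_act f) (ker_coact f) = 0 := by
    rw [← cancel_mono f]
    exact hom_ext fun v => v.2.trans (by simp)
  exact LinearMap.congr_fun (congrArg Hom.lin ker_incl_eq_zero) (⟨x, hx⟩ : LinearMap.ker f.lin)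

theorem surjective_of_epi (f : X ⟶ Y) [Epi f] : Function.Surjective f.lin := by
  have proj_eq_zero : quotπ Y _ (range_act f) (range_coact' f) = 0 := by
    rw [← cancel_epi f]
    exact hom_ext fun v => (Submodule.Quotient.mk_eq_zero _).2 ⟨v, rfl⟩
  exact fun y => (Submodule.Quotient.mk_eq_zero _).1
    (LinearMap.congr_fun (congrArg Hom.lin proj_eq_zero) y)

theorem mono_of_injective (f : X ⟶ Y) (hf : Function.Injective f.lin) : Mono f :=
  ⟨fun _ _ h => hom_ext fun v => hf (LinearMap.congr_fun (congrArg Hom.lin h) v)⟩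

theorem epi_of_surjective (f : X ⟶ Y) (hf : Function.Surjective f.lin) : Epi f :=
  ⟨fun _ _ h => hom_ext fun v => by
    obtain ⟨x, rfl⟩ := hf v
    exact LinearMap.congr_fun (congrArg Hom.lin h) x⟩

theorem ker_le_range_of_shortExact {S : ShortComplex (YetterDrinfeld k A)} (hS : S.ShortExact) :
    LinearMap.ker S.g.lin ≤ LinearMap.range S.f.lin := by
  intro x hx
  have w : subι S.X₂ _ (ker_act S.g) (ker_coact S.g) ≫ S.g = 0 := hom_ext fun v => v.2
  have := hS.mono_f
  exact ⟨(hS.exact.lift _ w).lin ⟨x, hx⟩, LinearMap.congr_fun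
    (congrArg Hom.lin (hS.exact.lift_f _ w)) (⟨x, hx⟩ : LinearMap.ker S.g.lin)⟩

theorem shortExact_of_lin (S : ShortComplex (YetterDrinfeld k A))
    (hf : Function.Injective S.f.lin) (hg : Function.Surjective S.g.lin)
    (h : LinearMap.ker S.g.lin ≤ LinearMap.range S.f.lin) : S.ShortExact :=
  have := mono_of_injective _ hf
  have := epi_of_surjective _ hg
  { exact := ShortComplex.exact_of_f_is_kernel _ (isLimitOfExact _ _ S.zero hf h) }

end Exact

section Average

variable {k H : Type u} [Field k] [Ring H] [HopfAlgebra k H] (l : H →ₗ[k] k)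

/-- The action `m ↦ m₍₀₎ l(m₍₁₎)` of a functional on a comodule; for an invariant functional it is
the averaging projection to the coinvariants. -/
def average (M : YetterDrinfeld k H) : M.carrier →ₗ[k] M.carrier :=
  (TensorProduct.rid k M.carrier).toLinearMap ∘ₗ l.lTensor M.carrier ∘ₗ M.coact

theorem average_map {M N : YetterDrinfeld k H} (f : M ⟶ N) (m : M.carrier) :
    f.lin (average l M m) = average l N (f.lin m) := by
  have h : f.lin ∘ₗ (TensorProduct.rid k M.carrier).toLinearMap ∘ₗ l.lTensor M.carrier =
      (TensorProduct.rid k N.carrier).toLinearMap ∘ₗ l.lTensor N.carrier ∘ₗ f.lin.rTensor H := by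
    ext; simp
  simp only [average, LinearMap.comp_apply, ← f.map_coact]
  exact LinearMap.congr_fun h (M.coact m)

theorem coact_average (M : YetterDrinfeld k H) (m : M.carrier) :
    M.coact (average l M m) = (leftHit l).lTensor M.carrier (M.coact m) := by
  have h : M.coact ∘ₗ (TensorProduct.rid k M.carrier).toLinearMap ∘ₗ l.lTensor M.carrier =
      ((TensorProduct.rid k H).toLinearMap ∘ₗ l.lTensor H).lTensor M.carrier ∘ₗ
        (TensorProduct.assoc k M.carrier H H).toLinearMap ∘ₗ M.coact.rTensor H := by
    have hassoc (b : H) :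
        ((TensorProduct.rid k H).toLinearMap ∘ₗ l.lTensor H).lTensor M.carrier ∘ₗ
          (TensorProduct.assoc k M.carrier H H).toLinearMap ∘ₗ
            (TensorProduct.mk k (M.carrier ⊗[k] H) H).flip b = l b • LinearMap.id := by
      ext; simp
    ext x b
    simpa using (LinearMap.congr_fun (hassoc b) (M.coact x)).symm
  refine (LinearMap.congr_fun h (M.coact m)).trans ?_
  simp only [LinearMap.comp_apply, LinearEquiv.coe_coe, M.coaction.coassoc m]
  rw [← LinearMap.lTensor_comp_apply]
  rfl

variable {L : Type u} [Ring L] [HopfAlgebra k L]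

theorem average_eq_self (f : L →ₐc[k] H) (hl : ∀ a, l (f a) = Coalgebra.counit a)
    {M : YetterDrinfeld k H} {m : M.carrier} (hm : m ∈ resSubmodule f M) : average l M m = m := by
  obtain ⟨t, ht⟩ := hm
  have h : l.lTensor M.carrier ∘ₗ (f : L →ₗ[k] H).lTensor M.carrier =
      Coalgebra.counit.lTensor M.carrier ∘ₗ (f : L →ₗ[k] H).lTensor M.carrier := by
    ext; simp [hl]
  have hm : l.lTensor M.carrier (M.coact m) = m ⊗ₜ 1 := by
    rw [← M.coaction.counit m, ← ht]
    exact LinearMap.congr_fun h t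
  simp [average, hm]

theorem average_mem_resSubmodule (f : L →ₐc[k] H)
    (hl : ∀ x, leftHit l x ∈ LinearMap.range (f : L →ₗ[k] H)) (M : YetterDrinfeld k H)
    (m : M.carrier) : average l M m ∈ resSubmodule f M := by
  refine Submodule.mem_comap.2 ?_
  rw [coact_average]
  rw [← LinearMap.subtype_comp_codRestrict (leftHit l) _ hl, LinearMap.lTensor_comp_apply,
    LinearMap.lTensor_range]
  exact ⟨_, rfl⟩

/-- The coinvariants `{m | m₍₀₎ ⊗ m₍₁₎ = m ⊗ 1}` of the underlying comodule. -/
def coinvariants (M : YetterDrinfeld k H) : Submodule k M.carrier :=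
  LinearMap.eqLocus M.coact ((TensorProduct.mk k M.carrier H).flip 1)

theorem mem_coinvariants {M : YetterDrinfeld k H} {m : M.carrier} :
    m ∈ coinvariants M ↔ M.coact m = m ⊗ₜ 1 := Iff.rfl

variable {l}

theorem average_of_mem_coinvariants (h1 : l 1 = 1) {M : YetterDrinfeld k H} {m : M.carrier}
    (hm : m ∈ coinvariants M) : average l M m = m := by
  simp [average, mem_coinvariants.1 hm, h1]

theorem average_mem_coinvariants (hl : LeftInvariant l) (M : YetterDrinfeld k H)
    (m : M.carrier) : average l M m ∈ coinvariants M := by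
  have h : (leftHit l).lTensor M.carrier = (TensorProduct.mk k M.carrier H).flip 1 ∘ₗ
      (TensorProduct.rid k M.carrier).toLinearMap ∘ₗ l.lTensor M.carrier := by
    ext m c
    simp [hl c, smul_tmul']
  rw [mem_coinvariants, coact_average, h]
  rfl

end Average

section Restriction

variable {k H L : Type u} [Field k] [Ring H] [HopfAlgebra k H] [Ring L] [HopfAlgebra k L]
  (f : L →ₐc[k] H) (hf : Function.Injective f)

instance : (restriction f hf).Additive where
  map_add := hom_ext fun _ => rfl

instance : (restriction f hf).Linear k where
  map_smul _ _ := hom_ext fun _ => rfl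

theorem restriction_map_shortExact {l : H →ₗ[k] k} (h1 : ∀ a, l (f a) = Coalgebra.counit a)
    (h2 : ∀ x, leftHit l x ∈ LinearMap.range (f : L →ₗ[k] H))
    (S : ShortComplex (YetterDrinfeld k H)) (hS : S.ShortExact) :
    (S.map (restriction f hf)).ShortExact := by
  have := hS.mono_f
  have := hS.epi_g
  have inj := injective_of_mono S.f
  refine shortExact_of_lin _ (fun x y hxy => Subtype.ext (inj (congrArg Subtype.val hxy))) ?_ ?_
  · rintro ⟨q, hq⟩
    obtain ⟨m, rfl⟩ := surjective_of_epi S.g q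
    exact ⟨⟨average l S.X₂ m, average_mem_resSubmodule l f h2 _ m⟩,
      Subtype.ext ((average_map l S.g m).trans (average_eq_self l f h1 hq))⟩
  · rintro ⟨x, hx⟩ hx0
    obtain ⟨y, rfl⟩ := ker_le_range_of_shortExact hS (congrArg Subtype.val hx0)
    have average_eq : average l S.X₁ y = y :=
      inj ((average_map l S.f y).trans (average_eq_self l f h1 hx))
    exact ⟨⟨y, average_eq ▸ average_mem_resSubmodule l f h2 _ y⟩, Subtype.ext rfl⟩

end Restriction

section Coproduct

variable {k A B H : Type u} [Field k] [Ring A] [Ring B] [Ring H] [HopfAlgebra k A]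
  [Bialgebra k B] [HopfAlgebra k H] {i : A →ₐc[k] H} {j : B →ₐc[k] H}

theorem restriction_isExact (hij : IsAlgCoprod (i : A →ₐ[k] H) (j : B →ₐ[k] H))
    (hi : Function.Injective i) (hA : IsCosemisimple k A) (hB : IsCosemisimple k B) :
    PreservesFiniteLimits (restriction i hi) ∧ PreservesFiniteColimits (restriction i hi) := by
  obtain ⟨ρ, hρi, hρ⟩ := hij.exists_retraction hA hB
  refine ((Functor.exact_tfae (restriction i hi)).out 0 3).1
    (restriction_map_shortExact i hi (l := Coalgebra.counit ∘ₗ ρ) (fun a => ?_) fun x => ?_)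
  · exact congrArg _ (hρi a)
  · exact ⟨ρ x, by rw [hρ, leftHit_counit]; rfl⟩

end Coproduct

end YetterDrinfeld

/-! ### Cofree Yetter–Drinfeld modules -/

section Antipode

variable {k H : Type u} [Field k] [Ring H] [HopfAlgebra k H]

theorem comul_antipode_apply (x : H) :
    Coalgebra.comul (HopfAlgebra.antipode k x) =
      TensorProduct.map (HopfAlgebra.antipode k) (HopfAlgebra.antipode k)
        (TensorProduct.comm k H H (Coalgebra.comul x)) := by
  let S : WithConv (H →ₗ[k] H) := .toConv (HopfAlgebra.antipode k)
  let I : WithConv (H →ₗ[k] H) := .toConv LinearMap.id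
  let push (φ : H →ₐ[k] H ⊗[k] H) (f : WithConv (H →ₗ[k] H)) : WithConv (H →ₗ[k] H ⊗[k] H) :=
    .toConv (φ.toLinearMap ∘ₗ f.ofConv)
  have push_mul (φ f g) : push φ f * push φ g = push φ (f * g) :=
    WithConv.ofConv_injective (LinearMap.algHom_comp_convMul_distrib φ f g).symm
  have push_one (φ) : push φ 1 = 1 := WithConv.ofConv_injective (by ext; simp [push])
  let Δ := Bialgebra.comulAlgHom k H
  let ι₁ : H →ₐ[k] H ⊗[k] H := Algebra.TensorProduct.includeLeft
  let ι₂ : H →ₐ[k] H ⊗[k] H := Algebra.TensorProduct.includeRight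
  -- `Δ` and `τ (S ⊗ S) Δ` are the convolution products `ι₁ * ι₂` and `ι₂ S * ι₁ S`.
  have comul_eq : push Δ I = push ι₁ I * push ι₂ I := by
    have h : LinearMap.mul' k (H ⊗[k] H) ∘ₗ TensorProduct.map ι₁.toLinearMap ι₂.toLinearMap =
        LinearMap.id := by ext; simp [ι₁, ι₂]
    exact WithConv.ofConv_injective (LinearMap.ext fun x =>
      (LinearMap.congr_fun h (Coalgebra.comul x)).symm)
  have flip_eq : push ι₂ S * push ι₁ S = .toConv (TensorProduct.map (HopfAlgebra.antipode k)
      (HopfAlgebra.antipode k) ∘ₗ (TensorProduct.comm k H H).toLinearMap ∘ₗ Coalgebra.comul) := by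
    have h : LinearMap.mul' k (H ⊗[k] H) ∘ₗ TensorProduct.map (ι₂.toLinearMap ∘ₗ S.ofConv)
        (ι₁.toLinearMap ∘ₗ S.ofConv) = TensorProduct.map S.ofConv S.ofConv ∘ₗ
          (TensorProduct.comm k H H).toLinearMap := by ext; simp [ι₁, ι₂]
    exact WithConv.ofConv_injective (LinearMap.ext fun x =>
      LinearMap.congr_fun h (Coalgebra.comul x))
  have left_inv : push Δ S * push Δ I = 1 := by
    rw [push_mul, LinearMap.antipode_mul_id, push_one]
  have right_inv : push Δ I * (push ι₂ S * push ι₁ S) = 1 := by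
    rw [comul_eq, mul_assoc, ← mul_assoc (push ι₂ I), push_mul, LinearMap.id_mul_antipode, push_one,
      one_mul, push_mul, LinearMap.id_mul_antipode, push_one]
  exact LinearMap.congr_fun (congrArg WithConv.ofConv
    ((left_inv_eq_right_inv left_inv right_inv).trans flip_eq)) x

end Antipode

/-- A bilinear map `N × H → N` is a right action of the algebra `H`. -/
structure IsRightAction {k H N : Type u} [Field k] [Ring H] [Algebra k H] [AddCommGroup N]
    [Module k N] (act : N →ₗ[k] H →ₗ[k] N) : Prop where
  act_one : ∀ v, act v 1 = v
  act_mul : ∀ v a b, act v (a * b) = act (act v a) b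

section Convolution

variable {k H : Type u} [Field k] [Ring H] [HopfAlgebra k H]

theorem comp_convMul_apply {V W : Type u} [AddCommGroup V] [Module k V] [AddCommGroup W]
    [Module k W] {T : V →ₗ[k] W} {φ φ' : WithConv (H →ₗ[k] Module.End k V)}
    {ψ ψ' : WithConv (H →ₗ[k] Module.End k W)} (h : ∀ a, T ∘ₗ φ a = ψ a ∘ₗ T)
    (h' : ∀ a, T ∘ₗ φ' a = ψ' a ∘ₗ T) (a : H) : T ∘ₗ (φ * φ') a = (ψ * ψ') a ∘ₗ T := by
  let r := Coalgebra.Repr.arbitrary k a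
  have hφ (x y v) : T (φ x (φ' y v)) = ψ x (ψ' y (T v)) :=
    (LinearMap.congr_fun (h x) _).trans (congrArg _ (LinearMap.congr_fun (h' y) v))
  ext v
  simp [r.convMul_apply, hφ]

/-- The operators `f a ⊗ id` on `V ⊗ H` induced by a family of operators `f a` on `V`. -/
def rTensorOperators {V : Type u} [AddCommGroup V] [Module k V]
    (f : WithConv (H →ₗ[k] Module.End k V)) : WithConv (H →ₗ[k] Module.End k (V ⊗[k] H)) :=
  .toConv (LinearMap.rTensorHom H ∘ₗ f.ofConv)

theorem rTensorOperators_mul {V : Type u} [AddCommGroup V] [Module k V]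
    (f g : WithConv (H →ₗ[k] Module.End k V)) :
    rTensorOperators (f * g) = rTensorOperators f * rTensorOperators g :=
  WithConv.ofConv_injective
    (LinearMap.algHom_comp_convMul_distrib (Module.End.rTensorAlgHom k V H) f g)

variable (k H) (N : Type u) [AddCommGroup N] [Module k N]

/-- The operators `n ⊗ h ↦ n ⊗ S(a) h` on `N ⊗ H`. -/
def leftAntipodeMul : WithConv (H →ₗ[k] Module.End k (N ⊗[k] H)) :=
  .toConv (LinearMap.lTensorHom N ∘ₗ LinearMap.mul k H ∘ₗ HopfAlgebra.antipode k)

/-- The operators `n ⊗ h ↦ n ⊗ h a` on `N ⊗ H`. -/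
def rightMul : WithConv (H →ₗ[k] Module.End k (N ⊗[k] H)) :=
  .toConv (LinearMap.lTensorHom N ∘ₗ (LinearMap.mul k H).flip)

variable {k H N}

/-- The operators `n ⊗ h ↦ n · a ⊗ h` on `N ⊗ H`. -/
def actLeft (act : N →ₗ[k] H →ₗ[k] N) : WithConv (H →ₗ[k] Module.End k (N ⊗[k] H)) :=
  .toConv (LinearMap.rTensorHom H ∘ₗ act.flip)

/-- The iterated comultiplication `a ↦ a₍₁₎ ⊗ (a₍₂₎ ⊗ a₍₃₎)`. -/
def comul₃ (k H : Type u) [Field k] [Ring H] [HopfAlgebra k H] : H →ₐ[k] H ⊗[k] (H ⊗[k] H) :=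
  (Algebra.TensorProduct.map (AlgHom.id k H) (Bialgebra.comulAlgHom k H)).comp
    (Bialgebra.comulAlgHom k H)

theorem comul₃_apply (a : H) : comul₃ k H a = Coalgebra.comul.lTensor H (Coalgebra.comul a) := rfl

theorem ydTwist_flip_comul₃ (act : N →ₗ[k] H →ₗ[k] N) (a : H) :
    (ydTwist act).flip (comul₃ k H a) =
      (leftAntipodeMul k H N * (actLeft act * rightMul k H N)) a := by
  have h : (ydTwist act).flip = LinearMap.mul' k (Module.End k (N ⊗[k] H)) ∘ₗ
      TensorProduct.map (leftAntipodeMul k H N).ofConv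
        (LinearMap.mul' k _ ∘ₗ TensorProduct.map (actLeft act).ofConv (rightMul k H N).ofConv) := by
    ext x y z n h
    simp [leftAntipodeMul, actLeft, rightMul, mul_assoc]
  rw [h, comul₃_apply, LinearMap.convMul_apply, LinearMap.comp_apply]
  congr 1
  exact LinearMap.congr_fun (LinearMap.map_comp_lTensor ..) _

theorem flip_ydTwist_one {act : N →ₗ[k] H →ₗ[k] N} (h : IsRightAction act) :
    (ydTwist act).flip 1 = LinearMap.id := by
  ext n p
  simp [Algebra.TensorProduct.one_def, h.act_one]

theorem flip_ydTwist_mul {act : N →ₗ[k] H →ₗ[k] N} (h : IsRightAction act)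
    (s s' : H ⊗[k] (H ⊗[k] H)) :
    (ydTwist act).flip (s * s') = (ydTwist act).flip s' * (ydTwist act).flip s := by
  have h : (LinearMap.mul k (H ⊗[k] (H ⊗[k] H))).compr₂ (ydTwist act).flip =
      (LinearMap.mul k (Module.End k (N ⊗[k] H))).flip.compl₁₂ (ydTwist act).flip
        (ydTwist act).flip := by
    ext x y z x' y' z' n p
    simp [h.act_mul, HopfAlgebra.antipode_mul_antidistrib, mul_assoc]
  exact LinearMap.congr_fun₂ h s s'

end Convolution

section CofreeCoaction

variable (k C N : Type u) [Field k] [AddCommGroup C] [Module k C] [Coalgebra k C]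
  [AddCommGroup N] [Module k N]

/-- The coaction of `C` on the cofree comodule `N ⊗ C`, `n ⊗ c ↦ (n ⊗ c₍₁₎) ⊗ c₍₂₎`. -/
def cofreeCoact : N ⊗[k] C →ₗ[k] (N ⊗[k] C) ⊗[k] C :=
  (TensorProduct.assoc k N C C).symm.toLinearMap ∘ₗ Coalgebra.comul.lTensor N

/-- The cofree comodule `N ⊗ C`. -/
def cofreeCoaction : Coaction k C (N ⊗[k] C) where
  coact := cofreeCoact k C N
  coassoc t := by
    have assoc_rTensor : (TensorProduct.assoc k (N ⊗[k] C) C C).toLinearMap ∘ₗ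
        (cofreeCoact k C N).rTensor C ∘ₗ (TensorProduct.assoc k N C C).symm.toLinearMap =
        (TensorProduct.assoc k N C (C ⊗[k] C)).symm.toLinearMap ∘ₗ
          ((TensorProduct.assoc k C C C).toLinearMap ∘ₗ Coalgebra.comul.rTensor C).lTensor N := by
      ext n x y
      simp [cofreeCoact, ← (Coalgebra.Repr.arbitrary k x).eq, tmul_sum, sum_tmul]
    have lTensor_assoc : Coalgebra.comul.lTensor (N ⊗[k] C) ∘ₗ
        (TensorProduct.assoc k N C C).symm.toLinearMap =
        (TensorProduct.assoc k N C (C ⊗[k] C)).symm.toLinearMap ∘ₗ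
          (Coalgebra.comul.lTensor C).lTensor N := by
      ext
      simp
    have comp_comul : ((TensorProduct.assoc k C C C).toLinearMap ∘ₗ
        Coalgebra.comul.rTensor C).lTensor N ∘ₗ Coalgebra.comul.lTensor N =
        (Coalgebra.comul.lTensor C).lTensor N ∘ₗ Coalgebra.comul.lTensor N := by
      rw [← LinearMap.lTensor_comp, ← LinearMap.lTensor_comp, LinearMap.comp_assoc,
        Coalgebra.coassoc]
    refine (LinearMap.congr_fun assoc_rTensor (Coalgebra.comul.lTensor N t)).trans
      (.trans ?_ (LinearMap.congr_fun lTensor_assoc (Coalgebra.comul.lTensor N t)).symm)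
    exact congrArg (TensorProduct.assoc k N C (C ⊗[k] C)).symm (LinearMap.congr_fun comp_comul t)
  counit t := by
    have lTensor_assoc : Coalgebra.counit.lTensor (N ⊗[k] C) ∘ₗ
        (TensorProduct.assoc k N C C).symm.toLinearMap =
        (TensorProduct.assoc k N C k).symm.toLinearMap ∘ₗ
          (Coalgebra.counit.lTensor C).lTensor N := by
      ext
      simp
    have h : Coalgebra.counit.lTensor (N ⊗[k] C) ∘ₗ cofreeCoact k C N =
        (TensorProduct.mk k (N ⊗[k] C) k).flip 1 := by
      rw [cofreeCoact, ← LinearMap.comp_assoc, lTensor_assoc, LinearMap.comp_assoc,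
        ← LinearMap.lTensor_comp, Coalgebra.lTensor_counit_comp_comul]
      ext
      simp
    exact LinearMap.congr_fun h t

/-- The projection `N ⊗ C → N`, `n ⊗ c ↦ ε(c) n`. -/
def cofreeCounit : N ⊗[k] C →ₗ[k] N :=
  (TensorProduct.rid k N).toLinearMap ∘ₗ Coalgebra.counit.lTensor N

theorem rTensor_cofreeCounit_coact (t : N ⊗[k] C) :
    (cofreeCounit k C N).rTensor C (cofreeCoact k C N t) = t := by
  have rTensor_assoc : (cofreeCounit k C N).rTensor C ∘ₗ
      (TensorProduct.assoc k N C C).symm.toLinearMap =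
      ((TensorProduct.lid k C).toLinearMap ∘ₗ Coalgebra.counit.rTensor C).lTensor N := by
    ext
    simp [cofreeCounit, smul_tmul]
  have h : (cofreeCounit k C N).rTensor C ∘ₗ cofreeCoact k C N = LinearMap.id := by
    rw [cofreeCoact, ← LinearMap.comp_assoc, rTensor_assoc, ← LinearMap.lTensor_comp,
      LinearMap.comp_assoc, Coalgebra.rTensor_counit_comp_comul]
    ext
    simp
  exact LinearMap.congr_fun h t

end CofreeCoaction

section Cofree

variable {k H N : Type u} [Field k] [Ring H] [HopfAlgebra k H] [AddCommGroup N] [Module k N]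
  (act : N →ₗ[k] H →ₗ[k] N)

/-- The action of `H` on `N ⊗ H`, `(n ⊗ h) · a = n · a₍₂₎ ⊗ S(a₍₁₎) h a₍₃₎`. -/
def cofreeAct : N ⊗[k] H →ₗ[k] H →ₗ[k] N ⊗[k] H :=
  (ydTwist act).compl₂ (comul₃ k H).toLinearMap

theorem cofreeAct_apply (t : N ⊗[k] H) (a : H) : cofreeAct act t a = ydTwist act t (comul₃ k H a) :=
  rfl

theorem cofreeCoact_comp_leftAntipodeMul (a : H) :
    cofreeCoact k H N ∘ₗ leftAntipodeMul k H N a =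
      (leftAntipodeMul k H (N ⊗[k] H) * rTensorOperators (leftAntipodeMul k H N)) a ∘ₗ
        cofreeCoact k H N := by
  let r := Coalgebra.Repr.arbitrary k a
  ext n p
  let q := Coalgebra.Repr.arbitrary k p
  simp [cofreeCoact, leftAntipodeMul, rTensorOperators, comul_antipode_apply, ← r.eq, ← q.eq,
    Finset.sum_mul_sum, tmul_sum, Bialgebra.comul_mul]

theorem cofreeCoact_comp_rightMul (a : H) :
    cofreeCoact k H N ∘ₗ rightMul k H N a =
      (rTensorOperators (rightMul k H N) * rightMul k H (N ⊗[k] H)) a ∘ₗ cofreeCoact k H N := by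
  let r := Coalgebra.Repr.arbitrary k a
  ext n p
  let q := Coalgebra.Repr.arbitrary k p
  simpa [cofreeCoact, rightMul, rTensorOperators, Bialgebra.comul_mul, ← r.eq, ← q.eq,
    Finset.sum_mul_sum, tmul_sum] using Finset.sum_comm

theorem cofreeCoact_comp_actLeft (a : H) :
    cofreeCoact k H N ∘ₗ actLeft act a =
      rTensorOperators (actLeft act) a ∘ₗ cofreeCoact k H N := by
  ext n p
  let q := Coalgebra.Repr.arbitrary k p
  simp [cofreeCoact, actLeft, rTensorOperators, ← q.eq, tmul_sum]

theorem cofreeCoact_cofreeAct (t : N ⊗[k] H) (a : H) : cofreeCoact k H N (cofreeAct act t a) =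
    ydTwist (cofreeAct act) (cofreeCoact k H N t) (comul₃ k H a) := by
  have h : (ydTwist (cofreeAct act)).flip (comul₃ k H a) ∘ₗ cofreeCoact k H N =
      cofreeCoact k H N ∘ₗ (ydTwist act).flip (comul₃ k H a) := by
    have hact : actLeft (cofreeAct act) =
        rTensorOperators (leftAntipodeMul k H N * (actLeft act * rightMul k H N)) :=
      WithConv.ofConv_injective (LinearMap.ext fun b =>
        congrArg (LinearMap.rTensor H) (ydTwist_flip_comul₃ act b))
    rw [ydTwist_flip_comul₃, ydTwist_flip_comul₃, hact, rTensorOperators_mul,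
      rTensorOperators_mul, mul_assoc, mul_assoc, ← mul_assoc (leftAntipodeMul k H (N ⊗[k] H))]
    exact (comp_convMul_apply cofreeCoact_comp_leftAntipodeMul
      (comp_convMul_apply (cofreeCoact_comp_actLeft act) cofreeCoact_comp_rightMul) a).symm
  exact (LinearMap.congr_fun h t).symm

end Cofree

section CofreeModule

variable {k H N : Type u} [Field k] [Ring H] [HopfAlgebra k H] [AddCommGroup N] [Module k N]
  {act : N →ₗ[k] H →ₗ[k] N}

/-- The cofree Yetter–Drinfeld module on a right `H`-module. -/
def cofree (h : IsRightAction act) : YetterDrinfeld k H where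
  carrier := N ⊗[k] H
  act := cofreeAct act
  act_one v := by
    rw [cofreeAct_apply, map_one]
    exact LinearMap.congr_fun (flip_ydTwist_one h) v
  act_mul v a b := by
    rw [cofreeAct_apply, map_mul]
    exact LinearMap.congr_fun (flip_ydTwist_mul h _ _) v
  coaction := cofreeCoaction k H N
  yd v a := cofreeCoact_cofreeAct act v a

theorem cofreeCounit_act (t : N ⊗[k] H) (a : H) :
    cofreeCounit k H N (cofreeAct act t a) = act (cofreeCounit k H N t) a := by
  let ε : H →ₗ[k] k := Coalgebra.counit
  let counit₂ : H ⊗[k] H →ₗ[k] H := (TensorProduct.rid k H).toLinearMap ∘ₗ ε.lTensor H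
  have counit₂_comul : counit₂ ∘ₗ Coalgebra.comul = LinearMap.id := by
    ext
    simp [counit₂, ε]
  have counit_comul₃ :
      TensorProduct.lid k H (TensorProduct.map ε counit₂ (comul₃ k H a)) = a := by
    rw [comul₃_apply, LinearMap.map_lTensor, counit₂_comul, ← LinearMap.rTensor_def,
      Coalgebra.rTensor_counit_comul, TensorProduct.lid_tmul, one_smul]
  have twist : (ydTwist act).flip.compr₂ (cofreeCounit k H N) =
      (act.flip.compl₂ (cofreeCounit k H N)) ∘ₗ (TensorProduct.lid k H).toLinearMap ∘ₗ
        TensorProduct.map ε counit₂ := by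
    ext x y z n p
    simp [cofreeCounit, counit₂, ε, smul_smul, mul_comm, mul_left_comm]
  exact (LinearMap.congr_fun₂ twist _ t).trans
    (congrArg (fun b => act (cofreeCounit k H N t) b) counit_comul₃)

end CofreeModule

/-! ### Injective modules over a coproduct of algebras -/

section InjectiveAction

variable {k H A B N W V : Type u} [Field k] [Ring H] [Algebra k H] [Ring A] [Algebra k A]
  [Ring B] [Algebra k B] [AddCommGroup N] [Module k N] [AddCommGroup W] [Module k W]
  [AddCommGroup V] [Module k V]

/-- The right module `N` is injective: every linear map to `N` can be made equivariant without
changing it at the vectors where it is equivariant already. -/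
def IsInjectiveAction (act : N →ₗ[k] H →ₗ[k] N) : Prop :=
  ∀ (W : Type u) [AddCommGroup W] [Module k W] (actW : W →ₗ[k] H →ₗ[k] W), IsRightAction actW →
    ∀ g : W →ₗ[k] N, ∃ G : W →ₗ[k] N, (∀ w a, G (actW w a) = act (G w) a) ∧
      ∀ v, (∀ a, g (actW v a) = act (g v) a) → G v = g v

variable (k H V) in
/-- The coinduced right action on `Hom(H, V)`, `(φ · a) x = φ (a x)`. -/
def coindAct : (H →ₗ[k] V) →ₗ[k] H →ₗ[k] (H →ₗ[k] V) :=
  LinearMap.mk₂ k (fun φ a => φ ∘ₗ LinearMap.mulLeft k a)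
    (fun _ _ _ => rfl) (fun _ _ _ => rfl)
    (fun φ a b => by ext; simp [add_mul]) (fun c φ a => by ext; simp)

@[simp] theorem coindAct_apply (φ : H →ₗ[k] V) (a x : H) : coindAct k H V φ a x = φ (a * x) := rfl

theorem isRightAction_coindAct : IsRightAction (coindAct k H V) where
  act_one φ := by ext; simp
  act_mul φ a b := by ext; simp [mul_assoc]

theorem isInjectiveAction_coindAct : IsInjectiveAction (coindAct k H V) := by
  intro W _ _ actW hW g
  refine ⟨LinearMap.mk₂ k (fun w x => g (actW w x) 1) (by simp) (by simp) (by simp) (by simp),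
    fun w a => ?_, fun v hv => ?_⟩
  · ext x
    simp [hW.act_mul]
  · ext x
    simp [hv]

theorem IsRightAction.compl₂ {act : N →ₗ[k] H →ₗ[k] N} (h : IsRightAction act) (i : A →ₐ[k] H) :
    IsRightAction (act.compl₂ i.toLinearMap) where
  act_one w := by simp [h.act_one]
  act_mul w a b := by simp [h.act_mul]

/-- The direct sum of two right actions. -/
def prodAct (actN : N →ₗ[k] A →ₗ[k] N) (actW : W →ₗ[k] A →ₗ[k] W) :
    N × W →ₗ[k] A →ₗ[k] N × W :=
  LinearMap.mk₂ k (fun y a => (actN y.1 a, actW y.2 a)) (by simp) (by simp) (by simp) (by simp)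

@[simp] theorem prodAct_apply (actN : N →ₗ[k] A →ₗ[k] N) (actW : W →ₗ[k] A →ₗ[k] W) (y : N × W)
    (a : A) : prodAct actN actW y a = (actN y.1 a, actW y.2 a) := rfl

/-- The extension of `N` by `W` on which the graph of `-g` is a complement of `N` where `B` acts
through `ε`. -/
def graphAct (actN : N →ₗ[k] B →ₗ[k] N) (ε : B →ₐ[k] k) (g : W →ₗ[k] N) :
    N × W →ₗ[k] B →ₗ[k] N × W :=
  LinearMap.mk₂ k (fun y b => (actN (y.1 + g y.2) b - ε b • g y.2, ε b • y.2))
    (fun y z b => by ext <;> simp; abel) (fun c y b => by ext <;> simp [smul_sub, smul_comm c])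
    (fun y b c => by ext <;> simp [add_smul]; abel)
    (fun c y b => by ext <;> simp [smul_sub, smul_smul])

@[simp] theorem graphAct_apply (actN : N →ₗ[k] B →ₗ[k] N) (ε : B →ₐ[k] k) (g : W →ₗ[k] N)
    (y : N × W) (b : B) :
    graphAct actN ε g y b = (actN (y.1 + g y.2) b - ε b • g y.2, ε b • y.2) := rfl

theorem IsRightAction.prodAct {actN : N →ₗ[k] A →ₗ[k] N} {actW : W →ₗ[k] A →ₗ[k] W}
    (hN : IsRightAction actN) (hW : IsRightAction actW) : IsRightAction (prodAct actN actW) where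
  act_one _ := Prod.ext (hN.act_one _) (hW.act_one _)
  act_mul _ _ _ := Prod.ext (hN.act_mul _ _ _) (hW.act_mul _ _ _)

theorem IsRightAction.graphAct {actN : N →ₗ[k] B →ₗ[k] N} (hN : IsRightAction actN) (ε : B →ₐ[k] k)
    (g : W →ₗ[k] N) : IsRightAction (graphAct actN ε g) where
  act_one y := by ext <;> simp [hN.act_one]
  act_mul y a b := by ext <;> simp [hN.act_mul, smul_smul, mul_comm]

/-- A right action as an algebra map to the opposite of the endomorphism algebra. -/
def IsRightAction.toAlgHom {act : W →ₗ[k] H →ₗ[k] W} (h : IsRightAction act) :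
    H →ₐ[k] (Module.End k W)ᵐᵒᵖ :=
  AlgHom.ofLinearMap ((MulOpposite.opLinearEquiv k).toLinearMap ∘ₗ act.flip)
    (MulOpposite.unop_injective (LinearMap.ext h.act_one))
    (fun a b => MulOpposite.unop_injective (LinearMap.ext fun w => h.act_mul w a b))

namespace IsAlgCoprod

variable {i : A →ₐ[k] H} {j : B →ₐ[k] H} (hij : IsAlgCoprod i j)
include hij

theorem exists_action {actA : W →ₗ[k] A →ₗ[k] W} {actB : W →ₗ[k] B →ₗ[k] W}
    (hA : IsRightAction actA) (hB : IsRightAction actB) :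
    ∃ act : W →ₗ[k] H →ₗ[k] W, IsRightAction act ∧ (∀ w a, act w (i a) = actA w a) ∧
      ∀ w b, act w (j b) = actB w b := by
  obtain ⟨φ, hφi, hφj⟩ := hij.exists_lift _ hA.toAlgHom hB.toAlgHom
  exact ⟨((MulOpposite.opLinearEquiv k).symm.toLinearMap ∘ₗ φ.toLinearMap).flip,
    ⟨fun w => by simp, fun w a b => by simp⟩,
    fun w a => LinearMap.congr_fun (congrArg MulOpposite.unop (hφi a)) w,
    fun w b => LinearMap.congr_fun (congrArg MulOpposite.unop (hφj b)) w⟩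

theorem map_act {actN : N →ₗ[k] H →ₗ[k] N} {actW : W →ₗ[k] H →ₗ[k] W} (hN : IsRightAction actN)
    (hW : IsRightAction actW) {e : N →ₗ[k] W} (hi : ∀ n a, e (actN n (i a)) = actW (e n) (i a))
    (hj : ∀ n b, e (actN n (j b)) = actW (e n) (j b)) (n : N) (x : H) :
    e (actN n x) = actW (e n) x :=
  hij.induction (fun x => ∀ n, e (actN n x) = actW (e n) x) (fun a n => hi n a) (fun b n => hj n b)
    (fun x y hx hy n => by simp [hx, hy])
    (fun x y hx hy n => by rw [hN.act_mul, hW.act_mul, hy, hx]) x n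

theorem act_mem {act : W →ₗ[k] H →ₗ[k] W} (hW : IsRightAction act) {S : Submodule k W}
    (hi : ∀ w ∈ S, ∀ a, act w (i a) ∈ S) (hj : ∀ w ∈ S, ∀ b, act w (j b) ∈ S) {w : W}
    (hw : w ∈ S) (x : H) : act w x ∈ S :=
  hij.induction (fun x => ∀ w ∈ S, act w x ∈ S) (fun a w hw => hi w hw a) (fun b w hw => hj w hw b)
    (fun x y hx hy w hw => map_add (act w) x y ▸ S.add_mem (hx w hw) (hy w hw))
    (fun x y hx hy w hw => hW.act_mul w x y ▸ hy _ (hx w hw)) x w hw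

-- Extend the actions of `A` on `N ⊕ W` and of `B` on the graph extension to an action of the
-- coproduct; the wanted map is then a retraction onto the injective submodule `N`.
theorem exists_equivariant_sub_invariant {actN : N →ₗ[k] H →ₗ[k] N} (hN : IsRightAction actN)
    (hinj : IsInjectiveAction actN) (ε : B →ₐ[k] k) {actW : W →ₗ[k] A →ₗ[k] W}
    (hW : IsRightAction actW) (g : W →ₗ[k] N) :
    ∃ G : W →ₗ[k] N, (∀ w a, G (actW w a) = actN (G w) (i a)) ∧
      (∀ w b, actN (g w - G w) (j b) = ε b • (g w - G w)) ∧
      ∀ v, (∀ a, g (actW v a) = actN (g v) (i a)) → G v = g v := by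
  obtain ⟨act, hact, hi, hj⟩ := hij.exists_action ((hN.compl₂ i).prodAct hW)
    ((hN.compl₂ j).graphAct ε g)
  obtain ⟨F, hF, hFg⟩ := hinj _ act hact (LinearMap.coprod LinearMap.id g)
  have act_inl (n : N) (x : H) : LinearMap.inl k N W (actN n x) = act (LinearMap.inl k N W n) x :=
    hij.map_act hN hact (fun n a => by simp [hi]) (fun n b => by simp [hj]) n x
  have F_inl (n : N) : F (n, 0) = n := by
    refine (hFg _ fun x => ?_).trans (by simp)
    rw [show act (n, 0) x = (actN n x, 0) from (act_inl n x).symm]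
    simp
  have F_graph (w : W) : F (g w, -w) = g w - F (0, w) := by
    rw [show (g w, -w) = (g w, (0 : W)) - (0, w) by simp, map_sub, F_inl]
  refine ⟨F ∘ₗ LinearMap.inr k _ _, fun w a => ?_, fun w b => ?_, fun v hv => ?_⟩
  · simpa [hi] using hF (0, w) (i a)
  · simp only [LinearMap.comp_apply, LinearMap.inr_apply]
    rw [← F_graph, ← hF, hj, ← map_smul]
    congr 1
    simp
  · let E : Submodule k W := ⨅ a, LinearMap.eqLocus (g ∘ₗ actW.flip a) (actN.flip (i a) ∘ₗ g)
    have mem_E (w : W) : w ∈ E ↔ ∀ a, g (actW w a) = actN (g w) (i a) := by simp [E]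
    have act_mem : ∀ x, act (g v, -v) x ∈ E.map (g.prod (-LinearMap.id)) := by
      refine hij.act_mem hact ?_ ?_ ⟨v, (mem_E v).2 hv, rfl⟩
      · rintro _ ⟨w, hw, rfl⟩ a
        rw [SetLike.mem_coe, mem_E] at hw
        refine ⟨actW w a, (mem_E _).2 fun b => ?_, by simp [hi, hw]⟩
        rw [← hW.act_mul, hw, hw, map_mul, hN.act_mul]
      · rintro _ ⟨w, hw, rfl⟩ b
        exact ⟨ε b • w, E.smul_mem _ hw, by simp [hj]⟩
    have : F (g v, -v) = 0 := by
      refine (hFg _ fun x => ?_).trans (by simp)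
      obtain ⟨w, -, hw⟩ := act_mem x
      simp [← hw]
    rw [F_graph, sub_eq_zero] at this
    exact this.symm

theorem isInjectiveAction_compl₂ (ε : B →ₐ[k] k) {actN : N →ₗ[k] H →ₗ[k] N}
    (hN : IsRightAction actN) (hinj : IsInjectiveAction actN) :
    IsInjectiveAction (actN.compl₂ i.toLinearMap) := by
  intro W _ _ actW hW g
  obtain ⟨G, hG, -, hGg⟩ := hij.exists_equivariant_sub_invariant hN hinj ε hW g
  exact ⟨G, hG, hGg⟩

theorem exists_invariant_add_invariant {actN : N →ₗ[k] H →ₗ[k] N} (hN : IsRightAction actN)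
    (hinj : IsInjectiveAction actN) (εA : A →ₐ[k] k) (εB : B →ₐ[k] k) (n : N) :
    ∃ p q : N, n = p + q ∧ (∀ a, actN p (i a) = εA a • p) ∧ ∀ b, actN q (j b) = εB b • q := by
  have hk : IsRightAction ((LinearMap.mul k k).compl₂ εA.toLinearMap) :=
    ⟨by simp, by simp [mul_assoc]⟩
  obtain ⟨G, hGA, hGB, -⟩ :=
    hij.exists_equivariant_sub_invariant hN hinj εB hk (LinearMap.toSpanSingleton k _ n)
  refine ⟨G 1, n - G 1, by simp, fun a => ?_, fun b => by simpa using hGB 1 b⟩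
  rw [← hGA, ← map_smul]
  simp

end IsAlgCoprod

end InjectiveAction

/-! ### The universal property of cofree Yetter–Drinfeld modules -/

namespace YetterDrinfeld

section SemiHom

variable {k H L : Type u} [Field k] [Ring H] [HopfAlgebra k H] [Ring L] [HopfAlgebra k L]

/-- A linear map from a Yetter–Drinfeld module over `L` to one over `H` compatible with the
structures along `f : L → H`. -/
structure IsSemiHom (f : L →ₐc[k] H) (X : YetterDrinfeld k L) (M : YetterDrinfeld k H)
    (φ : X.carrier →ₗ[k] M.carrier) : Prop where
  map_act : ∀ x a, φ (X.act x a) = M.act (φ x) (f a)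
  map_coact : ∀ x, TensorProduct.map φ (f : L →ₗ[k] H) (X.coact x) = M.coact (φ x)

variable {f : L →ₐc[k] H} (hf : Function.Injective f) {X : YetterDrinfeld k L}
  {M : YetterDrinfeld k H}

theorem IsSemiHom.mem_resSubmodule {φ : X.carrier →ₗ[k] M.carrier} (h : IsSemiHom f X M φ)
    (x : X.carrier) : φ x ∈ resSubmodule f M :=
  ⟨φ.rTensor L (X.coact x),
    (LinearMap.congr_fun (LinearMap.lTensor_comp_rTensor ..) _).trans (h.map_coact x)⟩

/-- A semilinear morphism as a morphism to the restriction. -/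
def IsSemiHom.toRes {φ : X.carrier →ₗ[k] M.carrier} (h : IsSemiHom f X M φ) :
    X ⟶ resObj f hf M where
  lin := LinearMap.codRestrict (resSubmodule f M) φ h.mem_resSubmodule
  map_act v a := Subtype.ext (h.map_act v a)
  map_coact v := by
    apply map_injective _ (resSubmodule f M).subtype_injective _ hf
    refine Eq.trans ?_ (map_resObj_coact f hf M _).symm
    exact (LinearMap.map_rTensor ..).trans (h.map_coact v)

theorem isSemiHom_of_hom (φ : X ⟶ resObj f hf M) :
    IsSemiHom f X M ((resSubmodule f M).subtype ∘ₗ φ.lin) where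
  map_act x a := congrArg Subtype.val (φ.map_act x a)
  map_coact x := by
    refine Eq.trans ?_ (map_resObj_coact f hf M (φ.lin x))
    rw [← φ.map_coact]
    exact (LinearMap.map_rTensor ..).symm

theorem isSemiHom_id {X M : YetterDrinfeld k H} (φ : X ⟶ M) :
    IsSemiHom (BialgHom.id k H) X M φ.lin where
  map_act := φ.map_act
  map_coact := φ.map_coact

/-- A compatible map along the identity is a morphism. -/
def IsSemiHom.toHom {X M : YetterDrinfeld k H} {φ : X.carrier →ₗ[k] M.carrier}
    (h : IsSemiHom (BialgHom.id k H) X M φ) : X ⟶ M where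
  lin := φ
  map_act := h.map_act
  map_coact := h.map_coact

variable {N : Type u} [AddCommGroup N] [Module k N] {act : N →ₗ[k] H →ₗ[k] N}

theorem map_map_coact_coact (γ : X.carrier →ₗ[k] N) (x : X.carrier) :
    TensorProduct.map (TensorProduct.map γ (f : L →ₗ[k] H) ∘ₗ X.coact) (f : L →ₗ[k] H)
        (X.coact x) =
      cofreeCoact k H N (TensorProduct.map γ (f : L →ₗ[k] H) (X.coact x)) := by
  have coassoc : TensorProduct.assoc k X.carrier L L (X.coact.rTensor L (X.coact x)) =
    Coalgebra.comul.lTensor X.carrier (X.coact x) := X.coaction.coassoc x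
  rw [← LinearMap.map_rTensor, ← LinearEquiv.symm_apply_apply (TensorProduct.assoc k _ L L)
    (X.coact.rTensor L _), coassoc, TensorProduct.map_map_assoc_symm, LinearMap.map_lTensor,
    CoalgHomClass.map_comp_comul, ← LinearMap.lTensor_map]
  rfl

theorem isSemiHom_cofree (h : IsRightAction act) (γ : X.carrier →ₗ[k] N)
    (hγ : ∀ x a, γ (X.act x a) = act (γ x) (f a)) :
    IsSemiHom f X (cofree h) (TensorProduct.map γ (f : L →ₗ[k] H) ∘ₗ X.coact) where
  map_act x a := by
    have twist := ydTwist_map f γ X.act act hγ (X.coact x)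
      (Coalgebra.comul.lTensor L (Coalgebra.comul a))
    rw [comul_map] at twist
    exact (congrArg _ (X.yd x a)).trans twist
  map_coact := map_map_coact_coact γ

theorem cofreeCounit_map_coact (γ : X.carrier →ₗ[k] N) (x : X.carrier) :
    cofreeCounit k H N (TensorProduct.map γ (f : L →ₗ[k] H) (X.coact x)) = γ x := by
  have counit : Coalgebra.counit.lTensor X.carrier (X.coact x) = x ⊗ₜ 1 := X.coaction.counit x
  have h : cofreeCounit k H N ∘ₗ TensorProduct.map γ (f : L →ₗ[k] H) =
      γ ∘ₗ (TensorProduct.rid k X.carrier).toLinearMap ∘ₗ Coalgebra.counit.lTensor X.carrier := by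
    ext
    simp [cofreeCounit]
  refine (LinearMap.congr_fun h _).trans ?_
  simp [counit]

theorem IsSemiHom.eq_map_coact {h : IsRightAction act} {φ : X.carrier →ₗ[k] (cofree h).carrier}
    (hφ : IsSemiHom f X (cofree h) φ) (x : X.carrier) :
    φ x = TensorProduct.map ((cofreeCounit k H N) ∘ₗ φ) (f : L →ₗ[k] H) (X.coact x) := by
  refine (rTensor_cofreeCounit_coact k H N (φ x)).symm.trans ?_
  exact (congrArg _ (hφ.map_coact x)).symm.trans (LinearMap.rTensor_map ..)

end SemiHom

section Injective

variable {k L N : Type u} [Field k] [Ring L] [HopfAlgebra k L] [AddCommGroup N] [Module k N]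

/-- The universal property of the cofree Yetter–Drinfeld module on a right module. -/
structure IsCofree (I : YetterDrinfeld k L) (act : N →ₗ[k] L →ₗ[k] N)
    (e : I.carrier →ₗ[k] N) : Prop where
  map_act : ∀ v a, e (I.act v a) = act (e v) a
  exists_hom : ∀ (X : YetterDrinfeld k L) (γ : X.carrier →ₗ[k] N),
    (∀ x a, γ (X.act x a) = act (γ x) a) → ∃ φ : X ⟶ I, ∀ x, e (φ.lin x) = γ x
  hom_ext : ∀ (X : YetterDrinfeld k L) (φ ψ : X ⟶ I),
    (∀ x, e (φ.lin x) = e (ψ.lin x)) → φ = ψ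

theorem isRightAction (X : YetterDrinfeld k L) : IsRightAction X.act := ⟨X.act_one, X.act_mul⟩

theorem IsCofree.injective {I : YetterDrinfeld k L} {act : N →ₗ[k] L →ₗ[k] N}
    {e : I.carrier →ₗ[k] N} (h : IsCofree I act e) (hN : IsInjectiveAction act) : Injective I where
  factors {X Y} g f _ := by
    obtain ⟨r, hr⟩ := f.lin.exists_leftInverse_of_injective
      (LinearMap.ker_eq_bot.2 (injective_of_mono f))
    have r_f (x : X.carrier) : r (f.lin x) = x := LinearMap.congr_fun hr x
    obtain ⟨G, hG, hG'⟩ := hN Y.carrier Y.act (isRightAction Y) (e ∘ₗ g.lin ∘ₗ r)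
    obtain ⟨φ, hφ⟩ := h.exists_hom Y G hG
    refine ⟨φ, h.hom_ext _ _ _ fun x => (hφ _).trans ((hG' _ fun a => ?_).trans ?_)⟩
    · rw [← f.map_act]
      simp only [LinearMap.comp_apply, r_f, g.map_act, h.map_act]
    · simp only [LinearMap.comp_apply, r_f]

end Injective

section CofreeInstances

variable {k H L N : Type u} [Field k] [Ring H] [HopfAlgebra k H] [Ring L] [HopfAlgebra k L]
  [AddCommGroup N] [Module k N] {act : N →ₗ[k] H →ₗ[k] N}

theorem isCofree_cofree (h : IsRightAction act) :
    IsCofree (cofree h) act (cofreeCounit k H N) where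
  map_act := cofreeCounit_act
  exists_hom X γ hγ := ⟨(isSemiHom_cofree (f := BialgHom.id k H) h γ hγ).toHom,
    cofreeCounit_map_coact (f := BialgHom.id k H) γ⟩
  hom_ext X φ ψ hφψ := hom_ext fun x => by
    rw [(isSemiHom_id φ).eq_map_coact, (isSemiHom_id ψ).eq_map_coact,
      show cofreeCounit k H N ∘ₗ φ.lin = cofreeCounit k H N ∘ₗ ψ.lin from LinearMap.ext hφψ]

theorem isCofree_resObj_cofree (f : L →ₐc[k] H) (hf : Function.Injective f)
    (h : IsRightAction act) :
    IsCofree (resObj f hf (cofree h)) (act.compl₂ (f : L →ₗ[k] H))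
      (cofreeCounit k H N ∘ₗ (resSubmodule f (cofree h)).subtype) where
  map_act v a := cofreeCounit_act _ _
  exists_hom X γ hγ := ⟨(isSemiHom_cofree (f := f) h γ hγ).toRes hf,
    cofreeCounit_map_coact (f := f) γ⟩
  hom_ext X φ ψ hφψ := hom_ext fun x => Subtype.ext (by
    refine ((isSemiHom_of_hom hf φ).eq_map_coact x).trans
      (Eq.trans ?_ ((isSemiHom_of_hom hf ψ).eq_map_coact x).symm)
    exact congrArg (fun γ : X.carrier →ₗ[k] N =>
      TensorProduct.map γ (f : L →ₗ[k] H) (X.coact x)) (LinearMap.ext hφψ))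

end CofreeInstances

end YetterDrinfeld

/-! ### Morphisms from the trivial module -/

namespace YetterDrinfeld

section Invariants

variable {k H L : Type u} [Field k] [Ring H] [HopfAlgebra k H] [Ring L] [HopfAlgebra k L]
  (f : L →ₐc[k] H)

/-- The elements spanning a trivial Yetter–Drinfeld module over `L`: coinvariant, and `L` acts on
them through the counit. -/
def invariants (M : YetterDrinfeld k H) : Submodule k M.carrier where
  carrier := {x | x ∈ coinvariants M ∧ ∀ a, M.act x (f a) = Coalgebra.counit (R := k) a • x}
  add_mem' hx hy := ⟨add_mem hx.1 hy.1, fun a => by simp [hx.2, hy.2]⟩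
  zero_mem' := ⟨zero_mem _, fun a => by simp⟩
  smul_mem' c x hx := ⟨Submodule.smul_mem _ c hx.1, fun a => by simp [hx.2, smul_comm c]⟩

variable {f} (hf : Function.Injective f) {M M' : YetterDrinfeld k H}

theorem map_mem_coinvariants (φ : M ⟶ M') {x : M.carrier} (hx : x ∈ coinvariants M) :
    φ.lin x ∈ coinvariants M' := by
  rw [mem_coinvariants] at hx ⊢
  rw [← φ.map_coact, hx, LinearMap.rTensor_tmul]

theorem mem_coinvariants_of_map_mem (φ : M ⟶ M') [Mono φ] {x : M.carrier}
    (hx : φ.lin x ∈ coinvariants M') : x ∈ coinvariants M := by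
  rw [mem_coinvariants, ← φ.map_coact] at hx
  exact Module.Flat.rTensor_preserves_injective_linearMap φ.lin (injective_of_mono φ)
    (hx.trans (LinearMap.rTensor_tmul ..).symm)

theorem map_mem_invariants (φ : M ⟶ M') {x : M.carrier} (hx : x ∈ invariants f M) :
    φ.lin x ∈ invariants f M' :=
  ⟨map_mem_coinvariants φ hx.1, fun a => by rw [← φ.map_act, hx.2, map_smul]⟩

theorem isSemiHom_of_mem_invariants {x : M.carrier} (hx : x ∈ invariants f M) :
    IsSemiHom f (trivialModule k L) M (LinearMap.toSpanSingleton k M.carrier x) where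
  map_act c a := by
    change k at c
    change (c * Coalgebra.counit (R := k) a) • x = M.act (c • x) (f a)
    rw [map_smul, LinearMap.smul_apply, hx.2, mul_smul]
  map_coact c := by
    change k at c
    change (c • x) ⊗ₜ[k] f 1 = M.coact (c • x)
    rw [map_smul, mem_coinvariants.1 hx.1, map_one, TensorProduct.smul_tmul']

theorem IsSemiHom.mem_invariants {φ : k →ₗ[k] M.carrier}
    (hφ : IsSemiHom f (trivialModule k L) M φ) : φ 1 ∈ invariants f M := by
  refine ⟨?_, fun a => ?_⟩
  · refine (hφ.map_coact (1 : k)).symm.trans ((TensorProduct.map_tmul _ _ (1 : k) (1 : L)).trans ?_)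
    exact congrArg _ (map_one f)
  · refine (hφ.map_act (1 : k) a).symm.trans (Eq.trans ?_ (map_smul φ (Coalgebra.counit a) 1))
    exact congrArg φ (mul_comm (1 : k) _)

/-- The morphism from the trivial module defined by an invariant element. -/
def homOfInvariant {x : M.carrier} (hx : x ∈ invariants f M) :
    trivialModule k L ⟶ (restriction f hf).obj M :=
  (isSemiHom_of_mem_invariants hx).toRes hf

/-- The value at `1` of a morphism from the trivial module. -/
def evalOne (φ : trivialModule k L ⟶ (restriction f hf).obj M) : M.carrier :=
  (resSubmodule f M).subtype (φ.lin (1 : k))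

theorem evalOne_mem (φ : trivialModule k L ⟶ (restriction f hf).obj M) :
    evalOne hf φ ∈ invariants f M := IsSemiHom.mem_invariants (isSemiHom_of_hom hf φ)

theorem evalOne_homOfInvariant {x : M.carrier} (hx : x ∈ invariants f M) :
    evalOne hf (homOfInvariant hf hx) = x := one_smul k x

theorem evalOne_add (φ ψ : trivialModule k L ⟶ (restriction f hf).obj M) :
    evalOne hf (φ + ψ) = evalOne hf φ + evalOne hf ψ := rfl

theorem evalOne_comp (φ : trivialModule k L ⟶ (restriction f hf).obj M) (g : M ⟶ M') :
    evalOne hf (φ ≫ (restriction f hf).map g) = g.lin (evalOne hf φ) := rfl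

theorem hom_ext_one {φ ψ : trivialModule k H ⟶ M} (h : φ.lin (1 : k) = ψ.lin (1 : k)) :
    φ = ψ := by
  have lin_eq_smul (χ : trivialModule k H ⟶ M) (c : k) : χ.lin c = c • χ.lin (1 : k) :=
    (congrArg χ.lin (mul_one c).symm).trans (map_smul χ.lin c (1 : k))
  refine hom_ext fun (c : k) => ?_
  rw [lin_eq_smul φ, lin_eq_smul ψ, h]

theorem hom_ext_evalOne {φ ψ : trivialModule k L ⟶ (restriction f hf).obj M}
    (h : evalOne hf φ = evalOne hf ψ) : φ = ψ :=
  hom_ext_one (Subtype.ext h)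

theorem one_mem_invariants :
    ((1 : k) : (trivialModule k H).carrier) ∈ invariants f (trivialModule k H) := by
  refine ⟨rfl, fun a => ?_⟩
  change (1 : k) * Coalgebra.counit (R := k) (f a) = Coalgebra.counit (R := k) a * 1
  rw [one_mul, mul_one, CoalgHomClass.counit_comp_apply]

/-- The identification of the trivial module with the restriction of the trivial module. -/
def trivialToRes : trivialModule k L ⟶ (restriction f hf).obj (trivialModule k H) :=
  homOfInvariant hf (one_mem_invariants (k := k) (H := H))

theorem evalOne_trivialToRes_comp (g : trivialModule k H ⟶ M) :
    evalOne hf (trivialToRes hf ≫ (restriction f hf).map g) = g.lin (1 : k) :=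
  congrArg (fun c : k => g.lin c) (one_smul k (1 : k))

end Invariants

section Cofree

variable {k A H N : Type u} [Field k] [Ring A] [HopfAlgebra k A] [Ring H] [HopfAlgebra k H]
  {i : A →ₐc[k] H} [AddCommGroup N] [Module k N] {act : N →ₗ[k] H →ₗ[k] N}

theorem eq_cofreeCounit_tmul_of_mem_coinvariants (h : IsRightAction act) {t : N ⊗[k] H}
    (ht : t ∈ coinvariants (cofree h)) : t = cofreeCounit k H N t ⊗ₜ 1 := by
  have coact_eq : cofreeCoact k H N t = t ⊗ₜ 1 := ht
  rw [← LinearMap.rTensor_tmul, ← coact_eq, rTensor_cofreeCounit_coact]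

theorem tmul_one_mem_invariants (hi : Function.Injective i) (h : IsRightAction act) {p : N}
    (hp : ∀ a, act p (i a) = Coalgebra.counit (R := k) a • p) :
    p ⊗ₜ[k] (1 : H) ∈ invariants i (cofree h) := by
  obtain ⟨φ, hφ⟩ := (isCofree_resObj_cofree i hi h).exists_hom (trivialModule k A)
    (LinearMap.toSpanSingleton k N p) (fun c a => by
      change k at c
      change (c * Coalgebra.counit (R := k) a) • p = act (c • p) (i a)
      rw [map_smul, LinearMap.smul_apply, hp, mul_smul])
  have counit_eq : cofreeCounit k H N (evalOne hi φ) = p := (hφ (1 : k)).trans (one_smul k p)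
  have eq_tmul := eq_cofreeCounit_tmul_of_mem_coinvariants h (evalOne_mem hi φ).1
  rw [counit_eq] at eq_tmul
  exact eq_tmul ▸ evalOne_mem hi φ

end Cofree

section Coproduct

variable {k A B H : Type u} [Field k] [Ring A] [HopfAlgebra k A] [Ring B] [HopfAlgebra k B]
  [Ring H] [HopfAlgebra k H] {i : A →ₐc[k] H} {j : B →ₐc[k] H}

theorem exists_hom_of_mem_invariants (hij : IsAlgCoprod (i : A →ₐ[k] H) (j : B →ₐ[k] H))
    {M : YetterDrinfeld k H} {x : M.carrier} (hi : x ∈ invariants i M) (hj : x ∈ invariants j M) :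
    ∃ t : trivialModule k H ⟶ M, t.lin (1 : k) = x := by
  have h : x ∈ invariants (BialgHom.id k H) M := by
    refine ⟨hi.1, hij.induction _ (fun a => ?_) (fun b => ?_) (fun a b ha hb => ?_)
      (fun a b ha hb => ?_)⟩
    · exact (hi.2 a).trans (by rw [← CoalgHomClass.counit_comp_apply i a]; rfl)
    · exact (hj.2 b).trans (by rw [← CoalgHomClass.counit_comp_apply j b]; rfl)
    · rw [map_add, map_add, ha, hb, map_add, add_smul]
    · rw [BialgHom.id_apply] at ha hb ⊢
      rw [M.act_mul, ha, map_smul, LinearMap.smul_apply, hb, Bialgebra.counit_mul, mul_smul]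
  exact ⟨(isSemiHom_of_mem_invariants h).toHom, one_smul k x⟩

theorem coinvariants_cofree_le (hij : IsAlgCoprod (i : A →ₐ[k] H) (j : B →ₐ[k] H))
    (hi : Function.Injective i) (hj : Function.Injective j) {N : Type u} [AddCommGroup N]
    [Module k N] {act : N →ₗ[k] H →ₗ[k] N} (h : IsRightAction act) (hN : IsInjectiveAction act) :
    coinvariants (cofree h) ≤ invariants i (cofree h) ⊔ invariants j (cofree h) := by
  intro t ht
  obtain ⟨p, q, hn, hp, hq⟩ := hij.exists_invariant_add_invariant h hN
    (Bialgebra.counitAlgHom k A) (Bialgebra.counitAlgHom k B) (cofreeCounit k H N t)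
  rw [eq_cofreeCounit_tmul_of_mem_coinvariants h ht, hn, add_tmul]
  exact Submodule.add_mem_sup (tmul_one_mem_invariants hi h hp) (tmul_one_mem_invariants hj h hq)

theorem exists_shortExact_injective (hij : IsAlgCoprod (i : A →ₐ[k] H) (j : B →ₐ[k] H))
    (hi : Function.Injective i) (hj : Function.Injective j) (M : YetterDrinfeld k H) :
    ∃ (I Q : YetterDrinfeld k H) (f : M ⟶ I) (g : I ⟶ Q) (w : f ≫ g = 0),
      (ShortComplex.mk f g w).ShortExact ∧ Injective I ∧ Injective ((restriction i hi).obj I) ∧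
        Injective ((restriction j hj).obj I) ∧
          coinvariants I ≤ invariants i I ⊔ invariants j I := by
  have hN : IsRightAction (coindAct k H M.carrier) := isRightAction_coindAct
  have hinj : IsInjectiveAction (coindAct k H M.carrier) := isInjectiveAction_coindAct
  obtain ⟨f, hf⟩ := (isCofree_cofree hN).exists_hom M M.act fun x a =>
    LinearMap.ext fun b => (M.act_mul x a b).symm
  have : Mono f := mono_of_injective _ fun x y hxy => by
    rw [← M.act_one x, ← M.act_one y, ← hf, ← hf, hxy]
  exact ⟨cofree hN, _, f, cokernel.π f, cokernel.condition f,
    { exact := ShortComplex.exact_cokernel f }, (isCofree_cofree hN).injective hinj,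
    (isCofree_resObj_cofree i hi hN).injective
      (hij.isInjectiveAction_compl₂ (Bialgebra.counitAlgHom k B) hN hinj),
    (isCofree_resObj_cofree j hj hN).injective
      (hij.symm.isInjectiveAction_compl₂ (Bialgebra.counitAlgHom k A) hN hinj),
    coinvariants_cofree_le hij hi hj hN hinj⟩

theorem exists_coinvariant_lift {l : H →ₗ[k] k} (h1 : l 1 = 1) (hl : LeftInvariant l)
    {M N : YetterDrinfeld k H} (p : M ⟶ N) [Epi p] {c : N.carrier} (hc : c ∈ coinvariants N) :
    ∃ d ∈ coinvariants M, p.lin d = c := by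
  obtain ⟨m, rfl⟩ := surjective_of_epi p c
  exact ⟨average l M m, average_mem_coinvariants hl M m, by
    rw [average_map, average_of_mem_coinvariants h1 hc]⟩

theorem coinvariants_le_of_epi {l : H →ₗ[k] k} (h1 : l 1 = 1) (hl : LeftInvariant l)
    {M N : YetterDrinfeld k H} (p : M ⟶ N) [Epi p]
    (hM : coinvariants M ≤ invariants i M ⊔ invariants j M) :
    coinvariants N ≤ invariants i N ⊔ invariants j N := by
  intro c hc
  obtain ⟨d, hd, rfl⟩ := exists_coinvariant_lift h1 hl p hc
  obtain ⟨x, hx, y, hy, rfl⟩ := Submodule.mem_sup.1 (hM hd)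
  rw [map_add]
  exact Submodule.add_mem_sup (map_mem_invariants p hx) (map_mem_invariants p hy)

variable (hi : Function.Injective i) (hj : Function.Injective j)

theorem exists_lift_trivialModule (hij : IsAlgCoprod (i : A →ₐ[k] H) (j : B →ₐ[k] H))
    {S : ShortComplex (YetterDrinfeld k H)} (hS : S.ShortExact)
    (h₁ : coinvariants S.X₁ ≤ invariants i S.X₁ ⊔ invariants j S.X₁)
    (t : trivialModule k H ⟶ S.X₃)
    (f : trivialModule k A ⟶ (restriction i hi).obj S.X₂)
    (g : trivialModule k B ⟶ (restriction j hj).obj S.X₂)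
    (hf : f ≫ (restriction i hi).map S.g = trivialToRes hi ≫ (restriction i hi).map t)
    (hg : g ≫ (restriction j hj).map S.g = trivialToRes hj ≫ (restriction j hj).map t) :
    ∃ s : trivialModule k H ⟶ S.X₂, s ≫ S.g = t := by
  have := hS.mono_f
  have map_f : S.g.lin (evalOne hi f) = t.lin (1 : k) := by
    rw [← evalOne_comp, hf, evalOne_trivialToRes_comp]
  have map_g : S.g.lin (evalOne hj g) = t.lin (1 : k) := by
    rw [← evalOne_comp, hg, evalOne_trivialToRes_comp]
  obtain ⟨q, hq⟩ := ker_le_range_of_shortExact hS (show evalOne hi f - evalOne hj g ∈ _ by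
    rw [LinearMap.mem_ker, map_sub, map_f, map_g, sub_self])
  have q_mem : q ∈ coinvariants S.X₁ := mem_coinvariants_of_map_mem S.f
    (hq ▸ sub_mem (evalOne_mem hi f).1 (evalOne_mem hj g).1)
  obtain ⟨a, ha, b, hb, rfl⟩ := Submodule.mem_sup.1 (h₁ q_mem)
  have eq_common : evalOne hi f - S.f.lin a = evalOne hj g + S.f.lin b := by
    rw [map_add] at hq
    rw [sub_eq_iff_eq_add, add_assoc, add_comm (S.f.lin b), hq]
    abel
  obtain ⟨s, hs⟩ := exists_hom_of_mem_invariants hij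
    (sub_mem (evalOne_mem hi f) (map_mem_invariants S.f ha))
    (eq_common ▸ add_mem (evalOne_mem hj g) (map_mem_invariants S.f hb))
  have g_f : S.g.lin (S.f.lin a) = 0 := LinearMap.congr_fun (congrArg Hom.lin S.zero) a
  refine ⟨s, hom_ext_one ((congrArg S.g.lin hs).trans ?_)⟩
  rw [map_sub, map_f, g_f, sub_zero]

theorem exists_decomposition_trivialModule
    (hij : IsAlgCoprod (i : A →ₐ[k] H) (j : B →ₐ[k] H)) {l : H →ₗ[k] k} (h1 : l 1 = 1)
    (hl : LeftInvariant l) {M N : YetterDrinfeld k H} (p : M ⟶ N) [Epi p]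
    (hM : coinvariants M ≤ invariants i M ⊔ invariants j M)
    (a : trivialModule k A ⟶ (restriction i hi).obj N)
    (b : trivialModule k B ⟶ (restriction j hj).obj N) :
    ∃ (t : trivialModule k H ⟶ N) (f : trivialModule k A ⟶ (restriction i hi).obj M)
      (g : trivialModule k B ⟶ (restriction j hj).obj M),
      a = trivialToRes hi ≫ (restriction i hi).map t + f ≫ (restriction i hi).map p ∧
      b = trivialToRes hj ≫ (restriction j hj).map t + g ≫ (restriction j hj).map p := by
  have ha := evalOne_mem hi a
  have hb := evalOne_mem hj b
  obtain ⟨c, hc, hcp⟩ := exists_coinvariant_lift h1 hl p (sub_mem ha.1 hb.1)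
  obtain ⟨x, hx, y, hy, rfl⟩ := Submodule.mem_sup.1 (hM hc)
  have eq_common : evalOne hi a - p.lin x = evalOne hj b + p.lin y := by
    rw [map_add] at hcp
    rw [sub_eq_iff_eq_add, add_assoc, add_comm (p.lin y), hcp]
    abel
  obtain ⟨t, ht⟩ := exists_hom_of_mem_invariants hij (sub_mem ha (map_mem_invariants p hx))
    (eq_common ▸ add_mem hb (map_mem_invariants p hy))
  refine ⟨t, homOfInvariant hi hx, homOfInvariant hj (neg_mem hy), hom_ext_evalOne hi ?_,
    hom_ext_evalOne hj ?_⟩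
  · rw [evalOne_add, evalOne_trivialToRes_comp, evalOne_comp, evalOne_homOfInvariant, ht]
    abel
  · rw [evalOne_add, evalOne_trivialToRes_comp, evalOne_comp, evalOne_homOfInvariant, ht,
      eq_common, map_neg]
    abel

end Coproduct

end YetterDrinfeld

/-! ### Dimension shifting along a pair of exact functors -/

section DimensionShift

open CategoryTheory.Abelian CategoryTheory.Abelian.Ext

section ExtClass

variable {C : Type*} [Category* C] [Abelian C] [HasExt.{u} C] {S : ShortComplex C}
  (hS : S.ShortExact)
include hS

theorem exists_comp_extClass [Injective S.X₂] (T : C) {n : ℕ} (x : Ext T S.X₁ (n + 1)) :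
    ∃ y : Ext T S.X₃ n, y.comp hS.extClass rfl = x :=
  covariant_sequence_exact₁ T hS x (eq_zero_of_injective _) rfl

theorem eq_zero_of_comp_extClass [Injective S.X₂] {T : C} {n : ℕ} (x : Ext T S.X₃ (n + 1))
    (hx : x.comp hS.extClass rfl = 0) : x = 0 := by
  obtain ⟨y, rfl⟩ := covariant_sequence_exact₃ T hS x rfl hx
  rw [eq_zero_of_injective y, Ext.zero_comp]

theorem exists_mk₀_comp_extClass [Injective S.X₂] {T : C} (x : Ext T S.X₁ 1) :
    ∃ t : T ⟶ S.X₃, (mk₀ t).comp hS.extClass (zero_add 1) = x := by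
  obtain ⟨y, rfl⟩ := exists_comp_extClass hS T x
  obtain ⟨t, rfl⟩ := (mk₀_bijective _ _).2 y
  exact ⟨t, rfl⟩

theorem mk₀_comp_extClass_eq_zero_iff {T : C} (t : T ⟶ S.X₃) :
    (mk₀ t).comp hS.extClass (zero_add 1) = 0 ↔ ∃ s : T ⟶ S.X₂, s ≫ S.g = t := by
  constructor
  · intro h
    obtain ⟨y, hy⟩ := covariant_sequence_exact₃ T hS (mk₀ t) (zero_add 1) h
    obtain ⟨s, rfl⟩ := (mk₀_bijective _ _).2 y
    refine ⟨s, (mk₀_bijective _ _).1 ?_⟩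
    rw [← hy, mk₀_comp_mk₀]
  · rintro ⟨s, rfl⟩
    rw [← mk₀_comp_mk₀, comp_assoc_of_second_deg_zero, hS.comp_extClass, Ext.comp_zero]

theorem mk₀_add_comp_comp_extClass {T : C} (t : T ⟶ S.X₃) (s : T ⟶ S.X₂) :
    (mk₀ (t + s ≫ S.g)).comp hS.extClass (zero_add 1) =
      (mk₀ t).comp hS.extClass (zero_add 1) := by
  rw [mk₀_add, add_comp, (mk₀_comp_extClass_eq_zero_iff hS (s ≫ S.g)).2 ⟨s, rfl⟩, add_zero]

end ExtClass

section ExactFunctor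

variable {C D : Type*} [Category* C] [Category* D] [Abelian C] [Abelian D] [HasExt.{u} C]
  [HasExt.{u} D] (k : Type*) [CommRing k] [Linear k C] [Linear k D] (F : C ⥤ D) [F.Additive]
  [F.Linear k] [PreservesFiniteLimits F] [PreservesFiniteColimits F] {T : C} {T' : D}
  (v : T' ⟶ F.obj T)

/-- The map induced on `Ext` by an exact functor `F` and a morphism `T' ⟶ F.obj T`. -/
def extMapAlong (M : C) (n : ℕ) : Ext T M n →ₗ[k] Ext T' (F.obj M) n :=
  (mk₀ v).precompOfLinear k (F.obj M) (zero_add n) ∘ₗ F.mapExtLinearMap k T M n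

theorem extMapAlong_apply {M : C} {n : ℕ} (x : Ext T M n) :
    extMapAlong k F v M n x = (mk₀ v).comp (x.mapExactFunctor F) (zero_add n) := rfl

theorem extMapAlong_comp {M N : C} {n m p : ℕ} (x : Ext T M n) (y : Ext M N m) (h : n + m = p) :
    extMapAlong k F v N p (x.comp y h) =
      (extMapAlong k F v M n x).comp (y.mapExactFunctor F) h := by
  rw [extMapAlong_apply, extMapAlong_apply, mapExactFunctor_comp,
    comp_assoc _ _ _ (zero_add n) h (by omega)]

theorem extMapAlong_comp_extClass {S : ShortComplex C} (hS : S.ShortExact) {n m : ℕ}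
    (x : Ext T S.X₃ n) (h : n + 1 = m) :
    extMapAlong k F v S.X₁ m (x.comp hS.extClass h) =
      (extMapAlong k F v S.X₃ n x).comp (hS.map_of_exact F).extClass h := by
  rw [extMapAlong_comp, mapExactFunctor_extClass]
  rfl

theorem extMapAlong_mk₀ {M : C} (t : T ⟶ M) :
    extMapAlong k F v M 0 (mk₀ t) = mk₀ (v ≫ F.map t) := by
  rw [extMapAlong_apply, mapExactFunctor_mk₀, mk₀_comp_mk₀]

theorem extMapAlong_comp_mk₀ {M N : C} {n : ℕ} (f : M ⟶ N) (x : Ext T M n) :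
    extMapAlong k F v N n (x.comp (mk₀ f) (add_zero n)) =
      (extMapAlong k F v M n x).comp (mk₀ (F.map f)) (add_zero n) := by
  rw [extMapAlong_comp, mapExactFunctor_mk₀]

theorem extMapAlong_mk₀_comp_extClass {S : ShortComplex C} (hS : S.ShortExact) (t : T ⟶ S.X₃) :
    extMapAlong k F v S.X₁ 1 ((mk₀ t).comp hS.extClass (zero_add 1)) =
      (mk₀ (v ≫ F.map t)).comp (hS.map_of_exact F).extClass (zero_add 1) := by
  rw [extMapAlong_comp_extClass, extMapAlong_mk₀]

end ExactFunctor

section Pair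

variable {C D E : Type*} [Category* C] [Category* D] [Category* E] [Abelian C] [Abelian D]
  [Abelian E] [HasExt.{u} C] [HasExt.{u} D] [HasExt.{u} E] (k : Type*) [CommRing k] [Linear k C]
  [Linear k D] [Linear k E]
  (F : C ⥤ D) [F.Additive] [F.Linear k] [PreservesFiniteLimits F] [PreservesFiniteColimits F]
  (G : C ⥤ E) [G.Additive] [G.Linear k] [PreservesFiniteLimits G] [PreservesFiniteColimits G]
  {T : C} {T' : D} {T'' : E} (v : T' ⟶ F.obj T) (w : T'' ⟶ G.obj T)

/-- The pair of maps induced on `Ext` by two exact functors. -/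
def extMapAlongPair (M : C) (n : ℕ) :
    Ext T M n →ₗ[k] Ext T' (F.obj M) n × Ext T'' (G.obj M) n :=
  (extMapAlong k F v M n).prod (extMapAlong k G w M n)

variable {S : ShortComplex C} [Injective S.X₂] [hF : Injective (F.obj S.X₂)]
  [hG : Injective (G.obj S.X₂)] (hS : S.ShortExact)
include hS

theorem extMapAlongPair_bijective_succ {n : ℕ}
    (h : Function.Bijective (extMapAlongPair k F G v w S.X₃ (n + 1))) :
    Function.Bijective (extMapAlongPair k F G v w S.X₁ (n + 2)) := by
  have : Injective (S.map F).X₂ := hF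
  have : Injective (S.map G).X₂ := hG
  constructor
  · refine (injective_iff_map_eq_zero _).2 fun x hx => ?_
    obtain ⟨y, rfl⟩ := exists_comp_extClass hS T x
    obtain ⟨hx₁, hx₂⟩ := Prod.ext_iff.1 hx
    have hy : y = 0 := (injective_iff_map_eq_zero _).1 h.1 y (Prod.ext
      (eq_zero_of_comp_extClass _ _ ((extMapAlong_comp_extClass k F v hS y rfl).symm.trans hx₁))
      (eq_zero_of_comp_extClass _ _ ((extMapAlong_comp_extClass k G w hS y rfl).symm.trans hx₂)))
    rw [hy, Ext.zero_comp]
  · rintro ⟨x₁, x₂⟩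
    obtain ⟨y₁, rfl⟩ := exists_comp_extClass (hS.map_of_exact F) T' x₁
    obtain ⟨y₂, rfl⟩ := exists_comp_extClass (hS.map_of_exact G) T'' x₂
    obtain ⟨y, hy⟩ := h.2 (y₁, y₂)
    obtain ⟨rfl, rfl⟩ := Prod.ext_iff.1 hy
    exact ⟨y.comp hS.extClass rfl, Prod.ext (extMapAlong_comp_extClass k F v hS y rfl)
      (extMapAlong_comp_extClass k G w hS y rfl)⟩

theorem extMapAlongPair_bijective_one
    (hlift : ∀ (t : T ⟶ S.X₃) (f : T' ⟶ F.obj S.X₂) (g : T'' ⟶ G.obj S.X₂),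
      f ≫ F.map S.g = v ≫ F.map t → g ≫ G.map S.g = w ≫ G.map t → ∃ s : T ⟶ S.X₂, s ≫ S.g = t)
    (hdec : ∀ (a : T' ⟶ F.obj S.X₃) (b : T'' ⟶ G.obj S.X₃), ∃ (t : T ⟶ S.X₃)
      (f : T' ⟶ F.obj S.X₂) (g : T'' ⟶ G.obj S.X₂), a = v ≫ F.map t + f ≫ F.map S.g ∧
        b = w ≫ G.map t + g ≫ G.map S.g) :
    Function.Bijective (extMapAlongPair k F G v w S.X₁ 1) := by
  have : Injective (S.map F).X₂ := hF
  have : Injective (S.map G).X₂ := hG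
  constructor
  · refine (injective_iff_map_eq_zero _).2 fun x hx => ?_
    obtain ⟨t, rfl⟩ := exists_mk₀_comp_extClass hS x
    obtain ⟨hx₁, hx₂⟩ := Prod.ext_iff.1 hx
    obtain ⟨f, hf⟩ := (mk₀_comp_extClass_eq_zero_iff (hS.map_of_exact F) _).1
      ((extMapAlong_mk₀_comp_extClass k F v hS t).symm.trans hx₁)
    obtain ⟨g, hg⟩ := (mk₀_comp_extClass_eq_zero_iff (hS.map_of_exact G) _).1
      ((extMapAlong_mk₀_comp_extClass k G w hS t).symm.trans hx₂)
    exact (mk₀_comp_extClass_eq_zero_iff hS t).2 (hlift t f g hf hg)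
  · rintro ⟨x₁, x₂⟩
    obtain ⟨a, rfl⟩ := exists_mk₀_comp_extClass (hS.map_of_exact F) x₁
    obtain ⟨b, rfl⟩ := exists_mk₀_comp_extClass (hS.map_of_exact G) x₂
    obtain ⟨t, f, g, rfl, rfl⟩ := hdec a b
    exact ⟨(mk₀ t).comp hS.extClass (zero_add 1), Prod.ext
      ((extMapAlong_mk₀_comp_extClass k F v hS t).trans
        (mk₀_add_comp_comp_extClass (hS.map_of_exact F) _ f).symm)
      ((extMapAlong_mk₀_comp_extClass k G w hS t).trans
        (mk₀_add_comp_comp_extClass (hS.map_of_exact G) _ g).symm)⟩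

end Pair

end DimensionShift

/-! ### Cohomology of a coproduct -/

namespace YetterDrinfeld

variable {k A B H : Type u} [Field k] [Ring A] [HopfAlgebra k A] [Ring B] [HopfAlgebra k B]
  [Ring H] [HopfAlgebra k H] {i : A →ₐc[k] H} {j : B →ₐc[k] H}
  (hij : IsAlgCoprod (i : A →ₐ[k] H) (j : B →ₐ[k] H))
  (hi : Function.Injective i) (hj : Function.Injective j)
  [PreservesFiniteLimits (restriction i hi)] [PreservesFiniteColimits (restriction i hi)]
  [PreservesFiniteLimits (restriction j hj)] [PreservesFiniteColimits (restriction j hj)]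
  {l : H →ₗ[k] k} (h1 : l 1 = 1) (hl : LeftInvariant l)
include hij h1 hl

theorem extMapAlongPair_restriction_bijective_one {M : YetterDrinfeld k H}
    (hM : coinvariants M ≤ invariants i M ⊔ invariants j M) :
    Function.Bijective (extMapAlongPair k (restriction i hi) (restriction j hj)
      (trivialToRes hi) (trivialToRes hj) M 1) := by
  obtain ⟨I, Q, f, g, w, hS, hI, hIi, hIj, hle⟩ := exists_shortExact_injective hij hi hj M
  have := hS.epi_g
  exact extMapAlongPair_bijective_one k (restriction i hi) (restriction j hj) _ _
    (S := .mk f g w) hS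
    (exists_lift_trivialModule hi hj hij hS hM)
    (exists_decomposition_trivialModule hi hj hij h1 hl g hle)

theorem extMapAlongPair_restriction_bijective (n : ℕ) (M : YetterDrinfeld k H) :
    Function.Bijective (extMapAlongPair k (restriction i hi) (restriction j hj)
      (trivialToRes hi) (trivialToRes hj) M (n + 2)) := by
  induction n generalizing M with
  | zero =>
    obtain ⟨I, Q, f, g, w, hS, hI, hIi, hIj, hle⟩ := exists_shortExact_injective hij hi hj M
    have := hS.epi_g
    exact extMapAlongPair_bijective_succ k (restriction i hi) (restriction j hj) _ _
      (S := .mk f g w) hS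
      (extMapAlongPair_restriction_bijective_one hij hi hj h1 hl
        (coinvariants_le_of_epi h1 hl g hle))
  | succ n ih =>
    obtain ⟨I, Q, f, g, w, hS, hI, hIi, hIj, -⟩ := exists_shortExact_injective hij hi hj M
    exact extMapAlongPair_bijective_succ k (restriction i hi) (restriction j hj) _ _
      (S := .mk f g w) hS (ih Q)

end YetterDrinfeld

open YetterDrinfeld in
theorem theorem5_general {k : Type u} [Field k] {A B H : Type u} [Ring A] [HopfAlgebra k A]
    [Ring B] [HopfAlgebra k B] [Ring H] [HopfAlgebra k H] {i : A →ₐc[k] H} {j : B →ₐc[k] H}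
    (hij : IsAlgCoprod (i : A →ₐ[k] H) (j : B →ₐ[k] H)) (hi : Function.Injective i)
    (hj : Function.Injective j) (hA : IsCosemisimple k A) (hB : IsCosemisimple k B) (n : ℕ)
    (hn : 2 ≤ n) :
    ∃ e : ∀ M : YetterDrinfeld k H, HGS n M ≃ₗ[k]
        HGS n ((restriction i hi).obj M) × HGS n ((restriction j hj).obj M),
      ∀ (M N : YetterDrinfeld k H) (f : M ⟶ N) (x : HGS n M),
        e N (HGS.map n f x) =
          (HGS.map n ((restriction i hi).map f) (e M x).1,
            HGS.map n ((restriction j hj).map f) (e M x).2) := by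
  obtain ⟨n, rfl⟩ := Nat.exists_eq_add_of_le' hn
  obtain ⟨_, _⟩ := restriction_isExact hij hi hA hB
  obtain ⟨_, _⟩ := restriction_isExact hij.symm hj hB hA
  obtain ⟨l, h1, hl⟩ := hij.exists_leftInvariant hA hB
  exact ⟨fun M => LinearEquiv.ofBijective _
      (extMapAlongPair_restriction_bijective hij hi hj h1 hl n M),
    fun M N f x => _root_.Prod.ext
      (extMapAlong_comp_mk₀ k (restriction i hi) (trivialToRes hi) f x)
      (extMapAlong_comp_mk₀ k (restriction j hj) (trivialToRes hj) f x)⟩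

end

theorem theorem5 {k : Type u} [Field k] [IsAlgClosed k] [CharZero k]
    {A B : Type u} [Ring A] [Ring B] [HopfAlgebra k A] [HopfAlgebra k B]
    (hA : IsCosemisimple k A) (hB : IsCosemisimple k B) (n : ℕ) (hn : 2 ≤ n) :
    ∃ e : ∀ M : YetterDrinfeld k (FreeProd k A B),
        HGS n M ≃ₗ[k] HGS n ((resLeft k A B).obj M) × HGS n ((resRight k A B).obj M),
      ∀ (M N : YetterDrinfeld k (FreeProd k A B)) (f : M ⟶ N) (x : HGS n M),
        e N (HGS.map n f x) =
          (HGS.map n ((resLeft k A B).map f) (e M x).1,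
            HGS.map n ((resRight k A B).map f) (e M x).2) :=
  theorem5_general (i := FreeProd.inlBialg k A B) (j := FreeProd.inrBialg k A B)
    FreeProd.isAlgCoprod (FreeProd.inlBialg_injective k A B) (FreeProd.inrBialg_injective k A B)
    hA hB n hn
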